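/- **Setting.** Call $\varphi:\mathbb R\to\mathbb R$ sigmoidal if it is monotone, has distinct finite limits at $\pm\infty$, and is $C^3$ with bounded derivatives of orders $1,2,3$. Consider one-hidden-layer perceptrons with sigmoidal activation $\varphi$, $d'$ inputs, $h$ hidden units and $d$ outputs, $$F_W(z)_i=\beta_i+\sum_{j=1}^h a_{ij}\,\varphi\Big(\sum_{m=1}^{d'} w_{jm}z_m+b_j\Big),\qquad 1\le i\le d,$$ where $W\in\mathbb R^s$ collects the $s$ weights $\beta_i,a_{ij},w_{jm},b_j$ that the architecture allows to be non-null (any fixed subset of all the weights; the others are $0$). Let $(Y_t,Z_t)_{t\ge1}$ be i.i.d. random vectors in $\mathbb R^d\times\mathbb R^{d'}$, with generic variable $(Y,Z)$, such that $Y_t=F_{W^0}(Z_t)+\varepsilon_t$, where the noise $\varepsilon$ (generic variable of $\varepsilon_t$) is independent of $Z$, centered, and has an invertible covariance matrix $\Gamma_0=E(\varepsilon\varepsilon^T)$. Let $\Theta\subset\mathbb R^s$ be compact with $W^0\in\Theta$. Assume that the model is identifiable up to a finite group $G$ of homeomorphisms of $\mathbb R^s$ that leave the perceptron functions invariant ($F_{gW}=F_W$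 for all $g\in G$ and all $W$): if $W\in\Theta$ and $F_W(Z)=F_{W^0}(Z)$ a.s., then $W=gW^0$ for some $g\in G$. Put $$\Gamma_n(W)=\frac1n\sum_{t=1}^n (Y_t-F_W(Z_t))(Y_t-F_W(Z_t))^T,\qquad U_n(W)=\ln\det\Gamma_n(W),$$ and let $\hat W_n$ be a random vector with values in $\Theta$ which a.s. minimizes $U_n$ over $\Theta$ whenever $\Gamma_n(W)$ is invertible for all $W\in\Theta$. Parameters being considered modulo $G$, $\hat W_n$ is taken to be, among the elements of its $G$-orbit that lie in $\Theta$, one that is closest to $W^0$. **Theorem.** Assume that $E(\|\varepsilon\|^2)<\infty$ and $E(\|Z\|^3)<\infty$. Let $\nabla U_n(W^0)$ and $HU_n(W^0)$ be the gradient and the Hessian matrix of $U_n$ at $W^0$, and let $I_0$ be the $s\times s$ matrix with entries $$(I_0)_{kl}=\operatorname{tr}\left(\Gamma_0^{-1}\,E\left(\frac{\partial F_{W^0}(Z)}{\partial W_k}\,\frac{\partial F_{W^0}(Z)}{\partial W_l}^{T}\right)\right).$$ Then these expectations are well defined, $I_0$ is positive semidefinite, a.s. $U_n$ is $C^2$ near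 $W^0$ for all large $n$, and 1. $HU_n(W^0)\to 2I_0$ almost surely; 2. $\sqrt n\,\nabla U_n(W^0)\to\mathcal N(0,4I_0)$ in law; 3. if moreover $W^0$ is an interior point of $\Theta$ and $I_0$ is invertible, then $\sqrt n\,(\hat W_n-W^0)\to\mathcal N(0,I_0^{-1})$ in law. -/

import Mathlib

open MeasureTheory ProbabilityTheory Filter Topology

noncomputable section

namespace MLPRegression

/-- A sigmoidal activation function: a monotone function with distinct finite limits at `-∞` and
`+∞` which is three times continuously differentiable with bounded derivatives up to order three
(hyperbolic tangent, logistic function, arctangent, ...). -/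
structure IsSigmoidal (φ : ℝ → ℝ) : Prop where
  contDiff : ContDiff ℝ 3 φ
  monotone : Monotone φ
  limits : ∃ a b : ℝ, a < b ∧ Tendsto φ atBot (𝓝 a) ∧ Tendsto φ atTop (𝓝 b)
  bounded_deriv : ∀ m : ℕ, 1 ≤ m → m ≤ 3 → ∃ C : ℝ, ∀ x : ℝ, |iteratedDeriv m φ x| ≤ C

/-- The possible weights of a perceptron with `p` inputs, `h` hidden units and `d` outputs, in this
order: output biases, hidden-to-output weights, input-to-hidden weights, hidden biases. -/
abbrev WeightIndex (d p h : ℕ) : Type :=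
  Fin d ⊕ (Fin d × Fin h) ⊕ (Fin h × Fin p) ⊕ Fin h

/-- The weight at position `i`, when only the weights in `A` are free and the others are null. -/
def weightAt {d p h : ℕ} (A : Finset (WeightIndex d p h)) (W : EuclideanSpace ℝ A)
    (i : WeightIndex d p h) : ℝ :=
  if hi : i ∈ A then W ⟨i, hi⟩ else 0

/-- The one hidden layer perceptron with architecture `A` (the set of its non-null weights;
`A = Finset.univ` is the fully connected perceptron) and weight vector `W`:
`F_W(z)_i = β_i + ∑_j a_{ij} φ(∑_m w_{jm} z_m + b_j)`. -/
def mlp {d p h : ℕ} (φ : ℝ → ℝ) (A : Finset (WeightIndex d p h)) (W : EuclideanSpace ℝ A)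
    (z : EuclideanSpace ℝ (Fin p)) : EuclideanSpace ℝ (Fin d) :=
  WithLp.toLp 2 fun i : Fin d =>
    weightAt A W (Sum.inl i) +
      ∑ j : Fin h, weightAt A W (Sum.inr (Sum.inl (i, j))) *
        φ (∑ m : Fin p, weightAt A W (Sum.inr (Sum.inr (Sum.inl (j, m)))) * z m +
          weightAt A W (Sum.inr (Sum.inr (Sum.inr j))))

/-- The empirical error covariance matrix
`Γ_n(W) = (1/n) ∑ (y_t - F_W(z_t)) (y_t - F_W(z_t))ᵀ`, the sum being over the first `n` indices. -/
def empCov {d : ℕ} {E X : Type*} (F : E → X → EuclideanSpace ℝ (Fin d))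
    (y : ℕ → EuclideanSpace ℝ (Fin d)) (z : ℕ → X) (n : ℕ) (W : E) : Matrix (Fin d) (Fin d) ℝ :=
  (n : ℝ)⁻¹ • ∑ t ∈ Finset.range n,
    Matrix.vecMulVec (WithLp.ofLp (y t - F W (z t))) (WithLp.ofLp (y t - F W (z t)))

/-- The cost function `U_n(W) = ln det Γ_n(W)`. -/
def logDetCost {d : ℕ} {E X : Type*} (F : E → X → EuclideanSpace ℝ (Fin d))
    (y : ℕ → EuclideanSpace ℝ (Fin d)) (z : ℕ → X) (n : ℕ) (W : E) : ℝ :=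
  Real.log (empCov F y z n W).det

/-- The partial derivative `∂f/∂W_k`. -/
def partialDeriv {ι V : Type*} [Fintype ι] [DecidableEq ι] [NormedAddCommGroup V]
    [NormedSpace ℝ V] (k : ι) (f : EuclideanSpace ℝ ι → V) (W : EuclideanSpace ℝ ι) : V :=
  fderiv ℝ f W (EuclideanSpace.single k 1)

/-- The Hessian matrix `(∂²f/∂W_k∂W_l)_{k,l}`. -/
def hessianMatrix {ι : Type*} [Fintype ι] [DecidableEq ι] (f : EuclideanSpace ℝ ι → ℝ)
    (W : EuclideanSpace ℝ ι) : Matrix ι ι ℝ :=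
  Matrix.of fun k l => partialDeriv l (partialDeriv k f) W

/-- The matrix `E(ξ ξᵀ)`, which is the covariance matrix of `ξ` when `ξ` is centered. -/
def secondMoment {Ω : Type*} [MeasurableSpace Ω] {d : ℕ} (P : Measure Ω)
    (ξ : Ω → EuclideanSpace ℝ (Fin d)) : Matrix (Fin d) (Fin d) ℝ :=
  Matrix.of fun i j => ∫ ω, ξ ω i * ξ ω j ∂P

/-- The matrix `E(B(W_k, W_l))` with `B(W_k, W_l) = ∂F_W(Z)/∂W_k (∂F_W(Z)/∂W_l)ᵀ`. -/
def meanB {Ω X ι : Type*} [MeasurableSpace Ω] [Fintype ι] [DecidableEq ι] {d : ℕ} (P : Measure Ω)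
    (F : EuclideanSpace ℝ ι → X → EuclideanSpace ℝ (Fin d)) (Z : Ω → X)
    (W : EuclideanSpace ℝ ι) (k l : ι) : Matrix (Fin d) (Fin d) ℝ :=
  Matrix.of fun i j => ∫ ω, partialDeriv k (fun V => F V (Z ω)) W i *
    partialDeriv l (fun V => F V (Z ω)) W j ∂P

/-- The matrix with entries `tr(Γ⁻¹ E(B(W_k, W_l)))`. -/
def infoMatrix {Ω X ι : Type*} [MeasurableSpace Ω] [Fintype ι] [DecidableEq ι] {d : ℕ}
    (P : Measure Ω) (F : EuclideanSpace ℝ ι → X → EuclideanSpace ℝ (Fin d)) (Z : Ω → X)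
    (Γ : Matrix (Fin d) (Fin d) ℝ) (W : EuclideanSpace ℝ ι) : Matrix ι ι ℝ :=
  Matrix.of fun k l => (Γ⁻¹ * meanB P F Z W k l).trace

end MLPRegression

end

open scoped Asymptotics

noncomputable section

namespace MLPRegression

/-! The residual of an observation at `W` is `F_{W⁰}(Z) + ε - F_W(Z)`, so `Γ_n(W)` is an average
`G_n(W)` of i.i.d. smooth functions of `W` (`residualProd`) and `U_n = L ∘ G_n` with `L = ln det`.
Laws for `G_n` and its first two derivatives, together with the chain rule, give everything.

Each derivative in `W` costs at most a factor `1 + ‖Z‖`, and the noise contributes at most `(1 +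
‖ε‖)²`. By independence the product `(1 + ‖ε‖)² (1 + ‖Z‖)³` is integrable
(`isDominatedC3_residualProd`). Hence `G_n`, `DG_n` and `D²G_n` are averages of locally Lipschitz
functions with integrable constants, and the law of large numbers holds locally uniformly in `W`
(`ae_tendsto_average_locally_uniform`).

At `W⁰`, `G_n` tends to `Γ₀`; `DG_n` tends to `0`, since its terms are noise times a function of
`Z`; and `D²G_n` keeps only the products of first derivatives of `F`. In `D²U_n = DL(D²G_n) +
D²L(DG_n, DG_n)` the last term therefore vanishes in the limit, and `DL(Γ₀)N = tr(Γ₀⁻¹N)` gives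
`2I₀`.

For the gradient, `√n ∇U_n(W⁰)` is an almost surely convergent linear map applied to a normalized
centered sum, so the central limit theorem and Slutsky's argument apply. The score of one
observation has coordinates `-2 (Γ₀⁻¹ε)ᵀ ∂F/∂W_k`, and `Γ₀⁻¹ε` has covariance `Γ₀⁻¹`, whence `4I₀`
(`momentMatrix_score`).

For consistency, `Γ_n(W)` tends to `Γ₀ + E(ΔΔᵀ)` with `Δ = F_{W⁰}(Z) - F_W(Z)`. The determinant
increases strictly when a nonzero positive semidefinite matrix is added to a positive definite one
(`det_lt_det_add`), so the limit cost is minimal in `Θ` only on the orbit of `W⁰`, and the choice of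
representative selects `W⁰` (`tendsto_of_isMinOn_log`). The mean value inequality turns `∇U_n(Ŵ_n) =
0` into `∇U_n(W⁰) + 2I₀(Ŵ_n - W⁰) = o(Ŵ_n - W⁰)`, and the limit covariance is `(2I₀)⁻¹ (4I₀) (2I₀)⁻¹
= I₀⁻¹`. -/

/-- The empirical mean of a function which depends on a parameter `W`. -/
def sampleMean {S E V : Type*} [AddCommGroup V] [Module ℝ V] (f : S → E → V) (x : ℕ → S) (n : ℕ)
    (W : E) : V :=
  (n : ℝ)⁻¹ • ∑ t ∈ Finset.range n, f (x t) W

/-! ### Limit theorems: uniform law of large numbers, vector central limit theorem, negligible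
remainders. -/

section LimitTheorems

set_option linter.unusedSectionVars false

variable {Ω : Type*} [MeasurableSpace Ω] {P : Measure Ω} [IsProbabilityMeasure P]

/-- A strong law of large numbers which holds locally uniformly in a parameter `W`, for a summand
that is locally Lipschitz in the parameter with an integrable Lipschitz constant. -/
theorem ae_tendsto_average_locally_uniform {S E V : Type*} [MeasurableSpace S]
    [NormedAddCommGroup E] [SecondCountableTopology E]
    [NormedAddCommGroup V] [NormedSpace ℝ V] [CompleteSpace V] [MeasurableSpace V] [BorelSpace V]
    [SecondCountableTopology V]
    {X : ℕ → Ω → S} (hindep : iIndepFun X P) (hident : ∀ t, IdentDistrib (X t) (X 0) P P)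
    {g : S → E → V} (hmeas : ∀ W, Measurable fun x => g x W)
    (hbound : ∀ R : ℝ, ∃ K : S → ℝ, Measurable K ∧ Integrable (fun ω => K (X 0 ω)) P ∧
      ∀ x, ∀ W ∈ Metric.closedBall (0 : E) R, ‖g x W‖ ≤ K x ∧
        ∀ W' ∈ Metric.closedBall (0 : E) R, ‖g x W - g x W'‖ ≤ K x * ‖W - W'‖) :
    ∀ᵐ ω ∂P, ∀ W₁ : E, Tendsto
      (fun q : ℕ × E => sampleMean g (fun t => X t ω) q.1 q.2)
      (atTop ×ˢ 𝓝 W₁) (𝓝 (∫ ω, g (X 0 ω) W₁ ∂P)) := by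
  unfold sampleMean
  choose K hKm hKi hK using hbound
  have hint : ∀ W, Integrable (fun ω => g (X 0 ω) W) P := fun W =>
    (hKi ‖W‖).mono' ((hmeas W).comp_aemeasurable (hident 0).aemeasurable_fst).aestronglyMeasurable
      (Eventually.of_forall fun ω => (hK ‖W‖ _ W (by simp)).1)
  -- Only integer radii and the points of a dense sequence are used, so that countably many strong
  -- laws share one null set.
  have lln₁ : ∀ᵐ ω ∂P, ∀ R : ℕ, Tendsto
      (fun n : ℕ => (n : ℝ)⁻¹ • ∑ t ∈ Finset.range n, K R (X t ω)) atTop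
      (𝓝 (∫ ω, K R (X 0 ω) ∂P)) := ae_all_iff.2 fun R =>
    strong_law_ae (fun t ω => K R (X t ω)) (hKi R)
      (fun i j hij => (hindep.indepFun hij).comp (hKm R) (hKm R)) fun i => (hident i).comp (hKm R)
  have lln₂ : ∀ᵐ ω ∂P, ∀ m : ℕ, Tendsto
      (fun n : ℕ => (n : ℝ)⁻¹ • ∑ t ∈ Finset.range n, g (X t ω) (TopologicalSpace.denseSeq E m))
      atTop (𝓝 (∫ ω, g (X 0 ω) (TopologicalSpace.denseSeq E m) ∂P)) :=
    ae_all_iff.2 fun m => strong_law_ae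
      (fun t ω => g (X t ω) (TopologicalSpace.denseSeq E m)) (hint _)
      (fun i j hij => (hindep.indepFun hij).comp (hmeas _) (hmeas _))
      fun i => (hident i).comp (hmeas _)
  filter_upwards [lln₁, lln₂] with ω h₁ h₂ W₁
  obtain ⟨R, hR⟩ := exists_nat_ge (‖W₁‖ + 1)
  set k := ∫ ω, K R (X 0 ω) ∂P with hk
  have hk0 : 0 ≤ k := integral_nonneg fun ω =>
    (norm_nonneg _).trans (hK R (X 0 ω) W₁ (by simp; linarith)).1
  rw [Metric.tendsto_nhds]
  intro η hη
  -- Error budget, with `q` a dense point within `δ` of `W₁`: replacing `W` by `q` in the empirical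
  -- mean costs at most `(k + 1) * (2 * δ)`, and replacing `q` by `W₁` in the expectation at most `k
  -- * δ`. The sum is `(3 * k + 2) * δ`; the other `η / 2` is for the law of large numbers at `q`.
  obtain ⟨δ, hδ0, hδ1, hδ⟩ : ∃ δ : ℝ, 0 < δ ∧ δ ≤ 1 ∧ (3 * k + 2) * δ < η / 2 := by
    refine ⟨min 1 (η / (4 * (3 * k + 2))), by positivity, min_le_left _ _, ?_⟩
    calc (3 * k + 2) * min 1 (η / (4 * (3 * k + 2)))
        ≤ (3 * k + 2) * (η / (4 * (3 * k + 2))) := by gcongr; exact min_le_right _ _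
      _ = η / 4 := by field_simp
      _ < η / 2 := by linarith
  obtain ⟨m, hm⟩ : ∃ m, dist W₁ (TopologicalSpace.denseSeq E m) < δ :=
    (TopologicalSpace.denseRange_denseSeq E).exists_dist_lt W₁ hδ0
  set q := TopologicalSpace.denseSeq E m
  have hball : ∀ W, dist W W₁ ≤ 1 → W ∈ Metric.closedBall (0 : E) R := by
    intro W hW
    rw [mem_closedBall_zero_iff]
    calc ‖W‖ = ‖(W - W₁) + W₁‖ := by simp
      _ ≤ ‖W - W₁‖ + ‖W₁‖ := norm_add_le _ _
      _ ≤ 1 + ‖W₁‖ := by gcongr; rwa [← dist_eq_norm]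
      _ ≤ R := by linarith
  have hq : q ∈ Metric.closedBall (0 : E) R := hball q (by rw [dist_comm]; linarith)
  have hW₁ : W₁ ∈ Metric.closedBall (0 : E) R := hball W₁ (by simp)
  have e₁ : ∀ᶠ n : ℕ in atTop, (n : ℝ)⁻¹ • ∑ t ∈ Finset.range n, K R (X t ω) < k + 1 :=
    (h₁ R).eventually (gt_mem_nhds (by linarith))
  have e₂ : ∀ᶠ n : ℕ in atTop, dist ((n : ℝ)⁻¹ • ∑ t ∈ Finset.range n, g (X t ω) q)
      (∫ ω, g (X 0 ω) q ∂P) < η / 2 := (h₂ m).eventually (Metric.ball_mem_nhds _ (by positivity))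
  have e₃ : ∀ᶠ W in 𝓝 W₁, dist W W₁ < δ := Metric.ball_mem_nhds _ hδ0
  have e₄ : dist (∫ ω, g (X 0 ω) q ∂P) (∫ ω, g (X 0 ω) W₁ ∂P) ≤ k * δ := by
    rw [dist_eq_norm, ← integral_sub (hint _) (hint _)]
    calc ‖∫ ω, g (X 0 ω) q - g (X 0 ω) W₁ ∂P‖ ≤ ∫ ω, K R (X 0 ω) * ‖q - W₁‖ ∂P :=
          norm_integral_le_of_norm_le ((hKi R).mul_const _)
            (Eventually.of_forall fun ω => (hK R _ q hq).2 W₁ hW₁)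
      _ = k * ‖q - W₁‖ := integral_mul_const _ _
      _ ≤ k * δ := by gcongr; rw [← dist_eq_norm, dist_comm]; exact hm.le
  filter_upwards [(e₁.and e₂).prod_mk e₃] with ⟨n, W⟩ ⟨⟨a₁, a₂⟩, a₃⟩
  simp only at a₁ a₂ a₃ ⊢
  have hW : W ∈ Metric.closedBall (0 : E) R := hball W (by linarith)
  have e₅ : dist ((n : ℝ)⁻¹ • ∑ t ∈ Finset.range n, g (X t ω) W)
      ((n : ℝ)⁻¹ • ∑ t ∈ Finset.range n, g (X t ω) q) ≤ (k + 1) * (2 * δ) := by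
    rw [dist_eq_norm, ← smul_sub, ← Finset.sum_sub_distrib, norm_smul, Real.norm_of_nonneg
      (by positivity)]
    calc (n : ℝ)⁻¹ * ‖∑ t ∈ Finset.range n, (g (X t ω) W - g (X t ω) q)‖
        ≤ (n : ℝ)⁻¹ * ∑ t ∈ Finset.range n, K R (X t ω) * ‖W - q‖ := by
          gcongr
          exact norm_sum_le_of_le _ fun t _ => (hK R _ W hW).2 q hq
      _ = ((n : ℝ)⁻¹ • ∑ t ∈ Finset.range n, K R (X t ω)) * ‖W - q‖ := by
          rw [← Finset.sum_mul, smul_eq_mul, mul_assoc]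
      _ ≤ (k + 1) * (2 * δ) := by
          gcongr
          rw [← dist_eq_norm]
          linarith [dist_triangle W W₁ q]
  calc _ ≤ _ := dist_triangle4 _ ((n : ℝ)⁻¹ • ∑ t ∈ Finset.range n, g (X t ω) q)
        (∫ ω, g (X 0 ω) q ∂P) _
    _ < η := by linarith

/-- The matrix of second moments of a random vector. -/
def momentMatrix {ι : Type*} (P : Measure Ω) (ξ : Ω → EuclideanSpace ℝ ι) : Matrix ι ι ℝ :=
  Matrix.of fun i j => ∫ ω, ξ ω i * ξ ω j ∂P

section Vector

variable {ι : Type*} [Fintype ι] [DecidableEq ι]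

lemma memLp_coord {ξ : Ω → EuclideanSpace ℝ ι} (hξ : MemLp ξ 2 P) (i : ι) :
    MemLp (fun ω => ξ ω i) 2 P :=
  (EuclideanSpace.proj (𝕜 := ℝ) i).comp_memLp' hξ

lemma dotProduct_momentMatrix_mulVec {ξ : Ω → EuclideanSpace ℝ ι} (hξ : MemLp ξ 2 P)
    (x : ι → ℝ) :
    x ⬝ᵥ (momentMatrix P ξ).mulVec x = ∫ ω, (∑ i, x i * ξ ω i) ^ 2 ∂P := by
  have hint : ∀ i j, Integrable (fun ω => x i * (ξ ω i * ξ ω j * x j)) P := fun i j =>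
    (((memLp_coord hξ i).integrable_mul (memLp_coord hξ j)).mul_const _).const_mul _
  have : ∀ ω, (∑ i, x i * ξ ω i) ^ 2 = ∑ i, ∑ j, x i * (ξ ω i * ξ ω j * x j) := by
    intro ω
    rw [sq, Finset.sum_mul_sum]
    exact Finset.sum_congr rfl fun i _ => Finset.sum_congr rfl fun j _ => by ring
  simp_rw [this]
  rw [integral_finsetSum _ fun i _ => integrable_finsetSum _ fun j _ => hint i j]
  simp_rw [integral_finsetSum _ fun j _ => hint _ j]
  simp only [dotProduct, Matrix.mulVec, momentMatrix, Matrix.of_apply, Finset.mul_sum]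
  refine Finset.sum_congr rfl fun i _ => Finset.sum_congr rfl fun j _ => ?_
  rw [integral_const_mul, integral_mul_const]

lemma posSemidef_momentMatrix {ξ : Ω → EuclideanSpace ℝ ι} (hξ : MemLp ξ 2 P) :
    (momentMatrix P ξ).PosSemidef := by
  refine Matrix.PosSemidef.of_dotProduct_mulVec_nonneg ?_ fun x => ?_
  · ext i j
    simp [momentMatrix, mul_comm]
  · rw [star_trivial, dotProduct_momentMatrix_mulVec hξ]
    exact integral_nonneg fun ω => sq_nonneg _

/-- The central limit theorem for centered random vectors. -/
theorem tendstoInDistribution_inv_sqrt_smul_sum {ξ : ℕ → Ω → EuclideanSpace ℝ ι}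
    (hindep : iIndepFun ξ P) (hident : ∀ t, IdentDistrib (ξ t) (ξ 0) P P)
    (hξ : MemLp (ξ 0) 2 P) (hmean : ∫ ω, ξ 0 ω ∂P = 0) :
    TendstoInDistribution (fun (n : ℕ) ω => (√(n : ℝ))⁻¹ • ∑ t ∈ Finset.range n, ξ t ω) atTop
      (id : EuclideanSpace ℝ ι → EuclideanSpace ℝ ι) (fun _ => P)
      (multivariateGaussian 0 (momentMatrix P (ξ 0))) := by
  have hm : ∀ n : ℕ, AEMeasurable (fun ω => (√(n : ℝ))⁻¹ • ∑ t ∈ Finset.range n, ξ t ω) P :=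
    fun n => (measurable_const_smul (√(n : ℝ))⁻¹).comp_aemeasurable
      (Finset.aemeasurable_fun_sum (Finset.range n) fun t _ => (hident t).aemeasurable_fst)
  refine ⟨hm, aemeasurable_id, ?_⟩
  refine ProbabilityMeasure.tendsto_iff_tendsto_charFun.2 fun u => ?_
  have hu : Measurable fun x : EuclideanSpace ℝ ι => inner ℝ x u := by fun_prop
  have hL2 : MemLp (fun ω => inner ℝ (ξ 0 ω) u) 2 P := by
    have := (innerSL ℝ u).comp_memLp' hξ
    simpa [Function.comp_def, real_inner_comm] using this
  have hmean' : ∫ ω, inner ℝ (ξ 0 ω) u ∂P = 0 := by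
    have := (innerSL ℝ u).integral_comp_comm (hξ.integrable one_le_two)
    simpa [hmean, real_inner_comm] using this
  have hvar : Var[fun ω => inner ℝ (ξ 0 ω) u; P]
      = WithLp.ofLp u ⬝ᵥ (momentMatrix P (ξ 0)).mulVec (WithLp.ofLp u) := by
    rw [variance_of_integral_eq_zero hL2.1.aemeasurable hmean', dotProduct_momentMatrix_mulVec hξ]
    simp [PiLp.inner_apply]
  have clt := tendstoInDistribution_inv_sqrt_mul_sum_sub
    (P := P) (X := fun t ω => inner ℝ (ξ t ω) u) (Y := id)
    (P' := gaussianReal 0 Var[fun ω => inner ℝ (ξ 0 ω) u; P].toNNReal) HasLaw.id hL2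
    (hindep.comp (fun _ x => inner ℝ x u) fun _ => hu) fun t => (hident t).comp hu
  -- Cramér–Wold: the characteristic function of a vector at `u` is that of its scalar product with
  -- `u` at `1`, so the scalar theorem suffices.
  have h1 := ProbabilityMeasure.tendsto_iff_tendsto_charFun.1 clt.tendsto 1
  convert h1 using 2 with n
  · simp only [ProbabilityMeasure.coe_mk]
    rw [charFun_apply, charFun_apply, integral_map (hm n) (by fun_prop),
      integral_map (clt.forall_aemeasurable n) (by fun_prop)]
    refine integral_congr_ae (Eventually.of_forall fun ω => ?_)
    simp only [hmean', real_inner_smul_left, sum_inner]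
    simp
  · simp only [ProbabilityMeasure.coe_mk, Measure.map_id]
    rw [charFun_multivariateGaussian (posSemidef_momentMatrix hξ), charFun_gaussianReal,
      Real.coe_toNNReal _ (variance_nonneg _ _), hvar]
    simp

/-- The image of a centered Gaussian law under a linear map. -/
lemma map_multivariateGaussian_toEuclideanCLM {S : Matrix ι ι ℝ} (hS : S.PosSemidef)
    (M : Matrix ι ι ℝ) :
    (multivariateGaussian 0 S).map (Matrix.toEuclideanCLM (𝕜 := ℝ) M)
      = multivariateGaussian 0 (M * S * M.transpose) := by
  have hMS : (M * S * M.transpose).PosSemidef := by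
    simpa using hS.mul_mul_conjTranspose_same M
  refine Measure.ext_of_charFun ?_
  ext t
  rw [charFun_multivariateGaussian hMS, charFun_apply,
    integral_map (by fun_prop) (by fun_prop)]
  have : ∀ x : EuclideanSpace ℝ ι, inner ℝ (Matrix.toEuclideanCLM (𝕜 := ℝ) M x) t
      = inner ℝ x (Matrix.toEuclideanCLM (𝕜 := ℝ) M.transpose t) := by
    intro x
    simp only [EuclideanSpace.inner_eq_star_dotProduct, star_trivial, Matrix.ofLp_toEuclideanCLM]
    rw [Matrix.dotProduct_mulVec, Matrix.mulVec_transpose]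
  simp_rw [this]
  rw [← charFun_apply, charFun_multivariateGaussian hS]
  simp only [inner_zero_right, Matrix.ofLp_toEuclideanCLM]
  simp [Matrix.mulVec_mulVec, Matrix.dotProduct_mulVec, Matrix.vecMul_mulVec, Matrix.mul_assoc]

end Vector

/-- A sequence which is almost surely negligible with respect to a sequence converging in
distribution tends to zero in probability. -/
theorem tendstoInMeasure_of_isLittleO {V F : Type*} [NormedAddCommGroup V] [MeasurableSpace V]
    [BorelSpace V] [NormedAddCommGroup F] [MeasurableSpace F] [BorelSpace F]
    [SecondCountableTopology V] [SecondCountableTopology F]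
    {Ω' : Type*} [MeasurableSpace Ω'] {P' : Measure Ω'} [IsProbabilityMeasure P']
    {X : ℕ → Ω → V} {Z : Ω' → V} {R : ℕ → Ω → F}
    (hX : TendstoInDistribution X atTop Z (fun _ => P) P') (hR : ∀ n, AEMeasurable (R n) P)
    (h : ∀ᵐ ω ∂P, (fun n => R n ω) =o[atTop] fun n => X n ω) :
    TendstoInMeasure P R atTop 0 := by
  -- Slutsky's argument: `c n` tends to `0` almost surely, so `c n * ‖X n‖` tends to `0` in law.
  -- Division by zero gives `c n ω = 0` where `X n ω = 0`.
  set c : ℕ → Ω → ℝ := fun n ω => ‖R n ω‖ / ‖X n ω‖ with hc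
  have hXm := hX.forall_aemeasurable
  have hcm : ∀ n, AEMeasurable (c n) P := fun n => (hR n).norm.div (hXm n).norm
  have hc0 : TendstoInMeasure P c atTop (fun _ => (0 : ℝ)) :=
    tendstoInMeasure_of_tendsto_ae (fun n => (hcm n).aestronglyMeasurable)
      (h.mono fun ω hω => hω.norm_norm.tendsto_div_nhds_zero)
  have hQ := hX.continuous_comp_prodMk_of_tendstoInMeasure_const
    (g := fun q : V × ℝ => q.2 * ‖q.1‖) (by fun_prop) hc0 hcm
  -- The difference is nonzero only where `X n ω = 0` and `R n ω ≠ 0`, which the little-o relation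
  -- excludes for large `n`.
  have hD : TendstoInMeasure P (fun n ω => ‖R n ω‖ - c n ω * ‖X n ω‖) atTop (fun _ => (0 : ℝ)) := by
    refine tendstoInMeasure_of_tendsto_ae
      (fun n => ((hR n).norm.sub ((hcm n).mul (hXm n).norm)).aestronglyMeasurable)
      (h.mono fun ω hω => ?_)
    refine tendsto_const_nhds.congr' ?_
    filter_upwards [hω.def one_pos] with n hn
    rcases eq_or_ne (X n ω) 0 with h0 | h0
    · simp only [h0, norm_zero, mul_zero, sub_zero] at hn ⊢
      linarith [norm_nonneg (R n ω)]
    · simp [hc, div_mul_cancel₀ _ (norm_ne_zero_iff.2 h0)]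
  have hN := hQ.add_of_tendstoInMeasure_const hD fun n =>
    (hR n).norm.sub ((hcm n).mul (hXm n).norm)
  rw [tendstoInMeasure_iff_norm]
  intro η hη
  -- The limit law is the Dirac mass at `0`, which does not charge `{η}`, the frontier of `Set.Ici
  -- η`.
  have hnull := ProbabilityMeasure.tendsto_measure_of_null_frontier_of_tendsto' hN.tendsto
    (E := Set.Ici η) ?_
  · simp only [ProbabilityMeasure.coe_mk, zero_mul, add_zero] at hnull
    rw [Measure.map_const] at hnull
    simp only [measure_univ, one_smul] at hnull
    rw [Measure.dirac_apply' _ measurableSet_Ici, Set.indicator_of_notMem (by simpa using hη)]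
      at hnull
    refine hnull.congr fun n => ?_
    rw [Measure.map_apply_of_aemeasurable (hN.forall_aemeasurable n) measurableSet_Ici]
    congr 1
    ext ω
    simp
  · simp only [ProbabilityMeasure.coe_mk, zero_mul, add_zero]
    rw [Measure.map_const, frontier_Ici]
    simp [hη.ne]

end LimitTheorems

/-! ### Differentiation of empirical means and of their compositions with a smooth function. -/

section SampleMean

variable {S E V : Type*} [NormedAddCommGroup E] [NormedSpace ℝ E] [NormedAddCommGroup V]
  [NormedSpace ℝ V]

lemma contDiff_sampleMean {k : WithTop ℕ∞} {f : S → E → V} (hf : ∀ x, ContDiff ℝ k (f x))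
    (x : ℕ → S) (n : ℕ) : ContDiff ℝ k (sampleMean f x n) :=
  contDiff_const.smul (ContDiff.sum fun t _ => hf (x t))

lemma fderiv_sampleMean {f : S → E → V} (hf : ∀ x, Differentiable ℝ (f x)) (x : ℕ → S) (n : ℕ) :
    fderiv ℝ (sampleMean f x n) = sampleMean (fun x => fderiv ℝ (f x)) x n := by
  ext1 W
  refine HasFDerivAt.fderiv ?_
  exact (HasFDerivAt.fun_sum fun t _ => (hf (x t) W).hasFDerivAt).const_smul _

end SampleMean

section Composition

variable {E V : Type*} [NormedAddCommGroup E] [NormedSpace ℝ E] [NormedAddCommGroup V]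
  [NormedSpace ℝ V]

lemma tendsto_clm_comp {α E₁ E₂ E₃ : Type*} [NormedAddCommGroup E₁] [NormedSpace ℝ E₁]
    [NormedAddCommGroup E₂] [NormedSpace ℝ E₂] [NormedAddCommGroup E₃] [NormedSpace ℝ E₃]
    {l : Filter α} {g : α → E₂ →L[ℝ] E₃} {f : α → E₁ →L[ℝ] E₂} {g₀ : E₂ →L[ℝ] E₃}
    {f₀ : E₁ →L[ℝ] E₂} (hg : Tendsto g l (𝓝 g₀)) (hf : Tendsto f l (𝓝 f₀)) :
    Tendsto (fun a => (g a).comp (f a)) l (𝓝 (g₀.comp f₀)) :=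
  (isBoundedBilinearMap_comp.continuous.tendsto (g₀, f₀)).comp (hg.prodMk_nhds hf)

/-- Limits of the first two derivatives of `L ∘ G n`, when `G n` converges together with its first
two derivatives and the limit of the first derivative vanishes. -/
theorem eventually_contDiffAt_comp_and_tendsto {G : ℕ → E → V} {L : V → ℝ} {W₀ : E} {v₀ : V}
    {T : E →L[ℝ] E →L[ℝ] V} (hG : ∀ n, ContDiff ℝ 2 (G n)) (hL : ContDiffAt ℝ 2 L v₀)
    (h₀ : Tendsto (fun q : ℕ × E => G q.1 q.2) (atTop ×ˢ 𝓝 W₀) (𝓝 v₀))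
    (h₁ : Tendsto (fun q : ℕ × E => fderiv ℝ (G q.1) q.2) (atTop ×ˢ 𝓝 W₀) (𝓝 0))
    (h₂ : Tendsto (fun q : ℕ × E => fderiv ℝ (fderiv ℝ (G q.1)) q.2) (atTop ×ˢ 𝓝 W₀) (𝓝 T)) :
    (∀ᶠ q : ℕ × E in atTop ×ˢ 𝓝 W₀, ContDiffAt ℝ 2 (fun W => L (G q.1 W)) q.2) ∧
    Tendsto (fun q : ℕ × E => fderiv ℝ (fderiv ℝ fun W => L (G q.1 W)) q.2) (atTop ×ˢ 𝓝 W₀)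
      (𝓝 ((ContinuousLinearMap.compL ℝ E V ℝ (fderiv ℝ L v₀)).comp T)) := by
  have hLe : ∀ᶠ v in 𝓝 v₀, ContDiffAt ℝ 2 L v := hL.eventually (by simp)
  have hL₁ : ContDiffAt ℝ 1 (fderiv ℝ L) v₀ := hL.fderiv_right (by norm_num)
  have hL₂ : ContDiffAt ℝ 0 (fderiv ℝ (fderiv ℝ L)) v₀ := hL₁.fderiv_right (by norm_num)
  have hGL : ∀ᶠ q : ℕ × E in atTop ×ˢ 𝓝 W₀, ContDiffAt ℝ 2 L (G q.1 q.2) := h₀.eventually hLe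
  refine ⟨hGL.mono fun q hq => hq.comp q.2 (hG q.1).contDiffAt, ?_⟩
  -- Second-order chain rule. The summand with the second derivative of `L` contains `fderiv ℝ (G
  -- q.1) q.2` twice, hence tends to zero.
  have hform : ∀ᶠ q : ℕ × E in atTop ×ˢ 𝓝 W₀,
      (ContinuousLinearMap.compL ℝ E V ℝ (fderiv ℝ L (G q.1 q.2))).comp
          (fderiv ℝ (fderiv ℝ (G q.1)) q.2) +
        ((ContinuousLinearMap.compL ℝ E V ℝ).flip (fderiv ℝ (G q.1) q.2)).comp
          ((fderiv ℝ (fderiv ℝ L) (G q.1 q.2)).comp (fderiv ℝ (G q.1) q.2)) =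
      fderiv ℝ (fderiv ℝ fun W => L (G q.1 W)) q.2 := by
    filter_upwards [hGL] with q hq
    have hcont : Tendsto (G q.1) (𝓝 q.2) (𝓝 (G q.1 q.2)) := (hG q.1).continuous.continuousAt
    have hloc : fderiv ℝ (fun W => L (G q.1 W)) =ᶠ[𝓝 q.2]
        fun W => (fderiv ℝ L (G q.1 W)).comp (fderiv ℝ (G q.1) W) := by
      filter_upwards [hcont.eventually (hq.eventually (by simp))] with W hW
      exact fderiv_comp W (hW.differentiableAt (by simp))
        ((hG q.1).differentiable (by simp) W)
    rw [hloc.fderiv_eq]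
    have hq₁ : ContDiffAt ℝ 1 (fderiv ℝ L) (G q.1 q.2) := hq.fderiv_right (by norm_num)
    have hG₁ : ContDiff ℝ 1 (fderiv ℝ (G q.1)) := (hG q.1).fderiv_right (by norm_num)
    have d₁ : HasFDerivAt (fun W => fderiv ℝ L (G q.1 W))
        ((fderiv ℝ (fderiv ℝ L) (G q.1 q.2)).comp (fderiv ℝ (G q.1) q.2)) q.2 :=
      (hq₁.differentiableAt (by simp)).hasFDerivAt.comp q.2
        ((hG q.1).differentiable (by simp) q.2).hasFDerivAt
    have d₂ : HasFDerivAt (fderiv ℝ (G q.1)) (fderiv ℝ (fderiv ℝ (G q.1)) q.2) q.2 :=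
      (hG₁.differentiable (by simp) q.2).hasFDerivAt
    exact (d₁.clm_comp d₂).fderiv.symm
  refine Tendsto.congr' hform ?_
  have t₁ := hL₁.continuousAt.tendsto.comp h₀
  have t₂ := hL₂.continuousAt.tendsto.comp h₀
  have s₁ := tendsto_clm_comp
    (((ContinuousLinearMap.compL ℝ E V ℝ).continuous.tendsto _).comp t₁) h₂
  have s₂ := tendsto_clm_comp
    (((ContinuousLinearMap.compL ℝ E V ℝ).flip.continuous.tendsto _).comp h₁)
    (tendsto_clm_comp t₂ h₁)
  have s₃ := s₁.add s₂
  rw [map_zero, ContinuousLinearMap.zero_comp, add_zero] at s₃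
  exact s₃

end Composition

/-! ### From a vanishing gradient to asymptotic normality. -/

section Estimation

set_option linter.unusedSectionVars false

variable {ι : Type*} [Fintype ι] [DecidableEq ι]

/-- Linearisation of the estimating equation `∇ U n (W n) = 0`. -/
theorem gradient_add_isLittleO {U : ℕ → EuclideanSpace ℝ ι → ℝ} {W : ℕ → EuclideanSpace ℝ ι}
    {W₀ : EuclideanSpace ℝ ι} {H : EuclideanSpace ℝ ι →L[ℝ] EuclideanSpace ℝ ι}
    {B : EuclideanSpace ℝ ι →L[ℝ] EuclideanSpace ℝ ι →L[ℝ] ℝ}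
    (hB : ∀ u v, B u v = inner ℝ (H u) v)
    (hU : ∀ᶠ q : ℕ × EuclideanSpace ℝ ι in atTop ×ˢ 𝓝 W₀, ContDiffAt ℝ 2 (U q.1) q.2)
    (hU₂ : Tendsto (fun q : ℕ × EuclideanSpace ℝ ι => fderiv ℝ (fderiv ℝ (U q.1)) q.2)
      (atTop ×ˢ 𝓝 W₀) (𝓝 B))
    (hW : Tendsto W atTop (𝓝 W₀)) (hcrit : ∀ᶠ n in atTop, fderiv ℝ (U n) (W n) = 0) :
    (fun n => gradient (U n) W₀ + H (W n - W₀)) =o[atTop] fun n => W n - W₀ := by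
  rw [Asymptotics.isLittleO_iff]
  intro c hc
  have hnear : ∀ᶠ q : ℕ × EuclideanSpace ℝ ι in atTop ×ˢ 𝓝 W₀,
      ContDiffAt ℝ 2 (U q.1) q.2 ∧ ‖fderiv ℝ (fderiv ℝ (U q.1)) q.2 - B‖ ≤ c := by
    filter_upwards [hU, (tendsto_iff_norm_sub_tendsto_zero
      (E := EuclideanSpace ℝ ι →L[ℝ] EuclideanSpace ℝ ι →L[ℝ] ℝ).1 hU₂).eventually (ge_mem_nhds hc)]
      with q h₁ h₂
    exact ⟨h₁, h₂⟩
  obtain ⟨pa, hpa, pb, hpb, hab⟩ := Filter.eventually_prod_iff.1 hnear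
  obtain ⟨δ, hδ, hball⟩ := Metric.eventually_nhds_iff_ball.1 hpb
  filter_upwards [hpa, hcrit, hW.eventually (Metric.ball_mem_nhds W₀ hδ)] with n h₁ h₂ h₃
  -- On this ball the second derivative stays within `c` of `B`, so the mean value inequality for
  -- `fderiv ℝ (U n)` minus the linear map `B` replaces a Taylor expansion.
  have key := (convex_ball W₀ δ).norm_image_sub_le_of_norm_fderiv_le' (𝕜 := ℝ)
    (f := fderiv ℝ (U n)) (φ := B) (C := c) (x := W₀) (y := W n) (fun x hx => ?_)
    (fun x hx => (hab h₁ (hball x hx)).2) (Metric.mem_ball_self hδ) h₃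
  · have : fderiv ℝ (U n) (W n) - fderiv ℝ (U n) W₀ - B (W n - W₀)
        = -(InnerProductSpace.toDual ℝ _ (gradient (U n) W₀ + H (W n - W₀))) := by
      ext v
      rw [h₂, map_add]
      simp only [gradient, LinearIsometryEquiv.apply_symm_apply]
      simp [hB]
      ring
    rwa [this, norm_neg, LinearIsometryEquiv.norm_map] at key
  · have hx' : ContDiffAt ℝ 1 (fderiv ℝ (U n)) x :=
      (hab h₁ (hball x hx)).1.fderiv_right (by norm_num)
    exact hx'.differentiableAt (by simp)

variable {Ω : Type*} [MeasurableSpace Ω] {P : Measure Ω} [IsProbabilityMeasure P]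

omit [Fintype ι] [DecidableEq ι] in
-- The limit variable matters only through its law. This allows a linear image of a Gaussian
-- variable to be exchanged for the identity under the image law.
lemma _root_.MeasureTheory.TendstoInDistribution.congr_law {F Ω' Ω'' : Type*} [TopologicalSpace F]
    [MeasurableSpace F] [OpensMeasurableSpace F] [MeasurableSpace Ω'] [MeasurableSpace Ω'']
    {P' : Measure Ω'} {P'' : Measure Ω''} [IsProbabilityMeasure P'] [IsProbabilityMeasure P'']
    {X : ℕ → Ω → F} {Z : Ω' → F} {Z' : Ω'' → F}
    (h : TendstoInDistribution X atTop Z (fun _ => P) P') (hZ' : AEMeasurable Z' P'')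
    (hlaw : P'.map Z = P''.map Z') : TendstoInDistribution X atTop Z' (fun _ => P) P'' := by
  refine ⟨h.forall_aemeasurable, hZ', ?_⟩
  have hl : (⟨P'.map Z, Measure.isProbabilityMeasure_map h.aemeasurable_limit⟩ :
      ProbabilityMeasure F) = ⟨P''.map Z', Measure.isProbabilityMeasure_map hZ'⟩ :=
    Subtype.ext hlaw
  exact hl ▸ h.tendsto

/-- Asymptotic normality of a consistent sequence of critical points. -/
theorem tendstoInDistribution_sqrt_smul_sub {U : ℕ → Ω → EuclideanSpace ℝ ι → ℝ}
    {What : ℕ → Ω → EuclideanSpace ℝ ι} {W₀ : EuclideanSpace ℝ ι} {H S : Matrix ι ι ℝ}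
    {B : EuclideanSpace ℝ ι →L[ℝ] EuclideanSpace ℝ ι →L[ℝ] ℝ}
    (hB : ∀ u v, B u v = inner ℝ (Matrix.toEuclideanCLM (𝕜 := ℝ) H u) v) (hH : IsUnit H.det)
    (hS : S.PosSemidef)
    (hU : ∀ᵐ ω ∂P, ∀ᶠ q : ℕ × EuclideanSpace ℝ ι in atTop ×ˢ 𝓝 W₀, ContDiffAt ℝ 2 (U q.1 ω) q.2)
    (hU₂ : ∀ᵐ ω ∂P, Tendsto
      (fun q : ℕ × EuclideanSpace ℝ ι => fderiv ℝ (fderiv ℝ (U q.1 ω)) q.2)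
      (atTop ×ˢ 𝓝 W₀) (𝓝 B))
    (hscore : TendstoInDistribution (fun (n : ℕ) ω => √(n : ℝ) • gradient (U n ω) W₀) atTop
      (id : EuclideanSpace ℝ ι → EuclideanSpace ℝ ι) (fun _ => P) (multivariateGaussian 0 S))
    (hmeas : ∀ n, AEMeasurable (What n) P)
    (hcons : ∀ᵐ ω ∂P, Tendsto (fun n => What n ω) atTop (𝓝 W₀))
    (hcrit : ∀ᵐ ω ∂P, ∀ᶠ n in atTop, fderiv ℝ (U n ω) (What n ω) = 0) :
    TendstoInDistribution (fun (n : ℕ) ω => √(n : ℝ) • (What n ω - W₀)) atTop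
      (id : EuclideanSpace ℝ ι → EuclideanSpace ℝ ι) (fun _ => P)
      (multivariateGaussian 0 (H⁻¹ * S * (H⁻¹).transpose)) := by
  set C := Matrix.toEuclideanCLM (𝕜 := ℝ) (-H⁻¹) with hC
  have hCH : ∀ u, C (Matrix.toEuclideanCLM (𝕜 := ℝ) H u) = -u := by
    intro u
    rw [hC, ← mul_apply_eq_comp, ← map_mul, neg_mul, Matrix.nonsing_inv_mul _ hH]
    simp
  have hlim := hscore.continuous_comp C.continuous
  have hYm : ∀ n : ℕ, AEMeasurable (fun ω => √(n : ℝ) • (What n ω - W₀)) P := fun n =>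
    (measurable_const_smul (√(n : ℝ))).comp_aemeasurable ((hmeas n).sub_const W₀)
  have hsmall : TendstoInMeasure P ((fun (n : ℕ) ω => √(n : ℝ) • (What n ω - W₀)) -
      fun n : ℕ => C ∘ fun ω => √(n : ℝ) • gradient (U n ω) W₀) atTop 0 := by
    refine tendstoInMeasure_of_isLittleO hlim
      (fun n => (hYm n).sub (hlim.forall_aemeasurable n)) ?_
    filter_upwards [hU, hU₂, hcons, hcrit] with ω h₁ h₂ h₃ h₄
    have h := gradient_add_isLittleO hB h₁ h₂ h₃ h₄
    -- Since `C` is `-H⁻¹`, the linearized equation says that `C ∇U` is equivalent to `What - W₀`.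
    -- Equivalence being symmetric, the error is also negligible against `C ∇U`, whose rescaling
    -- converges in law; no prior tightness of `√n (What - W₀)` is needed.
    have h' : (fun n => C (gradient (U n ω) W₀)) ~[atTop] fun n => What n ω - W₀ := by
      refine ((C.isBigO_comp _ atTop).trans_isLittleO h).congr_left fun n => ?_
      simp only [map_add, hCH]
      exact (sub_eq_add_neg _ _).symm
    have h'' := (Asymptotics.IsEquivalent.refl (u := fun n : ℕ => √(n : ℝ))).smul h'.symm
    refine h''.isLittleO.congr_left (fun n => ?_) |>.congr_right fun n => ?_
    · simp
    · simp
  have hfin := tendstoInDistribution_of_tendstoInMeasure_sub _ _ hlim hsmall hYm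
  refine hfin.congr_law aemeasurable_id ?_
  rw [Measure.map_id, Function.comp_id, hC, map_multivariateGaussian_toEuclideanCLM hS]
  simp

end Estimation

/-! ### Averages of dominated `C³` families: laws of large numbers and normality of the gradient. -/

section Score

set_option linter.unusedSectionVars false

variable {S : Type*} [MeasurableSpace S] {ι : Type*} [Fintype ι] [DecidableEq ι]
  {V : Type*} [NormedAddCommGroup V] [NormedSpace ℝ V] [FiniteDimensional ℝ V]
  [MeasurableSpace V] [BorelSpace V]
  {Ω : Type*} [MeasurableSpace Ω]

/-- A family of `C³` functions of a parameter, depending on a random point, whose derivatives up to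
order three are locally dominated by an integrable function. -/
structure IsDominatedC3 (P : Measure Ω) (X : Ω → S) (f : S → EuclideanSpace ℝ ι → V) : Prop where
  contDiff : ∀ x, ContDiff ℝ 3 (f x)
  measurable : ∀ W, Measurable fun x => f x W
  measurable_fderiv : ∀ W, Measurable fun x => fderiv ℝ (f x) W
  measurable_fderiv_fderiv : ∀ W, Measurable fun x => fderiv ℝ (fderiv ℝ (f x)) W
  bound : ∀ R : ℝ, ∃ K : S → ℝ, Measurable K ∧ Integrable (fun ω => K (X ω)) P ∧
    ∀ x, ∀ W ∈ Metric.closedBall (0 : EuclideanSpace ℝ ι) R, ∀ m ≤ 3,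
      ‖iteratedFDeriv ℝ m (f x) W‖ ≤ K x

variable {P : Measure Ω} [IsProbabilityMeasure P] {X : ℕ → Ω → S}
  {f : S → EuclideanSpace ℝ ι → V}

lemma norm_sub_le_of_norm_fderiv_le_closedBall {E F : Type*} [NormedAddCommGroup E]
    [NormedSpace ℝ E] [NormedAddCommGroup F] [NormedSpace ℝ F] {g : E → F}
    (hg : Differentiable ℝ g) {R K : ℝ}
    (hK : ∀ W ∈ Metric.closedBall (0 : E) R, ‖fderiv ℝ g W‖ ≤ K) {W W' : E}
    (hW : W ∈ Metric.closedBall (0 : E) R) (hW' : W' ∈ Metric.closedBall (0 : E) R) :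
    ‖g W - g W'‖ ≤ K * ‖W - W'‖ :=
  (convex_closedBall 0 R).norm_image_sub_le_of_norm_fderiv_le (𝕜 := ℝ) (fun x _ => hg x) hK hW' hW

theorem IsDominatedC3.ae_tendsto (hf : IsDominatedC3 P (X 0) f) (hindep : iIndepFun X P)
    (hident : ∀ t, IdentDistrib (X t) (X 0) P P) :
    ∀ᵐ ω ∂P, ∀ W₁,
      Tendsto (fun q : ℕ × EuclideanSpace ℝ ι => sampleMean f (fun t => X t ω) q.1 q.2)
        (atTop ×ˢ 𝓝 W₁) (𝓝 (∫ ω, f (X 0 ω) W₁ ∂P)) := by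
  refine ae_tendsto_average_locally_uniform hindep hident hf.measurable fun R => ?_
  obtain ⟨K, hKm, hKi, hK⟩ := hf.bound R
  refine ⟨K, hKm, hKi, fun x W hW => ⟨?_, fun W' hW' => ?_⟩⟩
  · simpa using hK x W hW 0 (by norm_num)
  · refine norm_sub_le_of_norm_fderiv_le_closedBall ((hf.contDiff x).differentiable (by simp))
      (fun W hW => ?_) hW hW'
    simpa using hK x W hW 1 (by norm_num)

theorem IsDominatedC3.ae_tendsto_fderiv (hf : IsDominatedC3 P (X 0) f) (hindep : iIndepFun X P)
    (hident : ∀ t, IdentDistrib (X t) (X 0) P P) :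
    ∀ᵐ ω ∂P, ∀ W₁,
      Tendsto (fun q : ℕ × EuclideanSpace ℝ ι =>
          fderiv ℝ (sampleMean f (fun t => X t ω) q.1) q.2)
        (atTop ×ˢ 𝓝 W₁) (𝓝 (∫ ω, fderiv ℝ (f (X 0 ω)) W₁ ∂P)) := by
  simp_rw [fderiv_sampleMean fun x => (hf.contDiff x).differentiable (by simp)]
  refine ae_tendsto_average_locally_uniform hindep hident hf.measurable_fderiv fun R => ?_
  obtain ⟨K, hKm, hKi, hK⟩ := hf.bound R
  refine ⟨K, hKm, hKi, fun x W hW => ⟨?_, fun W' hW' => ?_⟩⟩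
  · simpa using hK x W hW 1 (by norm_num)
  · have h₁ : ContDiff ℝ 2 (fderiv ℝ (f x)) := (hf.contDiff x).fderiv_right (by norm_num)
    refine norm_sub_le_of_norm_fderiv_le_closedBall (h₁.differentiable (by simp))
      (fun W hW => ?_) hW hW'
    rw [← norm_iteratedFDeriv_one, norm_iteratedFDeriv_fderiv]
    exact hK x W hW 2 (by norm_num)

/-- The domination of the third derivative serves here: it makes the second derivative locally
Lipschitz in the parameter, with an integrable constant. -/
lemma IsDominatedC3.bound_fderiv_fderiv {X₀ : Ω → S} (hf : IsDominatedC3 P X₀ f) (R : ℝ) :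
    ∃ K : S → ℝ, Measurable K ∧ Integrable (fun ω => K (X₀ ω)) P ∧
      ∀ x, ∀ W ∈ Metric.closedBall (0 : EuclideanSpace ℝ ι) R,
        ‖fderiv ℝ (fderiv ℝ (f x)) W‖ ≤ K x ∧
        ∀ W' ∈ Metric.closedBall (0 : EuclideanSpace ℝ ι) R,
          ‖fderiv ℝ (fderiv ℝ (f x)) W - fderiv ℝ (fderiv ℝ (f x)) W'‖ ≤ K x * ‖W - W'‖ := by
  have h₁ : ∀ x, ContDiff ℝ 2 (fderiv ℝ (f x)) := fun x =>
    (hf.contDiff x).fderiv_right (by norm_num)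
  obtain ⟨K, hKm, hKi, hK⟩ := hf.bound R
  refine ⟨K, hKm, hKi, fun x W hW => ⟨?_, fun W' hW' => ?_⟩⟩
  · rw [← norm_iteratedFDeriv_one, norm_iteratedFDeriv_fderiv]
    exact hK x W hW 2 (by norm_num)
  · have h₂ : ContDiff ℝ 1 (fderiv ℝ (fderiv ℝ (f x))) := (h₁ x).fderiv_right (by norm_num)
    refine norm_sub_le_of_norm_fderiv_le_closedBall (h₂.differentiable (by simp))
      (fun W hW => ?_) hW hW'
    rw [← norm_iteratedFDeriv_one, norm_iteratedFDeriv_fderiv, norm_iteratedFDeriv_fderiv]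
    exact hK x W hW 3 (by norm_num)

lemma IsDominatedC3.integrable {X₀ : Ω → S} (hf : IsDominatedC3 P X₀ f) (hX : Measurable X₀)
    (W : EuclideanSpace ℝ ι) : Integrable (fun ω => f (X₀ ω) W) P := by
  obtain ⟨K, -, hKi, hK⟩ := hf.bound ‖W‖
  refine hKi.mono' ((hf.measurable W).comp hX).aestronglyMeasurable
    (Eventually.of_forall fun ω => ?_)
  simpa using hK (X₀ ω) W (by simp) 0 (by norm_num)

lemma IsDominatedC3.integrable_fderiv {X₀ : Ω → S} (hf : IsDominatedC3 P X₀ f)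
    (hX : Measurable X₀) (W : EuclideanSpace ℝ ι) :
    Integrable (fun ω => fderiv ℝ (f (X₀ ω)) W) P := by
  obtain ⟨K, -, hKi, hK⟩ := hf.bound ‖W‖
  refine hKi.mono' ((hf.measurable_fderiv W).comp hX).aestronglyMeasurable
    (Eventually.of_forall fun ω => ?_)
  simpa using hK (X₀ ω) W (by simp) 1 (by norm_num)

lemma integrable_and_integral_apply {F : Type*} [NormedAddCommGroup F] [NormedSpace ℝ F]
    [FiniteDimensional ℝ F] {E : Type*} [NormedAddCommGroup E] [NormedSpace ℝ E]
    [FiniteDimensional ℝ E] {g : Ω → E →L[ℝ] F} (hg : Measurable g) {K : Ω → ℝ}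
    (hK : Integrable K P) (hb : ∀ ω, ‖g ω‖ ≤ K ω) (u : E) :
    Integrable (fun ω => g ω u) P ∧ (∫ ω, g ω ∂P) u = ∫ ω, g ω u ∂P := by
  have hi : Integrable g P := hK.mono' hg.aestronglyMeasurable (Eventually.of_forall hb)
  exact ⟨hi.apply_continuousLinearMap u, ContinuousLinearMap.integral_apply hi u⟩

lemma IsDominatedC3.integrable_and_integral_fderiv_fderiv_apply {X₀ : Ω → S}
    (hf : IsDominatedC3 P X₀ f) (hX : Measurable X₀) (W u : EuclideanSpace ℝ ι) :
    Integrable (fun ω => fderiv ℝ (fderiv ℝ (f (X₀ ω))) W u) P ∧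
      (∫ ω, fderiv ℝ (fderiv ℝ (f (X₀ ω))) W ∂P) u =
        ∫ ω, fderiv ℝ (fderiv ℝ (f (X₀ ω))) W u ∂P := by
  obtain ⟨K, -, hKi, hK⟩ := hf.bound_fderiv_fderiv ‖W‖
  have hm := (hf.measurable_fderiv_fderiv W).comp hX
  have h := integrable_and_integral_apply (F := EuclideanSpace ℝ ι →L[ℝ] V)
    (g := fun ω => fderiv ℝ (fderiv ℝ (f (X₀ ω))) W) hm hKi
    (fun ω => (hK (X₀ ω) W (by simp)).1) u
  exact h

lemma IsDominatedC3.fderiv_fderiv_sampleMean {X₀ : Ω → S} (hf : IsDominatedC3 P X₀ f)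
    (x : ℕ → S) (n : ℕ) (W : EuclideanSpace ℝ ι) :
    fderiv ℝ (fderiv ℝ (sampleMean f x n)) W
      = sampleMean (fun x => fderiv ℝ (fderiv ℝ (f x))) x n W := by
  have h₁ : ∀ x, ContDiff ℝ 2 (fderiv ℝ (f x)) := fun x =>
    (hf.contDiff x).fderiv_right (by norm_num)
  rw [fderiv_sampleMean fun x => (hf.contDiff x).differentiable (by simp),
    fderiv_sampleMean fun x => (h₁ x).differentiable (by simp)]

theorem IsDominatedC3.ae_tendsto_fderiv_fderiv (hf : IsDominatedC3 P (X 0) f)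
    (hindep : iIndepFun X P) (hident : ∀ t, IdentDistrib (X t) (X 0) P P) :
    ∀ᵐ ω ∂P, ∀ W₁,
      Tendsto (fun q : ℕ × EuclideanSpace ℝ ι =>
          fderiv ℝ (fderiv ℝ (sampleMean f (fun t => X t ω) q.1)) q.2)
        (atTop ×ˢ 𝓝 W₁) (𝓝 (∫ ω, fderiv ℝ (fderiv ℝ (f (X 0 ω))) W₁ ∂P)) := by
  have h := ae_tendsto_average_locally_uniform (g := fun x => fderiv ℝ (fderiv ℝ (f x))) hindep
    hident hf.measurable_fderiv_fderiv hf.bound_fderiv_fderiv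
  filter_upwards [h] with ω hω W₁
  exact (hω W₁).congr fun q => (hf.fderiv_fderiv_sampleMean _ _ _).symm

variable (ι) in
/-- The Riesz representation of linear forms as a continuous linear map. -/
def vectorOfDual : (EuclideanSpace ℝ ι →L[ℝ] ℝ) →L[ℝ] EuclideanSpace ℝ ι :=
  LinearMap.toContinuousLinearMap
    { toFun := fun l => (InnerProductSpace.toDual ℝ (EuclideanSpace ℝ ι)).symm l
      map_add' := fun _ _ => map_add _ _ _
      map_smul' := fun c l => by simp }

lemma vectorOfDual_apply (l : EuclideanSpace ℝ ι →L[ℝ] ℝ) :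
    vectorOfDual ι l = (InnerProductSpace.toDual ℝ (EuclideanSpace ℝ ι)).symm l := rfl

/-- The central limit theorem for random linear images of normalized sums. -/
theorem tendstoInDistribution_clm_apply {M : Type*} [NormedAddCommGroup M] [NormedSpace ℝ M]
    [FiniteDimensional ℝ M] [MeasurableSpace M] [BorelSpace M] {D : ℕ → Ω → M}
    (hindep : iIndepFun D P) (hident : ∀ t, IdentDistrib (D t) (D 0) P P)
    (hL2 : MemLp (D 0) 2 P) (hmean : ∫ ω, D 0 ω ∂P = 0)
    {A : ℕ → Ω → M →L[ℝ] EuclideanSpace ℝ ι} {A₀ : M →L[ℝ] EuclideanSpace ℝ ι}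
    (hA : ∀ᵐ ω ∂P, Tendsto (fun n => A n ω) atTop (𝓝 A₀))
    {Y : ℕ → Ω → EuclideanSpace ℝ ι} (hYm : ∀ n, AEMeasurable (Y n) P)
    (hY : ∀ᵐ ω ∂P, ∀ᶠ n : ℕ in atTop,
      Y n ω = A n ω ((√(n : ℝ))⁻¹ • ∑ t ∈ Finset.range n, D t ω)) :
    TendstoInDistribution Y atTop (id : EuclideanSpace ℝ ι → EuclideanSpace ℝ ι) (fun _ => P)
      (multivariateGaussian 0 (momentMatrix P fun ω => A₀ (D 0 ω))) := by
  -- The vector central limit theorem concerns Euclidean spaces. Here `M` will be a space of linear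
  -- maps, so it is transported there by a linear isomorphism.
  set τ := toEuclidean (E := M) with hτ
  have hclt₁ := tendstoInDistribution_inv_sqrt_smul_sum (P := P) (ξ := fun t ω => A₀ (D t ω))
    (hindep.comp (fun _ x => A₀ x) fun _ => A₀.measurable)
    (fun t => (hident t).comp A₀.measurable) (A₀.comp_memLp' hL2)
    (by rw [A₀.integral_comp_comm (hL2.integrable one_le_two), hmean, map_zero])
  have hclt₂ := tendstoInDistribution_inv_sqrt_smul_sum (P := P) (ξ := fun t ω => τ (D t ω))
    (hindep.comp (fun _ x => τ x) fun _ => τ.continuous.measurable)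
    (fun t => (hident t).comp τ.continuous.measurable) (τ.toContinuousLinearMap.comp_memLp' hL2)
    (by
      have := τ.toContinuousLinearMap.integral_comp_comm (hL2.integrable one_le_two)
      simpa [hmean] using this)
  refine tendstoInDistribution_of_tendstoInMeasure_sub _ _ hclt₁ ?_ hYm
  refine tendstoInMeasure_of_isLittleO hclt₂
    (fun n => (hYm n).sub (hclt₁.forall_aemeasurable n)) ?_
  filter_upwards [hA, hY] with ω hω hω'
  -- The error `(A n - A₀)` applied to the normalized sum is negligible against that sum, hence
  -- against its image under `τ`, which converges in law.
  have hO : (fun n : ℕ => (√(n : ℝ))⁻¹ • ∑ t ∈ Finset.range n, D t ω) =O[atTop]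
      fun n : ℕ => (√(n : ℝ))⁻¹ • ∑ t ∈ Finset.range n, τ (D t ω) := by
    have := τ.symm.toContinuousLinearMap.isBigO_comp
      (fun n : ℕ => (√(n : ℝ))⁻¹ • ∑ t ∈ Finset.range n, τ (D t ω)) atTop
    simpa using this
  refine Asymptotics.IsLittleO.trans_isBigO ?_ hO
  rw [Asymptotics.isLittleO_iff]
  intro c hc
  filter_upwards [(tendsto_iff_norm_sub_tendsto_zero.1 hω).eventually (ge_mem_nhds hc), hω']
    with n hn hn'
  simp only [Pi.sub_apply]
  rw [hn', ← map_sum A₀, ← map_smul A₀, ← sub_apply]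
  exact (ContinuousLinearMap.le_opNorm _ _).trans (by gcongr)

lemma IsDominatedC3.sqrt_smul_fderiv_sampleMean {X₀ : Ω → S} (hf : IsDominatedC3 P X₀ f)
    (x : ℕ → S) (n : ℕ) (W₀ : EuclideanSpace ℝ ι) :
    √(n : ℝ) • fderiv ℝ (sampleMean f x n) W₀
      = (√(n : ℝ))⁻¹ • ∑ t ∈ Finset.range n, fderiv ℝ (f (x t)) W₀ := by
  rw [fderiv_sampleMean fun x => (hf.contDiff x).differentiable (by simp)]
  simp only [sampleMean, smul_smul]
  congr 1
  rw [← div_eq_mul_inv, Real.sqrt_div_self', one_div]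

lemma IsDominatedC3.ae_tendsto_at (hf : IsDominatedC3 P (X 0) f) (hindep : iIndepFun X P)
    (hident : ∀ t, IdentDistrib (X t) (X 0) P P) (W₀ : EuclideanSpace ℝ ι) :
    ∀ᵐ ω ∂P, Tendsto (fun n => sampleMean f (fun t => X t ω) n W₀) atTop
      (𝓝 (∫ ω, f (X 0 ω) W₀ ∂P)) := by
  filter_upwards [hf.ae_tendsto hindep hident] with ω hω
  have h : Tendsto (fun n : ℕ => (n, W₀)) atTop (atTop ×ˢ 𝓝 W₀) :=
    tendsto_id.prodMk tendsto_const_nhds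
  have h' := (hω W₀).comp h
  exact h'

/-- Asymptotic normality of the gradient of `L` composed with an empirical mean. -/
theorem IsDominatedC3.tendstoInDistribution_gradient (hf : IsDominatedC3 P (X 0) f)
    (hindep : iIndepFun X P) (hident : ∀ t, IdentDistrib (X t) (X 0) P P)
    {W₀ : EuclideanSpace ℝ ι} {L : V → ℝ}
    (hL : ContDiffAt ℝ 2 L (∫ ω, f (X 0 ω) W₀ ∂P))
    (hmean : ∫ ω, fderiv ℝ (f (X 0 ω)) W₀ ∂P = 0)
    (hL2 : MemLp (fun ω => fderiv ℝ (f (X 0 ω)) W₀) 2 P)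
    (hmeas : ∀ n, AEMeasurable (fun ω =>
      gradient (fun W => L (sampleMean f (fun t => X t ω) n W)) W₀) P) :
    TendstoInDistribution (fun (n : ℕ) ω =>
        √(n : ℝ) • gradient (fun W => L (sampleMean f (fun t => X t ω) n W)) W₀) atTop
      (id : EuclideanSpace ℝ ι → EuclideanSpace ℝ ι) (fun _ => P)
      (multivariateGaussian 0 (momentMatrix P fun ω => (InnerProductSpace.toDual ℝ _).symm
        ((fderiv ℝ L (∫ ω, f (X 0 ω) W₀ ∂P)).comp (fderiv ℝ (f (X 0 ω)) W₀)))) := by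
  set v₀ := ∫ ω, f (X 0 ω) W₀ ∂P with hv₀
  -- `Φ l M` is the Riesz vector of `l ∘ M`. The gradient is then linear in the derivative of the
  -- empirical mean, with a coefficient that depends continuously on `fderiv ℝ L`.
  set Φ : (V →L[ℝ] ℝ) →L[ℝ] (EuclideanSpace ℝ ι →L[ℝ] V) →L[ℝ] EuclideanSpace ℝ ι :=
    (ContinuousLinearMap.compL ℝ (EuclideanSpace ℝ ι →L[ℝ] V) (EuclideanSpace ℝ ι →L[ℝ] ℝ) _
      (vectorOfDual ι)).comp (ContinuousLinearMap.compL ℝ (EuclideanSpace ℝ ι) V ℝ) with hΦ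
  have hΦ_apply : ∀ (l : V →L[ℝ] ℝ) (M : EuclideanSpace ℝ ι →L[ℝ] V),
      Φ l M = (InnerProductSpace.toDual ℝ _).symm (l.comp M) := fun l M => rfl
  have hDm := hf.measurable_fderiv W₀
  refine tendstoInDistribution_clm_apply (D := fun t ω => fderiv ℝ (f (X t ω)) W₀)
    (A := fun n ω => Φ (fderiv ℝ L (sampleMean f (fun t => X t ω) n W₀)))
    (A₀ := Φ (fderiv ℝ L v₀))
    (hindep.comp (fun _ x => fderiv ℝ (f x) W₀) fun _ => hDm) (fun t => (hident t).comp hDm)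
    hL2 hmean ?_ (fun n => (measurable_const_smul (√(n : ℝ))).comp_aemeasurable (hmeas n)) ?_
  · filter_upwards [hf.ae_tendsto_at hindep hident W₀] with ω hω
    have hL₁ : ContDiffAt ℝ 1 (fderiv ℝ L) v₀ := hL.fderiv_right (by norm_num)
    have h := (Φ.continuous.tendsto _).comp (hL₁.continuousAt.tendsto.comp hω)
    exact h
  · filter_upwards [hf.ae_tendsto_at hindep hident W₀] with ω hω
    have hLe : ∀ᶠ v in 𝓝 v₀, ContDiffAt ℝ 2 L v := hL.eventually (by simp)
    filter_upwards [hω.eventually hLe] with n hn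
    have hgrad : gradient (fun W => L (sampleMean f (fun t => X t ω) n W)) W₀
        = Φ (fderiv ℝ L (sampleMean f (fun t => X t ω) n W₀))
          (fderiv ℝ (sampleMean f (fun t => X t ω) n) W₀) := by
      rw [hΦ_apply, gradient]
      congr 1
      exact fderiv_comp W₀ (hn.differentiableAt (by simp))
        ((contDiff_sampleMean hf.contDiff _ n).differentiable (by simp) W₀)
    rw [hgrad, ← map_smul, hf.sqrt_smul_fderiv_sampleMean]

end Score

/-! ### Measurability of derivatives in the parameter, from joint smoothness. -/

section JointlySmooth

set_option linter.unusedSectionVars false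

variable {M V : Type*} [NormedAddCommGroup M] [NormedSpace ℝ M] [MeasurableSpace M]
  [OpensMeasurableSpace M] {ι : Type*} [Fintype ι]
  [NormedAddCommGroup V] [NormedSpace ℝ V] [MeasurableSpace V] [BorelSpace V]

/-- Differentiating in the parameter keeps joint smoothness, one order lower. The derivatives are
thus continuous, and therefore measurable, in the random point. -/
lemma contDiff_fderiv_param {E F : Type*} [NormedAddCommGroup E] [NormedSpace ℝ E]
    [NormedAddCommGroup F] [NormedSpace ℝ F] {f : M → E → F} {m n : WithTop ℕ∞}
    (hf : ContDiff ℝ m fun q : M × E => f q.1 q.2) (hnm : n + 1 ≤ m) :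
    ContDiff ℝ n fun q : M × E => fderiv ℝ (f q.1) q.2 :=
  ContDiff.fderiv (f := fun (q : M × E) W => f q.1 W)
    (hf.comp (contDiff_fst.fst.prodMk contDiff_snd)) contDiff_snd hnm

lemma measurable_of_contDiff_param {E F : Type*} [NormedAddCommGroup E] [NormedSpace ℝ E]
    [NormedAddCommGroup F] [NormedSpace ℝ F] [MeasurableSpace F] [BorelSpace F] {f : M → E → F}
    {n : WithTop ℕ∞} (hf : ContDiff ℝ n fun q : M × E => f q.1 q.2) (W : E) :
    Measurable fun x => f x W := by
  have h : Continuous fun x => f x W :=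
    hf.continuous.comp (continuous_id.prodMk (continuous_const (y := W)))
  exact h.measurable

lemma IsDominatedC3.of_contDiff {Ω : Type*} [MeasurableSpace Ω] {P : Measure Ω} {X : Ω → M}
    {f : M → EuclideanSpace ℝ ι → V}
    (hf : ContDiff ℝ 3 fun q : M × EuclideanSpace ℝ ι => f q.1 q.2)
    (hb : ∀ R : ℝ, ∃ K : M → ℝ, Measurable K ∧ Integrable (fun ω => K (X ω)) P ∧
      ∀ x, ∀ W ∈ Metric.closedBall (0 : EuclideanSpace ℝ ι) R, ∀ m ≤ 3,
        ‖iteratedFDeriv ℝ m (f x) W‖ ≤ K x) : IsDominatedC3 P X f := by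
  have h₁ := contDiff_fderiv_param (n := 2) hf (by norm_num)
  have h₂ := contDiff_fderiv_param (f := fun x => fderiv ℝ (f x)) (m := 2) (n := 1) h₁
    (by norm_num)
  exact ⟨fun x => hf.comp (contDiff_const.prodMk contDiff_id), measurable_of_contDiff_param hf,
    measurable_of_contDiff_param h₁, measurable_of_contDiff_param h₂, hb⟩

end JointlySmooth

/-! ### A calculus of growth bounds for derivatives in the weights. -/

section Growth

variable {S E V : Type*} [NormedAddCommGroup E] [NormedSpace ℝ E] [NormedAddCommGroup V]
  [NormedSpace ℝ V] {s : Set E} {a b ρ : S → ℝ}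

/-- The derivatives up to order three of `g x` are bounded on `s`, the `m`-th one by a multiple of
`a x * ρ x ^ m`. -/
structure HasGrowth (s : Set E) (a ρ : S → ℝ) (g : S → E → V) : Prop where
  contDiff : ∀ x, ContDiff ℝ 3 (g x)
  bound : ∃ C, 0 ≤ C ∧ ∀ x, ∀ W ∈ s, ∀ m ≤ 3,
    ‖iteratedFDeriv ℝ m (g x) W‖ ≤ C * a x * ρ x ^ m

lemma hasGrowth_const {c : S → V} (ha : ∀ x, ‖c x‖ ≤ a x) (hρ : ∀ x, 0 ≤ ρ x) :
    HasGrowth s a ρ fun x (_ : E) => c x := by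
  refine ⟨fun x => contDiff_const, 1, zero_le_one, fun x W _ m _ => ?_⟩
  rcases Nat.eq_zero_or_pos m with rfl | hm
  · simpa using ha x
  · rw [iteratedFDeriv_const_of_ne hm.ne']
    have := (norm_nonneg _).trans (ha x)
    have := hρ x
    simp only [Pi.zero_apply, norm_zero]
    positivity

/-- Derivatives of order at least two vanish; the weak bound `D ^ m` is the form required by the
estimate for derivatives of a composition. -/
lemma norm_iteratedFDeriv_clm_le (l : E →L[ℝ] V) (W : E) {D : ℝ} (hD : ‖l‖ ≤ D) {m : ℕ}
    (hm : 1 ≤ m) : ‖iteratedFDeriv ℝ m l W‖ ≤ D ^ m := by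
  have hD0 : 0 ≤ D := (norm_nonneg _).trans hD
  obtain ⟨k, rfl⟩ := Nat.exists_eq_add_of_le' hm
  rw [← norm_iteratedFDeriv_fderiv]
  have : fderiv ℝ l = fun _ => l := by
    ext1 x
    exact l.fderiv
  rw [this]
  rcases Nat.eq_zero_or_pos k with rfl | hk
  · simpa using hD
  · rw [iteratedFDeriv_const_of_ne hk.ne']
    simpa using by positivity

/-- Boundedness of `s` is needed at order zero, where the linear form itself is not bounded. -/
lemma hasGrowth_clm (l : E →L[ℝ] V) (hs : Bornology.IsBounded s) (hρ : ∀ x, 1 ≤ ρ x) :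
    HasGrowth s (fun _ : S => 1) ρ fun _ => l := by
  obtain ⟨R, hR⟩ := hs.exists_norm_le
  -- The maximum with `1` makes `D ^ m ≤ D ^ 3` for `m ≤ 3`.
  set D := max ‖l‖ 1 with hD
  refine ⟨fun _ => l.contDiff, D ^ 3 * (1 + |R|), by positivity, fun x W hW m hm => ?_⟩
  have hD1 : 1 ≤ D := le_max_right _ _
  have hlD : ‖l‖ ≤ D := le_max_left _ _
  have hρm : 1 ≤ ρ x ^ m := one_le_pow₀ (hρ x)
  have key : ‖iteratedFDeriv ℝ m l W‖ ≤ D ^ 3 * (1 + |R|) := by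
    rcases Nat.eq_zero_or_pos m with rfl | hm0
    · rw [norm_iteratedFDeriv_zero]
      calc ‖l W‖ ≤ ‖l‖ * ‖W‖ := l.le_opNorm W
        _ ≤ D ^ 3 * (1 + |R|) := by
          gcongr
          · exact hlD.trans (le_self_pow₀ hD1 (by norm_num))
          · linarith [hR W hW, le_abs_self R]
    · calc ‖iteratedFDeriv ℝ m l W‖ ≤ D ^ m := norm_iteratedFDeriv_clm_le l W hlD hm0
        _ ≤ D ^ 3 := pow_le_pow_right₀ hD1 hm
        _ ≤ D ^ 3 * (1 + |R|) := le_mul_of_one_le_right (by positivity) (by simp)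
  calc _ ≤ D ^ 3 * (1 + |R|) := key
    _ ≤ D ^ 3 * (1 + |R|) * 1 * ρ x ^ m := by
      rw [mul_one]
      exact le_mul_of_one_le_right (by positivity) hρm

lemma HasGrowth.add {g₁ g₂ : S → E → V} (h₁ : HasGrowth s a ρ g₁) (h₂ : HasGrowth s a ρ g₂) :
    HasGrowth s a ρ fun x W => g₁ x W + g₂ x W := by
  obtain ⟨C₁, hC₁, hb₁⟩ := h₁.bound
  obtain ⟨C₂, hC₂, hb₂⟩ := h₂.bound
  refine ⟨fun x => (h₁.contDiff x).add (h₂.contDiff x), C₁ + C₂, by positivity,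
    fun x W hW m hm => ?_⟩
  have hm' : (m : WithTop ℕ∞) ≤ 3 := by exact_mod_cast hm
  rw [fun_iteratedFDeriv_add_apply ((h₁.contDiff x).contDiffAt.of_le hm')
    ((h₂.contDiff x).contDiffAt.of_le hm')]
  calc _ ≤ _ := norm_add_le _ _
    _ ≤ C₁ * a x * ρ x ^ m + C₂ * a x * ρ x ^ m := add_le_add (hb₁ x W hW m hm) (hb₂ x W hW m hm)
    _ = _ := by ring

lemma HasGrowth.mul {g₁ g₂ : S → E → ℝ} (h₁ : HasGrowth s a ρ g₁) (h₂ : HasGrowth s b ρ g₂)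
    (ha : ∀ x, 0 ≤ a x) (hb : ∀ x, 0 ≤ b x) (hρ : ∀ x, 0 ≤ ρ x) :
    HasGrowth s (fun x => a x * b x) ρ fun x W => g₁ x W * g₂ x W := by
  obtain ⟨C₁, hC₁, hb₁⟩ := h₁.bound
  obtain ⟨C₂, hC₂, hb₂⟩ := h₂.bound
  -- By Leibniz' formula the binomial coefficients sum to `2 ^ m ≤ 8`, and the powers of `ρ` combine
  -- to `ρ ^ m`.
  refine ⟨fun x => (h₁.contDiff x).mul (h₂.contDiff x), 8 * (C₁ * C₂), by positivity,
    fun x W hW m hm => ?_⟩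
  have hm' : (m : WithTop ℕ∞) ≤ 3 := by exact_mod_cast hm
  have := ha x
  have := hb x
  have := hρ x
  calc _ ≤ _ := norm_iteratedFDeriv_mul_le (h₁.contDiff x) (h₂.contDiff x) W hm'
    _ ≤ ∑ i ∈ Finset.range (m + 1), (m.choose i : ℝ) * (C₁ * C₂ * (a x * b x) * ρ x ^ m) := by
      refine Finset.sum_le_sum fun i hi => ?_
      have hi' : i ≤ m := Nat.lt_succ_iff.1 (Finset.mem_range.1 hi)
      calc _ ≤ (m.choose i : ℝ) * (C₁ * a x * ρ x ^ i) * (C₂ * b x * ρ x ^ (m - i)) := by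
            gcongr
            · exact hb₁ x W hW i (hi'.trans hm)
            · exact hb₂ x W hW _ ((Nat.sub_le _ _).trans hm)
        _ = (m.choose i : ℝ) * (C₁ * C₂ * (a x * b x) * (ρ x ^ i * ρ x ^ (m - i))) := by ring
        _ = _ := by rw [← pow_add, Nat.add_sub_cancel' hi']
    _ = 2 ^ m * (C₁ * C₂ * (a x * b x) * ρ x ^ m) := by
      rw [← Finset.sum_mul]
      congr 1
      exact_mod_cast Nat.sum_range_choose m
    _ ≤ 2 ^ 3 * (C₁ * C₂ * (a x * b x) * ρ x ^ m) := by
      gcongr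
      norm_num
    _ = _ := by ring

lemma HasGrowth.clm_comp {F : Type*} [NormedAddCommGroup F] [NormedSpace ℝ F] {g : S → E → V}
    (h : HasGrowth s a ρ g) (l : V →L[ℝ] F) : HasGrowth s a ρ fun x W => l (g x W) := by
  obtain ⟨C, hC, hb⟩ := h.bound
  refine ⟨fun x => l.contDiff.comp (h.contDiff x), ‖l‖ * C, by positivity, fun x W hW m hm => ?_⟩
  have hm' : (m : WithTop ℕ∞) ≤ 3 := by exact_mod_cast hm
  calc _ ≤ ‖l‖ * ‖iteratedFDeriv ℝ m (g x) W‖ :=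
        l.norm_iteratedFDeriv_comp_left (h.contDiff x).contDiffAt hm'
    _ ≤ ‖l‖ * (C * a x * ρ x ^ m) := by gcongr; exact hb x W hW m hm
    _ = _ := by ring

lemma HasGrowth.sum {κ : Type*} {g : κ → S → E → V} (u : Finset κ) (ha : ∀ x, 0 ≤ a x)
    (hρ : ∀ x, 0 ≤ ρ x) (h : ∀ i ∈ u, HasGrowth s a ρ (g i)) :
    HasGrowth s a ρ fun x W => ∑ i ∈ u, g i x W := by
  classical
  induction u using Finset.induction_on with
  | empty =>
    simp only [Finset.sum_empty]
    exact hasGrowth_const (fun x => by simpa using ha x) hρ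
  | insert i u hi ih =>
    simp only [Finset.sum_insert hi]
    exact (h i (Finset.mem_insert_self _ _)).add
      (ih fun j hj => h j (Finset.mem_insert_of_mem hj))

/-- At order zero the bound comes from monotonicity, which keeps `φ` between its two limits. -/
lemma IsSigmoidal.exists_norm_iteratedFDeriv_le {φ : ℝ → ℝ} (hφ : IsSigmoidal φ) :
    ∃ C : ℝ, 0 ≤ C ∧ ∀ m ≤ 3, ∀ x, ‖iteratedFDeriv ℝ m φ x‖ ≤ C := by
  obtain ⟨u, v, -, hu, hv⟩ := hφ.limits
  obtain ⟨C₁, h₁⟩ := hφ.bounded_deriv 1 le_rfl (by norm_num)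
  obtain ⟨C₂, h₂⟩ := hφ.bounded_deriv 2 (by norm_num) (by norm_num)
  obtain ⟨C₃, h₃⟩ := hφ.bounded_deriv 3 (by norm_num) le_rfl
  have p₁ := (abs_nonneg _).trans (h₁ 0)
  have p₂ := (abs_nonneg _).trans (h₂ 0)
  have p₃ := (abs_nonneg _).trans (h₃ 0)
  refine ⟨|u| + |v| + C₁ + C₂ + C₃, by positivity, fun m hm x => ?_⟩
  have q₁ := abs_nonneg u
  have q₂ := abs_nonneg v
  rw [norm_iteratedFDeriv_eq_norm_iteratedDeriv, Real.norm_eq_abs]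
  interval_cases m
  · rw [iteratedDeriv_zero]
    have hle : u ≤ φ x := hφ.monotone.le_of_tendsto hu x
    have hge : φ x ≤ v := hφ.monotone.ge_of_tendsto hv x
    rw [abs_le]
    constructor <;> linarith [neg_abs_le u, le_abs_self v]
  · linarith [h₁ x]
  · linarith [h₂ x]
  · linarith [h₃ x]

/-- Since `φ` and its derivatives are bounded on the whole line, `s` may be any set; each derivative
in `W` brings out one factor `‖l x‖`. -/
lemma hasGrowth_sigmoidal_clm {φ : ℝ → ℝ} (hφ : IsSigmoidal φ) {l : S → E →L[ℝ] ℝ} {c : ℝ}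
    (hc : 1 ≤ c) (hl : ∀ x, ‖l x‖ ≤ c * ρ x) (hρ : ∀ x, 0 ≤ ρ x) :
    HasGrowth s (fun _ : S => 1) ρ fun x W => φ (l x W) := by
  obtain ⟨C, hC, hb⟩ := hφ.exists_norm_iteratedFDeriv_le
  -- `6 = 3!` bounds the factor `m!` of the composition estimate, and `c ^ m ≤ c ^ 3` because `1 ≤
  -- c`.
  refine ⟨fun x => hφ.contDiff.comp (l x).contDiff, 6 * C * c ^ 3, by positivity,
    fun x W _ m hm => ?_⟩
  have hm' : (m : WithTop ℕ∞) ≤ 3 := by exact_mod_cast hm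
  have := hρ x
  calc _ ≤ (m.factorial : ℝ) * C * (c * ρ x) ^ m :=
        norm_iteratedFDeriv_comp_le hφ.contDiff (l x).contDiff hm' W
          (fun i hi => hb i (hi.trans hm) _)
          fun i hi _ => norm_iteratedFDeriv_clm_le (l x) W (hl x) hi
    _ = (m.factorial : ℝ) * C * c ^ m * ρ x ^ m := by ring
    _ ≤ 6 * C * c ^ 3 * ρ x ^ m := by
      gcongr
      exact_mod_cast (Nat.factorial_le hm : m.factorial ≤ 6)
    _ = _ := by ring

end Growth

/-! ### Growth of the perceptron and of its residual products. -/

section Perceptron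

variable {d p h : ℕ} {φ : ℝ → ℝ} {A : Finset (WeightIndex d p h)}

/-- The weight at position `i` as a linear form in the free weights. -/
def weightCLM (A : Finset (WeightIndex d p h)) (i : WeightIndex d p h) :
    EuclideanSpace ℝ A →L[ℝ] ℝ :=
  if hi : i ∈ A then EuclideanSpace.proj ⟨i, hi⟩ else 0

lemma weightCLM_apply (i : WeightIndex d p h) (W : EuclideanSpace ℝ A) :
    weightCLM A i W = weightAt A W i := by
  unfold weightCLM weightAt
  split_ifs <;> simp

lemma norm_weightCLM_le (i : WeightIndex d p h) : ‖weightCLM A i‖ ≤ 1 := by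
  refine ContinuousLinearMap.opNorm_le_bound _ zero_le_one fun W => ?_
  rw [weightCLM_apply, one_mul]
  unfold weightAt
  split_ifs
  · exact PiLp.norm_apply_le W _
  · simp

/-- The input of the `j`-th hidden unit as a linear form in the weights. -/
def hiddenInput (A : Finset (WeightIndex d p h)) (j : Fin h) (z : EuclideanSpace ℝ (Fin p)) :
    EuclideanSpace ℝ A →L[ℝ] ℝ :=
  ∑ m : Fin p, z m • weightCLM A (Sum.inr (Sum.inr (Sum.inl (j, m)))) +
    weightCLM A (Sum.inr (Sum.inr (Sum.inr j)))

lemma mlp_apply (W : EuclideanSpace ℝ A) (z : EuclideanSpace ℝ (Fin p)) (i : Fin d) :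
    mlp φ A W z i = weightCLM A (Sum.inl i) W +
      ∑ j : Fin h, weightCLM A (Sum.inr (Sum.inl (i, j))) W * φ (hiddenInput A j z W) := by
  simp [mlp, hiddenInput, weightCLM_apply, mul_comm]

lemma norm_hiddenInput_le (j : Fin h) (z : EuclideanSpace ℝ (Fin p)) :
    ‖hiddenInput A j z‖ ≤ (p + 1) * (1 + ‖z‖) := by
  have : ∀ m : Fin p, ‖z m • weightCLM A (Sum.inr (Sum.inr (Sum.inl (j, m))))‖ ≤ ‖z‖ := by
    intro m
    rw [norm_smul]
    calc ‖z m‖ * _ ≤ ‖z‖ * 1 := by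
          gcongr
          · exact PiLp.norm_apply_le z m
          · exact norm_weightCLM_le _
      _ = ‖z‖ := mul_one _
  calc _ ≤ _ := norm_add_le _ _
    _ ≤ ∑ m : Fin p, ‖z‖ + 1 :=
      add_le_add (norm_sum_le_of_le _ fun m _ => this m) (norm_weightCLM_le _)
    _ = p * ‖z‖ + 1 := by simp
    _ ≤ (p + 1) * (1 + ‖z‖) := by
      have : (0 : ℝ) ≤ p := by positivity
      nlinarith [norm_nonneg z]

/-- The hidden inputs are linear in the weights with norm of order `1 + ‖z‖`. At order zero the
bound does not involve `z`: the outputs are bounded, as `φ` is. -/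
lemma hasGrowth_mlp (hφ : IsSigmoidal φ) {s : Set (EuclideanSpace ℝ A)}
    (hs : Bornology.IsBounded s) (i : Fin d) :
    HasGrowth s (fun _ : EuclideanSpace ℝ (Fin p) => 1) (fun z => 1 + ‖z‖)
      fun z W => mlp φ A W z i := by
  have hρ : ∀ z : EuclideanSpace ℝ (Fin p), 1 ≤ 1 + ‖z‖ := fun z => by simp
  have hρ0 : ∀ z : EuclideanSpace ℝ (Fin p), 0 ≤ 1 + ‖z‖ := fun z => by positivity
  simp only [mlp_apply]
  refine (hasGrowth_clm _ hs hρ).add (HasGrowth.sum _ (fun _ => zero_le_one) hρ0 fun j _ => ?_)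
  have := (hasGrowth_clm (weightCLM A (Sum.inr (Sum.inl (i, j)))) hs hρ).mul
    (hasGrowth_sigmoidal_clm hφ (c := p + 1) (by simp) (norm_hiddenInput_le j) hρ0)
    (fun _ => zero_le_one) (fun _ => zero_le_one) hρ0
  simpa using this

lemma contDiff_mlp (hφ : IsSigmoidal φ) (i : Fin d) :
    ContDiff ℝ 3 fun q : EuclideanSpace ℝ (Fin p) × EuclideanSpace ℝ A => mlp φ A q.2 q.1 i := by
  have hw : ∀ k, ContDiff ℝ 3 fun q : EuclideanSpace ℝ (Fin p) × EuclideanSpace ℝ A =>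
      weightCLM A k q.2 := fun k => (weightCLM A k).contDiff.comp contDiff_snd
  have hz : ∀ m : Fin p, ContDiff ℝ 3 fun q : EuclideanSpace ℝ (Fin p) × EuclideanSpace ℝ A =>
      q.1 m := fun m => (EuclideanSpace.proj (𝕜 := ℝ) m).contDiff.comp contDiff_fst
  simp only [mlp_apply, hiddenInput, add_apply, sum_apply,
    smul_apply, smul_eq_mul]
  refine (hw _).add (ContDiff.sum fun j _ => (hw _).mul (hφ.contDiff.comp ?_))
  exact (ContDiff.sum fun m _ => (hz m).mul (hw _)).add (hw _)

/-- The products `r_i r_j` of the components of the residual `r = F_{W₀}(z) + e - F_W(z)`, as a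
function of the input `z`, of the noise `e` and of the parameter `W`. -/
def residualProd (φ : ℝ → ℝ) (A : Finset (WeightIndex d p h)) (W₀ : EuclideanSpace ℝ A)
    (x : EuclideanSpace ℝ (Fin p) × EuclideanSpace ℝ (Fin d)) (W : EuclideanSpace ℝ A) :
    Fin d → Fin d → ℝ :=
  fun i j => (mlp φ A W₀ x.1 i + x.2 i - mlp φ A W x.1 i) *
    (mlp φ A W₀ x.1 j + x.2 j - mlp φ A W x.1 j)

lemma contDiff_residualProd (hφ : IsSigmoidal φ) (W₀ : EuclideanSpace ℝ A) :
    ContDiff ℝ 3 fun q : (EuclideanSpace ℝ (Fin p) × EuclideanSpace ℝ (Fin d)) ×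
      EuclideanSpace ℝ A => residualProd φ A W₀ q.1 q.2 := by
  have hr : ∀ i, ContDiff ℝ 3 fun q : (EuclideanSpace ℝ (Fin p) × EuclideanSpace ℝ (Fin d)) ×
      EuclideanSpace ℝ A => mlp φ A W₀ q.1.1 i + q.1.2 i - mlp φ A q.2 q.1.1 i := by
    intro i
    refine ContDiff.sub (ContDiff.add ?_ ?_) ?_
    · exact (contDiff_mlp hφ i).comp (contDiff_fst.fst.prodMk contDiff_const)
    · exact (EuclideanSpace.proj (𝕜 := ℝ) i).contDiff.comp contDiff_fst.snd
    · exact (contDiff_mlp hφ i).comp (contDiff_fst.fst.prodMk contDiff_snd)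
  exact contDiff_pi.2 fun i => contDiff_pi.2 fun j => (hr i).mul (hr j)

/-- The noise stays in the amplitude and the input in the rate, so that the two factors can later be
integrated separately by independence. -/
lemma hasGrowth_residualProd (hφ : IsSigmoidal φ) (W₀ : EuclideanSpace ℝ A)
    {s : Set (EuclideanSpace ℝ A)} (hs : Bornology.IsBounded s) :
    HasGrowth s (fun x : EuclideanSpace ℝ (Fin p) × EuclideanSpace ℝ (Fin d) => (1 + ‖x.2‖) ^ 2)
      (fun x => 1 + ‖x.1‖) (residualProd φ A W₀) := by
  have hρ0 : ∀ x : EuclideanSpace ℝ (Fin p) × EuclideanSpace ℝ (Fin d), 0 ≤ 1 + ‖x.1‖ :=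
    fun x => by positivity
  have ha0 : ∀ x : EuclideanSpace ℝ (Fin p) × EuclideanSpace ℝ (Fin d), 0 ≤ 1 + ‖x.2‖ :=
    fun x => by positivity
  have hF : ∀ i, ∀ s : Set (EuclideanSpace ℝ A), Bornology.IsBounded s →
      HasGrowth s (fun x : EuclideanSpace ℝ (Fin p) × EuclideanSpace ℝ (Fin d) => 1 + ‖x.2‖)
      (fun x => 1 + ‖x.1‖) fun x W => mlp φ A W x.1 i := by
    intro i s hs
    obtain ⟨C, hC, hb⟩ := (hasGrowth_mlp hφ hs i).bound
    refine ⟨fun x => (hasGrowth_mlp hφ hs i).contDiff x.1, C, hC, fun x W hW m hm => ?_⟩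
    refine (hb x.1 W hW m hm).trans ?_
    gcongr
    simp
  have hF₀ : ∀ i, HasGrowth s
      (fun x : EuclideanSpace ℝ (Fin p) × EuclideanSpace ℝ (Fin d) => 1 + ‖x.2‖)
      (fun x => 1 + ‖x.1‖) fun x (_ : EuclideanSpace ℝ A) => mlp φ A W₀ x.1 i := by
    intro i
    obtain ⟨C, hC, hb⟩ := (hF i {W₀} Bornology.isBounded_singleton).bound
    refine ⟨fun x => contDiff_const, C, hC, fun x W hW m hm => ?_⟩
    rcases Nat.eq_zero_or_pos m with rfl | hm0
    · simpa using hb x W₀ rfl 0 hm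
    · rw [iteratedFDeriv_const_of_ne hm0.ne']
      have := hρ0 x
      have := ha0 x
      simp only [Pi.zero_apply, norm_zero]
      positivity
  have hr : ∀ i, HasGrowth s
      (fun x : EuclideanSpace ℝ (Fin p) × EuclideanSpace ℝ (Fin d) => 1 + ‖x.2‖)
      (fun x => 1 + ‖x.1‖) fun x W => mlp φ A W₀ x.1 i + x.2 i - mlp φ A W x.1 i := by
    intro i
    have h₁ := (hF₀ i).add (hasGrowth_const (s := s) (a := fun x => 1 + ‖x.2‖)
      (c := fun x : EuclideanSpace ℝ (Fin p) × EuclideanSpace ℝ (Fin d) => x.2 i)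
      (fun x => (PiLp.norm_apply_le x.2 i).trans (by simp)) hρ0)
    have h₂ := h₁.add ((hF i s hs).clm_comp (-ContinuousLinearMap.id ℝ ℝ))
    simpa [sub_eq_add_neg] using h₂
  -- The matrix is rebuilt from its entries by linear maps, which reduces the bound to products of
  -- real functions.
  have hsum : residualProd φ A W₀ = fun x W => ∑ i, ∑ j,
      ContinuousLinearMap.toSpanSingleton ℝ (Pi.single i (Pi.single j 1) : Fin d → Fin d → ℝ)
        ((mlp φ A W₀ x.1 i + x.2 i - mlp φ A W x.1 i) *
          (mlp φ A W₀ x.1 j + x.2 j - mlp φ A W x.1 j)) := by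
    ext x W k l
    simp [residualProd, Finset.sum_apply, Pi.single_apply, Finset.sum_ite_eq, ite_apply]
  rw [hsum]
  have ha2 : ∀ x : EuclideanSpace ℝ (Fin p) × EuclideanSpace ℝ (Fin d), 0 ≤ (1 + ‖x.2‖) ^ 2 :=
    fun x => by positivity
  refine HasGrowth.sum _ ha2 hρ0 fun i _ => HasGrowth.sum _ ha2 hρ0 fun j _ => ?_
  have := (hr i).mul (hr j) ha0 ha0 hρ0
  simp only [← sq] at this
  exact this.clm_comp _

variable {Ω : Type*} [MeasurableSpace Ω] {P : Measure Ω} [IsProbabilityMeasure P]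

lemma integrable_one_add_norm_pow {F : Type*} [NormedAddCommGroup F] {ξ : Ω → F} {k : ℕ}
    (hξm : AEStronglyMeasurable ξ P) (hξ : Integrable (fun ω => ‖ξ ω‖ ^ k) P) :
    Integrable (fun ω => (1 + ‖ξ ω‖) ^ k) P := by
  refine (((integrable_const 1).add hξ).const_mul (2 ^ (k - 1))).mono'
    ((hξm.norm.const_add 1).pow k) (Eventually.of_forall fun ω => ?_)
  rw [Real.norm_of_nonneg (by positivity)]
  simpa using add_pow_le zero_le_one (norm_nonneg (ξ ω)) k

/-- The dominating function is a multiple of `(1 + ‖ε‖)² (1 + ‖Z‖)³`. Independence splits its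
expectation, so two moments of the noise and three of the regressor are enough. -/
theorem isDominatedC3_residualProd (hφ : IsSigmoidal φ) (W₀ : EuclideanSpace ℝ A)
    {Z : Ω → EuclideanSpace ℝ (Fin p)} {ε : Ω → EuclideanSpace ℝ (Fin d)}
    (hZ : Measurable Z) (hε : Measurable ε) (hεZ : IndepFun ε Z P)
    (hε2 : Integrable (fun ω => ‖ε ω‖ ^ 2) P) (hZ3 : Integrable (fun ω => ‖Z ω‖ ^ 3) P) :
    IsDominatedC3 P (fun ω => (Z ω, ε ω)) (residualProd φ A W₀) := by
  refine IsDominatedC3.of_contDiff (contDiff_residualProd hφ W₀) fun R => ?_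
  obtain ⟨C, hC0, hb⟩ := (hasGrowth_residualProd hφ W₀
    (Metric.isBounded_closedBall (x := (0 : EuclideanSpace ℝ A)) (r := R))).bound
  refine ⟨fun x => C * (1 + ‖x.2‖) ^ 2 * (1 + ‖x.1‖) ^ 3, by fun_prop, ?_,
    fun x W hW m hm => (hb x W hW m hm).trans ?_⟩
  · simp only [mul_assoc]
    refine Integrable.const_mul ?_ _
    refine IndepFun.integrable_mul (X := fun ω => (1 + ‖ε ω‖) ^ 2)
      (Y := fun ω => (1 + ‖Z ω‖) ^ 3) ?_ (integrable_one_add_norm_pow hε.aestronglyMeasurable hε2)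
      (integrable_one_add_norm_pow hZ.aestronglyMeasurable hZ3)
    exact hεZ.comp (φ := fun e => (1 + ‖e‖) ^ 2) (ψ := fun z => (1 + ‖z‖) ^ 3)
      (by fun_prop) (by fun_prop)
  · beta_reduce
    gcongr
    simp

end Perceptron

/-! ### Derivative of `ln det`, and gradient of a logarithm. -/

section LogDet

variable {d : ℕ}

lemma contDiff_det {n : WithTop ℕ∞} :
    ContDiff ℝ n fun M : Fin d → Fin d → ℝ => (Matrix.of M).det := by
  simp only [Matrix.det_apply]
  refine ContDiff.sum fun σ _ => ContDiff.const_smul _ (contDiff_prod fun i _ => ?_)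
  exact contDiff_apply_apply ℝ ℝ (σ i) i

lemma contDiffAt_log_det {n : WithTop ℕ∞} {M : Fin d → Fin d → ℝ} (hM : (Matrix.of M).det ≠ 0) :
    ContDiffAt ℝ n (fun M : Fin d → Fin d → ℝ => Real.log (Matrix.of M).det) M :=
  contDiff_det.contDiffAt.log hM

/-- The derivative of `ln det`. -/
lemma fderiv_log_det_apply {M : Fin d → Fin d → ℝ} (hM : (Matrix.of M).det ≠ 0)
    (N : Fin d → Fin d → ℝ) :
    fderiv ℝ (fun M : Fin d → Fin d → ℝ => Real.log (Matrix.of M).det) M N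
      = ((Matrix.of M)⁻¹ * Matrix.of N).trace := by
  have hd := ((contDiffAt_log_det (n := 1) hM).differentiableAt (by simp)).hasFDerivAt
  -- Along the line `M + t N` the determinant is `det M * det (1 + t T)` with `T = M⁻¹ N`, and `det
  -- (1 + t T) = 1 + t tr T + O(t²)`.
  have hline : HasDerivAt (fun t : ℝ => M + t • N) N 0 := by
    simpa using ((hasDerivAt_id (0 : ℝ)).smul_const N).const_add M
  have hd' : HasFDerivAt (fun M : Fin d → Fin d → ℝ => Real.log (Matrix.of M).det)
      (fderiv ℝ (fun M : Fin d → Fin d → ℝ => Real.log (Matrix.of M).det) M) (M + (0 : ℝ) • N) := by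
    simpa using hd
  have h₁ := hd'.comp_hasDerivAt (0 : ℝ) hline
  set T := (Matrix.of M)⁻¹ * Matrix.of N with hT
  have hdet : ∀ t : ℝ, (Matrix.of (M + t • N)).det = (Matrix.of M).det * (1 + t • T).det := by
    intro t
    rw [← Matrix.det_mul, mul_add, mul_one, mul_smul_comm, hT, ← mul_assoc,
      Matrix.mul_nonsing_inv _ (isUnit_iff_ne_zero.2 hM), one_mul]
    rfl
  obtain ⟨q, hq⟩ : ∃ q : Polynomial ℝ, ∀ t : ℝ,
      (1 + t • T).det = 1 + T.trace * t + q.eval t * t ^ 2 :=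
    ⟨_, fun t => Matrix.det_one_add_smul t T⟩
  have h₂ : HasDerivAt (fun t : ℝ => (Matrix.of M).det * (1 + T.trace * t + q.eval t * t ^ 2))
      ((Matrix.of M).det * T.trace) 0 := by
    have := ((((hasDerivAt_id (0 : ℝ)).const_mul T.trace).const_add 1).add
      ((q.hasDerivAt 0).mul ((hasDerivAt_id (0 : ℝ)).pow 2))).const_mul (Matrix.of M).det
    simpa using this
  have h₃ := h₂.log (by simpa using hM)
  have h₄ : (fun M : Fin d → Fin d → ℝ => Real.log (Matrix.of M).det) ∘ (fun t : ℝ => M + t • N)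
      = fun t : ℝ => Real.log ((Matrix.of M).det * (1 + T.trace * t + q.eval t * t ^ 2)) := by
    ext1 t
    simp only [Function.comp_apply]
    rw [hdet, hq]
  rw [h₄] at h₁
  rw [h₁.unique h₃]
  field_simp
  simp

/-- The gradient of `ln g`, also where `g` vanishes. -/
lemma gradient_log {F : Type*} [NormedAddCommGroup F] [InnerProductSpace ℝ F] [CompleteSpace F]
    {g : F → ℝ} {W : F} (hg : DifferentiableAt ℝ g W) :
    gradient (fun W => Real.log (g W)) W = (g W)⁻¹ • gradient g W := by
  rcases eq_or_ne (g W) 0 with h0 | h0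
  · rw [h0, inv_zero, zero_smul]
    -- With `Real.log 0 = 0`, continuity of `log g` at a zero of `g` forces `g` to vanish nearby: a
    -- small nonzero value of `g` would have a logarithm below `-1`. So `log g` is locally zero or
    -- not differentiable, and in both cases the gradient is `0`.
    by_cases hd : DifferentiableAt ℝ (fun W => Real.log (g W)) W
    · have e₁ : ∀ᶠ W' in 𝓝 W, -1 < Real.log (g W') := by
        refine hd.continuousAt.eventually (lt_mem_nhds ?_)
        simp [h0]
      have e₂ : ∀ᶠ W' in 𝓝 W, |g W'| < Real.exp (-1) := by
        refine hg.continuousAt.abs.eventually (gt_mem_nhds ?_)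
        simp [h0, Real.exp_pos]
      have e₃ : (fun W => Real.log (g W)) =ᶠ[𝓝 W] fun _ => 0 := by
        filter_upwards [e₁, e₂] with W' h₁ h₂
        by_contra hne
        have hg0 : g W' ≠ 0 := fun h => hne (by simp [h])
        rw [← Real.log_abs] at h₁
        have := (Real.log_lt_log (abs_pos.2 hg0) h₂)
        rw [Real.log_exp] at this
        linarith
      rw [gradient, e₃.fderiv_eq]
      simp
    · exact gradient_eq_zero_of_not_differentiableAt hd
  · rw [gradient, fderiv.log hg h0, gradient]
    simp

end LogDet

/-! ### Second derivatives of products, and differentiation entry by entry. -/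

section Products

variable {E : Type*} [NormedAddCommGroup E] [NormedSpace ℝ E]

lemma fderiv_fderiv_mul_apply {g₁ g₂ : E → ℝ} (h₁ : ContDiff ℝ 2 g₁) (h₂ : ContDiff ℝ 2 g₂)
    (W u v : E) :
    fderiv ℝ (fderiv ℝ fun W => g₁ W * g₂ W) W u v =
      g₁ W * fderiv ℝ (fderiv ℝ g₂) W u v + fderiv ℝ g₁ W u * fderiv ℝ g₂ W v +
      (g₂ W * fderiv ℝ (fderiv ℝ g₁) W u v + fderiv ℝ g₂ W u * fderiv ℝ g₁ W v) := by
  have d₁ := h₁.differentiable (by simp)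
  have d₂ := h₂.differentiable (by simp)
  have h₁' : ContDiff ℝ 1 (fderiv ℝ g₁) := h₁.fderiv_right (by norm_num)
  have h₂' : ContDiff ℝ 1 (fderiv ℝ g₂) := h₂.fderiv_right (by norm_num)
  have d₁' := h₁'.differentiable (by simp)
  have d₂' := h₂'.differentiable (by simp)
  have hmul : (fderiv ℝ fun W => g₁ W * g₂ W)
      = fun W => g₁ W • fderiv ℝ g₂ W + g₂ W • fderiv ℝ g₁ W := by
    ext1 W
    exact fderiv_fun_mul (d₁ W) (d₂ W)
  rw [hmul]
  have key := ((d₁ W).hasFDerivAt.smul (d₂' W).hasFDerivAt).add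
    ((d₂ W).hasFDerivAt.smul (d₁' W).hasFDerivAt)
  have key' := key.fderiv
  simp only [Pi.add_def, Pi.smul_def'] at key'
  rw [key']
  simp

lemma fderiv_clm_comp_apply {V : Type*} [NormedAddCommGroup V] [NormedSpace ℝ V] {g : E → V}
    (hg : Differentiable ℝ g) (l : V →L[ℝ] ℝ) (W u : E) :
    l (fderiv ℝ g W u) = fderiv ℝ (fun W => l (g W)) W u := by
  have h := (l.hasFDerivAt.comp W (hg W).hasFDerivAt).fderiv
  have h' : fderiv ℝ (fun W => l (g W)) W = l.comp (fderiv ℝ g W) := h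
  rw [h']
  rfl

lemma fderiv_fderiv_clm_comp_apply {V : Type*} [NormedAddCommGroup V] [NormedSpace ℝ V] {g : E → V}
    (hg : ContDiff ℝ 2 g) (l : V →L[ℝ] ℝ) (W u v : E) :
    l (fderiv ℝ (fderiv ℝ g) W u v) = fderiv ℝ (fderiv ℝ fun W => l (g W)) W u v := by
  have hg' : ContDiff ℝ 1 (fderiv ℝ g) := hg.fderiv_right (by norm_num)
  have h₁ : (fderiv ℝ fun W => l (g W))
      = fun W => ContinuousLinearMap.compL ℝ E V ℝ l (fderiv ℝ g W) := by
    ext W u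
    exact (fderiv_clm_comp_apply (hg.differentiable (by simp)) l W u).symm
  rw [h₁]
  have h₂ := ((ContinuousLinearMap.compL ℝ E V ℝ l).hasFDerivAt.comp W
    (hg'.differentiable (by simp) W).hasFDerivAt).fderiv
  have h₃ : fderiv ℝ (fun W => ContinuousLinearMap.compL ℝ E V ℝ l (fderiv ℝ g W)) W
      = (ContinuousLinearMap.compL ℝ E V ℝ l).comp (fderiv ℝ (fderiv ℝ g) W) := h₂
  rw [h₃]
  rfl

end Products

/-! ### Derivatives of the residual products at the true parameter. -/

section Residuals

variable {d p h : ℕ} {φ : ℝ → ℝ} {A : Finset (WeightIndex d p h)}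

lemma contDiff_mlp_apply (hφ : IsSigmoidal φ) (z : EuclideanSpace ℝ (Fin p)) (i : Fin d) :
    ContDiff ℝ 3 fun W : EuclideanSpace ℝ A => mlp φ A W z i :=
  (contDiff_mlp hφ i).comp (contDiff_const.prodMk contDiff_id)

lemma logDetCost_mlp (W₀ : EuclideanSpace ℝ A) (z : ℕ → EuclideanSpace ℝ (Fin p))
    (e : ℕ → EuclideanSpace ℝ (Fin d)) (n : ℕ) (W : EuclideanSpace ℝ A) :
    empCov (mlp φ A) (fun t => mlp φ A W₀ (z t) + e t) z n W
      = Matrix.of (sampleMean (residualProd φ A W₀) (fun t => (z t, e t)) n W) := by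
  ext i j
  simp [empCov, sampleMean, residualProd, Matrix.sum_apply, Matrix.vecMulVec_apply,
    Finset.sum_apply]

variable (φ A) in
/-- The derivative of the `i`-th output of the perceptron with respect to the weights. -/
def outputDeriv (W : EuclideanSpace ℝ A) (z : EuclideanSpace ℝ (Fin p)) (i : Fin d) :
    EuclideanSpace ℝ A →L[ℝ] ℝ :=
  fderiv ℝ (fun W => mlp φ A W z i) W

variable (φ A) in
/-- The second derivative of the `i`-th output of the perceptron. -/
def outputDeriv₂ (W : EuclideanSpace ℝ A) (z : EuclideanSpace ℝ (Fin p)) (i : Fin d) :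
    EuclideanSpace ℝ A →L[ℝ] EuclideanSpace ℝ A →L[ℝ] ℝ :=
  fderiv ℝ (fderiv ℝ fun W => mlp φ A W z i) W

lemma partialDeriv_mlp (hφ : IsSigmoidal φ) (W : EuclideanSpace ℝ A)
    (z : EuclideanSpace ℝ (Fin p)) (k : A) (i : Fin d) :
    partialDeriv k (fun W => mlp φ A W z) W i
      = outputDeriv φ A W z i (EuclideanSpace.single k 1) := by
  have hd : Differentiable ℝ fun W : EuclideanSpace ℝ A => mlp φ A W z := by
    refine differentiable_euclidean.2 fun i => ?_
    exact (contDiff_mlp_apply hφ z i).differentiable (by simp)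
  exact fderiv_clm_comp_apply hd (EuclideanSpace.proj i) W (EuclideanSpace.single k 1)

/-- The entry at position `(i, j)` of a matrix as a continuous linear form. -/
def entryCLM (i j : Fin d) : (Fin d → Fin d → ℝ) →L[ℝ] ℝ :=
  (ContinuousLinearMap.proj (R := ℝ) (φ := fun _ : Fin d => ℝ) j).comp
    (ContinuousLinearMap.proj (R := ℝ) (φ := fun _ : Fin d => Fin d → ℝ) i)

lemma entryCLM_apply (i j : Fin d) (M : Fin d → Fin d → ℝ) : entryCLM i j M = M i j := rfl

lemma contDiff_residualProd_right (hφ : IsSigmoidal φ) (W₀ : EuclideanSpace ℝ A)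
    (x : EuclideanSpace ℝ (Fin p) × EuclideanSpace ℝ (Fin d)) :
    ContDiff ℝ 3 (residualProd φ A W₀ x) := by
  have h := (contDiff_residualProd hφ W₀).comp (contDiff_prodMk_right x)
  exact h

lemma contDiff_residual (hφ : IsSigmoidal φ) (z : EuclideanSpace ℝ (Fin p)) (c : ℝ) (i : Fin d) :
    ContDiff ℝ 2 fun W : EuclideanSpace ℝ A => c - mlp φ A W z i :=
  contDiff_const.sub ((contDiff_mlp_apply hφ z i).of_le (by norm_num))

lemma fderiv_residual (z : EuclideanSpace ℝ (Fin p)) (c : ℝ) (i : Fin d) :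
    (fderiv ℝ fun W : EuclideanSpace ℝ A => c - mlp φ A W z i)
      = fun W => -outputDeriv φ A W z i := by
  ext1 W
  exact fderiv_const_sub _

/-- At `W₀` the residual is the noise itself, so every term is a noise coordinate times a function
of the input. -/
lemma fderiv_residualProd_apply (hφ : IsSigmoidal φ) (W₀ u : EuclideanSpace ℝ A)
    (z : EuclideanSpace ℝ (Fin p)) (e : EuclideanSpace ℝ (Fin d)) (i j : Fin d) :
    fderiv ℝ (residualProd φ A W₀ (z, e)) W₀ u i j
      = -(e i * outputDeriv φ A W₀ z j u + e j * outputDeriv φ A W₀ z i u) := by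
  have h := fderiv_clm_comp_apply ((contDiff_residualProd_right hφ W₀ (z, e)).differentiable
    (by simp)) (entryCLM i j) W₀ u
  rw [entryCLM_apply] at h
  rw [h]
  simp only [entryCLM_apply, residualProd]
  have h₁ := fderiv_fun_mul
    ((contDiff_residual hφ z (mlp φ A W₀ z i + e i) i).differentiable (by simp) W₀)
    ((contDiff_residual hφ z (mlp φ A W₀ z j + e j) j).differentiable (by simp) W₀)
  rw [h₁, fderiv_residual, fderiv_residual]
  simp
  ring

/-- The terms split into products of first derivatives, free of noise, and terms linear in the
noise, which will average to zero. -/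
lemma fderiv_fderiv_residualProd_apply (hφ : IsSigmoidal φ) (W₀ u v : EuclideanSpace ℝ A)
    (z : EuclideanSpace ℝ (Fin p)) (e : EuclideanSpace ℝ (Fin d)) (i j : Fin d) :
    fderiv ℝ (fderiv ℝ (residualProd φ A W₀ (z, e))) W₀ u v i j
      = (outputDeriv φ A W₀ z i u * outputDeriv φ A W₀ z j v +
          outputDeriv φ A W₀ z j u * outputDeriv φ A W₀ z i v) -
        (e i * outputDeriv₂ φ A W₀ z j u v + e j * outputDeriv₂ φ A W₀ z i u v) := by
  have h := fderiv_fderiv_clm_comp_apply ((contDiff_residualProd_right hφ W₀ (z, e)).of_le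
    (by norm_num)) (entryCLM i j) W₀ u v
  rw [entryCLM_apply] at h
  rw [h]
  simp only [entryCLM_apply, residualProd]
  rw [fderiv_fderiv_mul_apply (contDiff_residual hφ z (mlp φ A W₀ z i + e i) i)
    (contDiff_residual hφ z (mlp φ A W₀ z j + e j) j)]
  have h₂ : ∀ i, fderiv ℝ (fun W => -outputDeriv φ A W z i) W₀ = -outputDeriv₂ φ A W₀ z i :=
    fun i => fderiv_neg
  simp only [fderiv_residual, h₂]
  simp
  ring

lemma exists_norm_outputDeriv_le (hφ : IsSigmoidal φ) (W : EuclideanSpace ℝ A) (i : Fin d) :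
    ∃ C, 0 ≤ C ∧ ∀ z : EuclideanSpace ℝ (Fin p), ‖outputDeriv φ A W z i‖ ≤ C * (1 + ‖z‖) ∧
      ‖outputDeriv₂ φ A W z i‖ ≤ C * (1 + ‖z‖) ^ 2 := by
  obtain ⟨C, hC, hb⟩ := (hasGrowth_mlp (φ := φ) hφ
    (Bornology.isBounded_singleton (x := W)) i).bound
  refine ⟨C, hC, fun z => ⟨?_, ?_⟩⟩
  · have := hb z W rfl 1 (by norm_num)
    rwa [norm_iteratedFDeriv_one, mul_one, pow_one] at this
  · have := hb z W rfl 2 (by norm_num)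
    rwa [← norm_iteratedFDeriv_fderiv, norm_iteratedFDeriv_one, mul_one] at this

lemma contDiff_outputDeriv (hφ : IsSigmoidal φ) (i : Fin d) :
    ContDiff ℝ 2 fun q : EuclideanSpace ℝ (Fin p) × EuclideanSpace ℝ A =>
      outputDeriv φ A q.2 q.1 i :=
  contDiff_fderiv_param (f := fun (z : EuclideanSpace ℝ (Fin p)) W => mlp φ A W z i) (m := 3)
    (contDiff_mlp hφ i) (by norm_num)

lemma measurable_outputDeriv (hφ : IsSigmoidal φ) (W : EuclideanSpace ℝ A) (i : Fin d) :
    Measurable fun z : EuclideanSpace ℝ (Fin p) => outputDeriv φ A W z i :=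
  measurable_of_contDiff_param (f := fun (z : EuclideanSpace ℝ (Fin p)) W => outputDeriv φ A W z i)
    (contDiff_outputDeriv hφ i) W

lemma measurable_outputDeriv₂ (hφ : IsSigmoidal φ) (W : EuclideanSpace ℝ A) (i : Fin d) :
    Measurable fun z : EuclideanSpace ℝ (Fin p) => outputDeriv₂ φ A W z i :=
  measurable_of_contDiff_param
    (f := fun (z : EuclideanSpace ℝ (Fin p)) W => outputDeriv₂ φ A W z i)
    (contDiff_fderiv_param (n := 1) (m := 2)
      (f := fun (z : EuclideanSpace ℝ (Fin p)) W => outputDeriv φ A W z i)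
      (contDiff_outputDeriv hφ i) (by norm_num)) W

end Residuals

/-! ### Expectations of the residual products and of their derivatives. -/

section Moments

set_option linter.unusedSectionVars false

variable {d p h : ℕ} {φ : ℝ → ℝ} {A : Finset (WeightIndex d p h)}
  {Ω : Type*} [MeasurableSpace Ω] {P : Measure Ω} [IsProbabilityMeasure P]
  {Z : Ω → EuclideanSpace ℝ (Fin p)} {ε : Ω → EuclideanSpace ℝ (Fin d)}

lemma integral_add_add_add {a b c e : Ω → ℝ} (ha : Integrable a P) (hb : Integrable b P)
    (hc : Integrable c P) (he : Integrable e P) :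
    ∫ ω, (a ω + b ω + (c ω + e ω)) ∂P =
      (∫ ω, a ω ∂P) + (∫ ω, b ω ∂P) + ((∫ ω, c ω ∂P) + ∫ ω, e ω ∂P) := by
  have h := integral_add (ha.add hb) (hc.add he)
  rw [integral_add' ha hb, integral_add' hc he] at h
  exact h

lemma integral_add_sub_add {a b c e : Ω → ℝ} (ha : Integrable a P) (hb : Integrable b P)
    (hc : Integrable c P) (he : Integrable e P) :
    ∫ ω, (a ω + b ω - (c ω + e ω)) ∂P =
      (∫ ω, a ω ∂P) + (∫ ω, b ω ∂P) - ((∫ ω, c ω ∂P) + ∫ ω, e ω ∂P) := by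
  have h := integral_sub (ha.add hb) (hc.add he)
  rw [integral_add' ha hb, integral_add' hc he] at h
  exact h

lemma exists_norm_mlp_sub_le (hφ : IsSigmoidal φ) (W W' : EuclideanSpace ℝ A) (i : Fin d) :
    ∃ C, ∀ z : EuclideanSpace ℝ (Fin p), ‖mlp φ A W z i - mlp φ A W' z i‖ ≤ C := by
  have h : ∀ W : EuclideanSpace ℝ A, ∃ C, ∀ z : EuclideanSpace ℝ (Fin p), ‖mlp φ A W z i‖ ≤ C := by
    intro W
    obtain ⟨C, -, hb⟩ := (hasGrowth_mlp (φ := φ) hφ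
      (Bornology.isBounded_singleton (x := W)) i).bound
    exact ⟨C, fun z => by simpa using hb z W rfl 0 (by norm_num)⟩
  obtain ⟨C, hC⟩ := h W
  obtain ⟨C', hC'⟩ := h W'
  exact ⟨C + C', fun z => (norm_sub_le _ _).trans (add_le_add (hC z) (hC' z))⟩

/-- A regressor `Z` with a finite third moment and an independent centered noise `ε` with a finite
second moment. -/
structure IsRegressionPair (P : Measure Ω) (Z : Ω → EuclideanSpace ℝ (Fin p))
    (ε : Ω → EuclideanSpace ℝ (Fin d)) : Prop where
  measurable_regressor : Measurable Z
  measurable_noise : Measurable ε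
  indepFun : IndepFun ε Z P
  integrable_noise_sq : Integrable (fun ω => ‖ε ω‖ ^ 2) P
  integral_noise : ∫ ω, ε ω ∂P = 0
  integrable_regressor_cube : Integrable (fun ω => ‖Z ω‖ ^ 3) P

namespace IsRegressionPair

lemma measurable_pair (hR : IsRegressionPair P Z ε) : Measurable fun ω => (Z ω, ε ω) :=
  hR.measurable_regressor.prodMk hR.measurable_noise

lemma memLp_noise (hR : IsRegressionPair P Z ε) : MemLp ε 2 P :=
  (memLp_two_iff_integrable_sq_norm hR.measurable_noise.aestronglyMeasurable).2
    hR.integrable_noise_sq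

lemma memLp_noise_coord (hR : IsRegressionPair P Z ε) (i : Fin d) :
    MemLp (fun ω => ε ω i) 2 P :=
  memLp_coord hR.memLp_noise i

lemma integral_noise_coord (hR : IsRegressionPair P Z ε) (i : Fin d) : ∫ ω, ε ω i ∂P = 0 := by
  have h := (EuclideanSpace.proj (𝕜 := ℝ) i).integral_comp_comm
    (hR.memLp_noise.integrable one_le_two)
  rw [hR.integral_noise, map_zero] at h
  exact h

lemma integrable_noise_mul_noise (hR : IsRegressionPair P Z ε) (i j : Fin d) :
    Integrable (fun ω => ε ω i * ε ω j) P :=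
  (hR.memLp_noise_coord i).integrable_mul (hR.memLp_noise_coord j)

section Products

variable {g : EuclideanSpace ℝ (Fin p) → ℝ} {u : EuclideanSpace ℝ (Fin d) → ℝ}

lemma integrable_mul (hR : IsRegressionPair P Z ε) (hu : Measurable u) (hg : Measurable g)
    (hui : Integrable (fun ω => u (ε ω)) P) (hgi : Integrable (fun ω => g (Z ω)) P) :
    Integrable (fun ω => u (ε ω) * g (Z ω)) P :=
  IndepFun.integrable_mul (X := fun ω => u (ε ω)) (Y := fun ω => g (Z ω))
    (hR.indepFun.comp hu hg) hui hgi

lemma integral_mul (hR : IsRegressionPair P Z ε) (hu : Measurable u) (hg : Measurable g) :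
    ∫ ω, u (ε ω) * g (Z ω) ∂P = (∫ ω, u (ε ω) ∂P) * ∫ ω, g (Z ω) ∂P :=
  IndepFun.integral_fun_mul_eq_mul_integral (X := fun ω => u (ε ω)) (Y := fun ω => g (Z ω))
    (hR.indepFun.comp hu hg) (hu.comp hR.measurable_noise).aestronglyMeasurable
    (hg.comp hR.measurable_regressor).aestronglyMeasurable

lemma integrable_noise_coord_mul (hR : IsRegressionPair P Z ε) (hg : Measurable g)
    (hgi : Integrable (fun ω => g (Z ω)) P) (i : Fin d) :
    Integrable (fun ω => ε ω i * g (Z ω)) P :=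
  hR.integrable_mul (u := fun e => e i) (by fun_prop) hg
    ((hR.memLp_noise_coord i).integrable one_le_two) hgi

lemma integral_noise_coord_mul (hR : IsRegressionPair P Z ε) (hg : Measurable g) (i : Fin d) :
    ∫ ω, ε ω i * g (Z ω) ∂P = 0 := by
  rw [hR.integral_mul (u := fun e => e i) (by fun_prop) hg, hR.integral_noise_coord, zero_mul]

end Products

lemma memLp_one_add_norm_regressor (hR : IsRegressionPair P Z ε) :
    MemLp (fun ω => 1 + ‖Z ω‖) 2 P := by
  have hm : AEStronglyMeasurable (fun ω => 1 + ‖Z ω‖) P :=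
    (hR.measurable_regressor.norm.const_add 1).aestronglyMeasurable
  refine (memLp_two_iff_integrable_sq hm).2 ?_
  refine (integrable_one_add_norm_pow hR.measurable_regressor.aestronglyMeasurable
    hR.integrable_regressor_cube).mono' (hm.pow 2) (Eventually.of_forall fun ω => ?_)
  rw [Real.norm_of_nonneg (by positivity)]
  exact pow_le_pow_right₀ (by simp) (by norm_num)

lemma memLp_outputDeriv (hR : IsRegressionPair P Z ε) (hφ : IsSigmoidal φ)
    (W u : EuclideanSpace ℝ A) (i : Fin d) :
    MemLp (fun ω => outputDeriv φ A W (Z ω) i u) 2 P := by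
  obtain ⟨C, hC, hb⟩ := exists_norm_outputDeriv_le (φ := φ) hφ W i
  refine MemLp.of_le_mul (c := C * ‖u‖) hR.memLp_one_add_norm_regressor
    (((measurable_outputDeriv hφ W i).comp hR.measurable_regressor).apply_continuousLinearMap
      u).aestronglyMeasurable (Eventually.of_forall fun ω => ?_)
  calc ‖outputDeriv φ A W (Z ω) i u‖ ≤ ‖outputDeriv φ A W (Z ω) i‖ * ‖u‖ :=
        ContinuousLinearMap.le_opNorm _ _
    _ ≤ C * (1 + ‖Z ω‖) * ‖u‖ := by gcongr; exact (hb (Z ω)).1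
    _ ≤ C * ‖u‖ * ‖1 + ‖Z ω‖‖ := by
      rw [Real.norm_of_nonneg (by positivity)]
      exact le_of_eq (by ring)

lemma integrable_outputDeriv_mul (hR : IsRegressionPair P Z ε) (hφ : IsSigmoidal φ)
    (W u v : EuclideanSpace ℝ A) (i j : Fin d) :
    Integrable (fun ω => outputDeriv φ A W (Z ω) i u * outputDeriv φ A W (Z ω) j v) P :=
  (hR.memLp_outputDeriv hφ W u i).integrable_mul (hR.memLp_outputDeriv hφ W v j)

lemma measurable_outputDeriv_apply (hφ : IsSigmoidal φ) (W u : EuclideanSpace ℝ A) (i : Fin d) :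
    Measurable fun z : EuclideanSpace ℝ (Fin p) => outputDeriv φ A W z i u :=
  (measurable_outputDeriv hφ W i).apply_continuousLinearMap u

lemma measurable_outputDeriv₂_apply (hφ : IsSigmoidal φ) (W u v : EuclideanSpace ℝ A)
    (i : Fin d) :
    Measurable fun z : EuclideanSpace ℝ (Fin p) => outputDeriv₂ φ A W z i u v :=
  ((measurable_outputDeriv₂ hφ W i).apply_continuousLinearMap u).apply_continuousLinearMap v

lemma integrable_outputDeriv₂ (hR : IsRegressionPair P Z ε) (hφ : IsSigmoidal φ)
    (W u v : EuclideanSpace ℝ A) (i : Fin d) :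
    Integrable (fun ω => outputDeriv₂ φ A W (Z ω) i u v) P := by
  obtain ⟨C, hC, hb⟩ := exists_norm_outputDeriv_le (φ := φ) hφ W i
  refine ((hR.memLp_one_add_norm_regressor.integrable_sq).const_mul (C * ‖u‖ * ‖v‖)).mono'
    ((measurable_outputDeriv₂_apply hφ W u v i).comp hR.measurable_regressor).aestronglyMeasurable
    (Eventually.of_forall fun ω => ?_)
  calc ‖outputDeriv₂ φ A W (Z ω) i u v‖ ≤ ‖outputDeriv₂ φ A W (Z ω) i‖ * ‖u‖ * ‖v‖ :=
        ContinuousLinearMap.le_opNorm₂ _ _ _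
    _ ≤ C * (1 + ‖Z ω‖) ^ 2 * ‖u‖ * ‖v‖ := by gcongr; exact (hb (Z ω)).2
    _ = C * ‖u‖ * ‖v‖ * (1 + ‖Z ω‖) ^ 2 := by ring

/-- The mean of the products of the components of the residual. -/
lemma integral_residualProd (hR : IsRegressionPair P Z ε) (hφ : IsSigmoidal φ)
    (W₀ W : EuclideanSpace ℝ A) (i j : Fin d) :
    (∫ ω, residualProd φ A W₀ (Z ω, ε ω) W ∂P) i j = secondMoment P ε i j +
      ∫ ω, (mlp φ A W₀ (Z ω) i - mlp φ A W (Z ω) i) *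
        (mlp φ A W₀ (Z ω) j - mlp φ A W (Z ω) j) ∂P := by
  have hD := isDominatedC3_residualProd hφ W₀ hR.measurable_regressor hR.measurable_noise
    hR.indepFun hR.integrable_noise_sq hR.integrable_regressor_cube
  choose C hC using fun i => exists_norm_mlp_sub_le (φ := φ) (p := p) hφ W₀ W i
  have hm : ∀ i, Measurable fun z : EuclideanSpace ℝ (Fin p) => mlp φ A W₀ z i - mlp φ A W z i :=
    fun i => (measurable_of_contDiff_param (f := fun z W => mlp φ A W z i) (contDiff_mlp hφ i)
      W₀).sub (measurable_of_contDiff_param (f := fun z W => mlp φ A W z i) (contDiff_mlp hφ i) W)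
  have hi : ∀ i, MemLp (fun ω => mlp φ A W₀ (Z ω) i - mlp φ A W (Z ω) i) 2 P := fun i =>
    MemLp.of_bound ((hm i).comp hR.measurable_regressor).aestronglyMeasurable (C i)
      (Eventually.of_forall fun ω => hC i (Z ω))
  have h₀ := (entryCLM i j).integral_comp_comm (hD.integrable hR.measurable_pair W)
  rw [entryCLM_apply] at h₀
  rw [← h₀]
  -- The cross terms are a noise coordinate times a function of the regressor, hence have mean zero.
  have h₁ : ∀ ω, entryCLM i j (residualProd φ A W₀ (Z ω, ε ω) W) = ε ω i * ε ω j +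
      (mlp φ A W₀ (Z ω) i - mlp φ A W (Z ω) i) * (mlp φ A W₀ (Z ω) j - mlp φ A W (Z ω) j) +
      (ε ω i * (mlp φ A W₀ (Z ω) j - mlp φ A W (Z ω) j) +
        ε ω j * (mlp φ A W₀ (Z ω) i - mlp φ A W (Z ω) i)) := by
    intro ω
    rw [entryCLM_apply]
    simp only [residualProd]
    ring
  simp_rw [h₁]
  have i₁ := hR.integrable_noise_mul_noise i j
  have i₂ := (hi i).integrable_mul (hi j)
  have i₃ := hR.integrable_noise_coord_mul (hm j) ((hi j).integrable one_le_two) i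
  have i₄ := hR.integrable_noise_coord_mul (hm i) ((hi i).integrable one_le_two) j
  have h₂ := integral_add_add_add i₁ i₂ i₃ i₄
  rw [hR.integral_noise_coord_mul (hm j), hR.integral_noise_coord_mul (hm i), add_zero,
    add_zero] at h₂
  exact h₂

lemma integral_residualProd_self (hR : IsRegressionPair P Z ε) (hφ : IsSigmoidal φ)
    (W₀ : EuclideanSpace ℝ A) :
    Matrix.of (∫ ω, residualProd φ A W₀ (Z ω, ε ω) W₀ ∂P) = secondMoment P ε := by
  ext i j
  rw [Matrix.of_apply, hR.integral_residualProd hφ]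
  simp

lemma integral_fderiv_residualProd (hR : IsRegressionPair P Z ε) (hφ : IsSigmoidal φ)
    (W₀ : EuclideanSpace ℝ A) :
    ∫ ω, fderiv ℝ (residualProd φ A W₀ (Z ω, ε ω)) W₀ ∂P = 0 := by
  have hD := isDominatedC3_residualProd hφ W₀ hR.measurable_regressor hR.measurable_noise
    hR.indepFun hR.integrable_noise_sq hR.integrable_regressor_cube
  ext u i j
  have h₀ := ((entryCLM i j).comp (ContinuousLinearMap.apply ℝ (Fin d → Fin d → ℝ)
    u)).integral_comp_comm (hD.integrable_fderiv hR.measurable_pair W₀)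
  have h₁ : ∀ ω, ((entryCLM i j).comp (ContinuousLinearMap.apply ℝ (Fin d → Fin d → ℝ) u))
      (fderiv ℝ (residualProd φ A W₀ (Z ω, ε ω)) W₀) =
      -(ε ω i * outputDeriv φ A W₀ (Z ω) j u + ε ω j * outputDeriv φ A W₀ (Z ω) i u) :=
    fun ω => fderiv_residualProd_apply hφ W₀ u (Z ω) (ε ω) i j
  simp_rw [h₁] at h₀
  have hJ := fun i => measurable_outputDeriv_apply (p := p) hφ W₀ u i
  have hi := fun i => (hR.memLp_outputDeriv hφ W₀ u i).integrable one_le_two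
  rw [integral_neg, integral_add (hR.integrable_noise_coord_mul (hJ j) (hi j) i)
    (hR.integrable_noise_coord_mul (hJ i) (hi i) j), hR.integral_noise_coord_mul (hJ j),
    hR.integral_noise_coord_mul (hJ i), add_zero, neg_zero] at h₀
  exact h₀.symm

lemma integral_fderiv_fderiv_residualProd (hR : IsRegressionPair P Z ε) (hφ : IsSigmoidal φ)
    (W₀ u v : EuclideanSpace ℝ A) (i j : Fin d) :
    (∫ ω, fderiv ℝ (fderiv ℝ (residualProd φ A W₀ (Z ω, ε ω))) W₀ ∂P) u v i j =
      (∫ ω, outputDeriv φ A W₀ (Z ω) i u * outputDeriv φ A W₀ (Z ω) j v ∂P) +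
        ∫ ω, outputDeriv φ A W₀ (Z ω) j u * outputDeriv φ A W₀ (Z ω) i v ∂P := by
  have hD := isDominatedC3_residualProd hφ W₀ hR.measurable_regressor hR.measurable_noise
    hR.indepFun hR.integrable_noise_sq hR.integrable_regressor_cube
  obtain ⟨hi₀, he⟩ := hD.integrable_and_integral_fderiv_fderiv_apply hR.measurable_pair W₀ u
  have h₀ := ((entryCLM i j).comp (ContinuousLinearMap.apply ℝ (Fin d → Fin d → ℝ)
    v)).integral_comp_comm hi₀
  have h₁ : ∀ ω, ((entryCLM i j).comp (ContinuousLinearMap.apply ℝ (Fin d → Fin d → ℝ) v))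
      (fderiv ℝ (fderiv ℝ (residualProd φ A W₀ (Z ω, ε ω))) W₀ u) =
      (outputDeriv φ A W₀ (Z ω) i u * outputDeriv φ A W₀ (Z ω) j v +
          outputDeriv φ A W₀ (Z ω) j u * outputDeriv φ A W₀ (Z ω) i v) -
        (ε ω i * outputDeriv₂ φ A W₀ (Z ω) j u v + ε ω j * outputDeriv₂ φ A W₀ (Z ω) i u v) :=
    fun ω => fderiv_fderiv_residualProd_apply hφ W₀ u v (Z ω) (ε ω) i j
  simp_rw [h₁] at h₀
  have hJ := fun i => measurable_outputDeriv₂_apply (p := p) hφ W₀ u v i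
  have hi := fun i => hR.integrable_outputDeriv₂ hφ W₀ u v i
  have i₁ := hR.integrable_outputDeriv_mul hφ W₀ u v i j
  have i₂ := hR.integrable_outputDeriv_mul hφ W₀ u v j i
  have i₃ := hR.integrable_noise_coord_mul (hJ j) (hi j) i
  have i₄ := hR.integrable_noise_coord_mul (hJ i) (hi i) j
  have h₂ := integral_add_sub_add i₁ i₂ i₃ i₄
  rw [hR.integral_noise_coord_mul (hJ j), hR.integral_noise_coord_mul (hJ i), add_zero,
    sub_zero] at h₂
  rw [he]
  exact h₀.symm.trans h₂

/-- The derivative of the residual products at the true parameter is square integrable. -/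
lemma memLp_fderiv_residualProd (hR : IsRegressionPair P Z ε) (hφ : IsSigmoidal φ)
    (W₀ : EuclideanSpace ℝ A) :
    MemLp (fun ω => fderiv ℝ (residualProd φ A W₀ (Z ω, ε ω)) W₀) 2 P := by
  have hD := isDominatedC3_residualProd hφ W₀ hR.measurable_regressor hR.measurable_noise
    hR.indepFun hR.integrable_noise_sq hR.integrable_regressor_cube
  choose C hC hb using fun i => exists_norm_outputDeriv_le (φ := φ) (p := p) hφ W₀ i
  set K := ∑ i, C i with hK
  have hCK : ∀ i, C i ≤ K := fun i => Finset.single_le_sum (fun j _ => hC j) (Finset.mem_univ i)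
  have hK0 : 0 ≤ K := Finset.sum_nonneg fun i _ => hC i
  have hm : Measurable fun ω => ‖ε ω‖ * (1 + ‖Z ω‖) :=
    hR.measurable_noise.norm.mul (hR.measurable_regressor.norm.const_add 1)
  -- Independence makes this square integrable without a fourth moment: its square has expectation
  -- `E‖ε‖² · E(1 + ‖Z‖)²`.
  have hdom : MemLp (fun ω => ‖ε ω‖ * (1 + ‖Z ω‖)) 2 P := by
    refine (memLp_two_iff_integrable_sq hm.aestronglyMeasurable).2 ?_
    simp only [mul_pow]
    exact hR.integrable_mul (u := fun e => ‖e‖ ^ 2) (g := fun z => (1 + ‖z‖) ^ 2) (by fun_prop)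
      (by fun_prop) hR.integrable_noise_sq hR.memLp_one_add_norm_regressor.integrable_sq
  refine MemLp.of_le_mul (c := 2 * K) hdom
    (hD.integrable_fderiv hR.measurable_pair W₀).aestronglyMeasurable
    (Eventually.of_forall fun ω => ?_)
  rw [Real.norm_of_nonneg (by positivity)]
  refine ContinuousLinearMap.opNorm_le_bound _ (by positivity) fun u => ?_
  refine (pi_norm_le_iff_of_nonneg (by positivity)).2 fun i =>
    (pi_norm_le_iff_of_nonneg (by positivity)).2 fun j => ?_
  rw [fderiv_residualProd_apply hφ, norm_neg]
  have hterm : ∀ i j, ‖ε ω i * outputDeriv φ A W₀ (Z ω) j u‖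
      ≤ ‖ε ω‖ * (K * (1 + ‖Z ω‖) * ‖u‖) := by
    intro i j
    rw [norm_mul]
    gcongr
    · exact PiLp.norm_apply_le _ i
    · calc _ ≤ ‖outputDeriv φ A W₀ (Z ω) j‖ * ‖u‖ := ContinuousLinearMap.le_opNorm _ _
        _ ≤ K * (1 + ‖Z ω‖) * ‖u‖ := by
          gcongr
          exact ((hb j (Z ω)).1).trans (by gcongr; exact hCK j)
  calc _ ≤ _ := norm_add_le _ _
    _ ≤ _ := add_le_add (hterm i j) (hterm j i)
    _ = _ := by ring

end IsRegressionPair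

end Moments

/-! ### Strict monotonicity of the determinant on positive definite matrices. -/

section Determinant

variable {n : Type*} [Fintype n] [DecidableEq n]

omit [Fintype n] [DecidableEq n] in
lemma one_add_sum_le_prod_one_add (s : Finset n) {f : n → ℝ} (hf : ∀ i, 0 ≤ f i) :
    1 + ∑ i ∈ s, f i ≤ ∏ i ∈ s, (1 + f i) := by
  classical
  induction s using Finset.induction_on with
  | empty => simp
  | insert a s ha ih =>
    rw [Finset.sum_insert ha, Finset.prod_insert ha]
    nlinarith [hf a, Finset.sum_nonneg fun i (_ : i ∈ s) => hf i,
      mul_le_mul_of_nonneg_left ih (hf a)]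

/-- With eigenvalues `λ_i ≥ 0`, the determinant is `∏ (1 + λ_i) ≥ 1 + ∑ λ_i`. -/
lemma one_add_trace_le_det_one_add {S : Matrix n n ℝ} (hS : S.PosSemidef) :
    1 + S.trace ≤ (1 + S).det := by
  have h₁ : (1 + S).det = ∏ i, (1 + hS.1.eigenvalues i) := by
    -- The product formula is the characteristic polynomial of `S` at `-1`, up to the sign `(-1) ^
    -- card n`.
    have h := Matrix.eval_charpoly S (-1)
    rw [hS.1.charpoly_eq, Polynomial.eval_prod] at h
    have h₂ : Matrix.scalar n (-1 : ℝ) - S = -(1 + S) := by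
      rw [map_neg, map_one, neg_add, sub_eq_add_neg]
    rw [h₂, Matrix.det_neg] at h
    have h₃ : ∀ i, Polynomial.eval (-1 : ℝ) (Polynomial.X - Polynomial.C
        ((hS.1.eigenvalues i : ℝ))) = (-1) * (1 + hS.1.eigenvalues i) := by
      intro i
      simp
      ring
    have h₄ : ∏ i, ((-1 : ℝ) * (1 + hS.1.eigenvalues i)) = (-1) ^ Fintype.card n * (1 + S).det := by
      rw [← h]
      exact Finset.prod_congr rfl fun i _ => (h₃ i).symm
    rw [Finset.prod_mul_distrib, Finset.prod_const, Finset.card_univ] at h₄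
    exact (mul_left_cancel₀ (pow_ne_zero _ (by norm_num)) h₄).symm
  have h₂ : S.trace = ∑ i, hS.1.eigenvalues i := by simpa using hS.1.trace_eq_sum_eigenvalues
  rw [h₁, h₂]
  exact one_add_sum_le_prod_one_add _ hS.eigenvalues_nonneg

open scoped MatrixOrder in
lemma exists_sqrt_of_posDef {M : Matrix n n ℝ} (hM : M.PosDef) :
    ∃ R : Matrix n n ℝ, R.conjTranspose = R ∧ R * R = M ∧ IsUnit R.det := by
  have h₁ : CFC.sqrt M * CFC.sqrt M = M := CFC.sqrt_mul_sqrt_self M hM.posSemidef.nonneg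
  refine ⟨CFC.sqrt M, ?_, h₁, ?_⟩
  · exact (Matrix.nonneg_iff_posSemidef.1 (CFC.sqrt_nonneg M)).isHermitian
  · rw [isUnit_iff_ne_zero]
    intro h
    have h₂ := hM.det_pos
    rw [← h₁, Matrix.det_mul, h, zero_mul] at h₂
    exact lt_irrefl _ h₂

/-- The determinant is strictly increasing at a positive definite matrix. -/
lemma det_lt_det_add {M S : Matrix n n ℝ} (hM : M.PosDef) (hS : S.PosSemidef) (h0 : S ≠ 0) :
    M.det < (M + S).det := by
  obtain ⟨R, hR, hRM, hRu⟩ := exists_sqrt_of_posDef hM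
  -- Factoring out the square root, `M + S = R (1 + T) R`; the gain `det (1 + T) > 1` comes from `tr
  -- T > 0`.
  set T := R⁻¹ * S * R⁻¹ with hT
  have hRi : R⁻¹.conjTranspose = R⁻¹ := by rw [Matrix.conjTranspose_nonsing_inv, hR]
  have hTS : R * T * R = S := by
    rw [hT]
    calc R * (R⁻¹ * S * R⁻¹) * R = (R * R⁻¹) * S * (R⁻¹ * R) := by simp only [mul_assoc]
      _ = S := by rw [Matrix.mul_nonsing_inv _ hRu, Matrix.nonsing_inv_mul _ hRu, one_mul, mul_one]
  have hTp : T.PosSemidef := by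
    have h := hS.mul_mul_conjTranspose_same R⁻¹
    rwa [hRi] at h
  have hT0 : T ≠ 0 := by
    intro h
    rw [h, mul_zero, zero_mul] at hTS
    exact h0 hTS.symm
  have htr : 0 < T.trace :=
    lt_of_le_of_ne hTp.trace_nonneg fun h => hT0 (hTp.trace_eq_zero_iff.1 h.symm)
  have hsum : M + S = R * (1 + T) * R := by rw [mul_add, add_mul, mul_one, hRM, hTS]
  have hdet : (M + S).det = M.det * (1 + T).det := by
    rw [hsum, Matrix.det_mul, Matrix.det_mul, ← hRM, Matrix.det_mul]
    ring
  rw [hdet]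
  exact lt_mul_of_one_lt_right hM.det_pos
    ((lt_add_of_pos_right 1 htr).trans_le (one_add_trace_le_det_one_add hTp))

end Determinant

/-! ### Consistency of the minimizer modulo the group. -/

section Consistency

variable {E : Type*} [NormedAddCommGroup E]

/-- Positivity at a point extends to a neighbourhood for all large `n`, and compactness gives one
threshold for the whole set. From then on the estimator is known to be a minimizer. -/
lemma eventually_forall_pos_of_isCompact {γ : ℕ → E → ℝ} {γ₀ : E → ℝ} {Θ : Set E}
    (hΘ : IsCompact Θ)
    (hγ : ∀ W, Tendsto (fun q : ℕ × E => γ q.1 q.2) (atTop ×ˢ 𝓝 W) (𝓝 (γ₀ W)))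
    (hpos : ∀ W, 0 < γ₀ W) : ∀ᶠ n in atTop, ∀ W ∈ Θ, 0 < γ n W := by
  refine hΘ.induction_on (p := fun s => ∀ᶠ n in atTop, ∀ W ∈ s, 0 < γ n W) (by simp)
    (fun s t hst ht => ht.mono fun n hn W hW => hn W (hst hW))
    (fun s t hs ht => ?_) fun W _ => ?_
  · filter_upwards [hs, ht] with n h₁ h₂ W hW
    exact hW.elim (h₁ W) (h₂ W)
  · obtain ⟨pa, hpa, pb, hpb, hab⟩ :=
      Filter.eventually_prod_iff.1 ((hγ W).eventually (lt_mem_nhds (hpos W)))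
    exact ⟨{W' | pb W'}, mem_nhdsWithin_of_mem_nhds hpb, hpa.mono fun n hn W' hW' => hab hn hW'⟩

/-- Consistency of a minimum contrast estimator, for a parameter which is identifiable up to a
group of homeomorphisms. -/
theorem tendsto_of_isMinOn_log [NormedSpace ℝ E] {γ : ℕ → E → ℝ} {γ₀ : E → ℝ}
    {Θ : Set E} (hΘ : IsCompact Θ)
    (hγ : ∀ W, Tendsto (fun q : ℕ × E => γ q.1 q.2) (atTop ×ˢ 𝓝 W) (𝓝 (γ₀ W)))
    (hpos : ∀ W, 0 < γ₀ W) {W₀ : E} (hW₀ : W₀ ∈ interior Θ) {G : Subgroup (E ≃ₜ E)}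
    (hident : ∀ W ∈ Θ, γ₀ W ≤ γ₀ W₀ → ∃ g ∈ G, W = g W₀) {What : ℕ → E} (hmem : ∀ n, What n ∈ Θ)
    (hmin : ∀ n, (∀ W ∈ Θ, γ n W ≠ 0) → IsMinOn (fun W => Real.log (γ n W)) Θ (What n))
    (hrep : ∀ n, ∀ g ∈ G, g (What n) ∈ Θ → ‖What n - W₀‖ ≤ ‖g (What n) - W₀‖) :
    Tendsto What atTop (𝓝 W₀) ∧
      ∀ᶠ n in atTop, fderiv ℝ (fun W => Real.log (γ n W)) (What n) = 0 := by
  have hΘpos := eventually_forall_pos_of_isCompact hΘ hγ hpos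
  have hW₀Θ := interior_subset hW₀
  have hlim : Tendsto What atTop (𝓝 W₀) := by
    -- Along an ultrafilter the estimator converges in the compact set, to a limit `W` which is then
    -- shown to lie in the orbit of `W₀`; this replaces extraction of subsequences.
    refine tendsto_iff_ultrafilter _ _ _ |>.2 fun 𝓊 h𝓊 => ?_
    obtain ⟨W, hWΘ, hW⟩ := hΘ.ultrafilter_le_nhds (𝓊.map What)
      (le_principal_iff.2 (Filter.mem_map.2 (Filter.mem_of_superset univ_mem fun n _ => hmem n)))
    have hW' : Tendsto What 𝓊 (𝓝 W) := hW
    have t₁ : Tendsto (fun n => γ n (What n)) 𝓊 (𝓝 (γ₀ W)) :=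
      (hγ W).comp ((show Tendsto id (𝓊 : Filter ℕ) atTop from h𝓊).prodMk hW')
    have t₂ : Tendsto (fun n => γ n W₀) 𝓊 (𝓝 (γ₀ W₀)) :=
      (hγ W₀).comp ((show Tendsto id (𝓊 : Filter ℕ) atTop from h𝓊).prodMk tendsto_const_nhds)
    have hle : γ₀ W ≤ γ₀ W₀ := by
      refine le_of_tendsto_of_tendsto t₁ t₂ ?_
      filter_upwards [h𝓊 hΘpos] with n hn
      have h := hmin n (fun V hV => (hn V hV).ne') hW₀Θ
      exact (Real.log_le_log_iff (hn _ (hmem n)) (hn _ hW₀Θ)).1 h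
    obtain ⟨g, hg, rfl⟩ := hident W hWΘ hle
    -- The translate `g⁻¹ (What n)` tends to `W₀`, an interior point, so it lies in `Θ` for most
    -- `n`. The estimator, being the closest representative, is at least as near to `W₀`.
    have t₃ : Tendsto (fun n => (g⁻¹ : E ≃ₜ E) (What n)) 𝓊 (𝓝 W₀) := by
      have h := ((g⁻¹ : E ≃ₜ E).continuous.tendsto (g W₀)).comp hW'
      have h' : (g⁻¹ : E ≃ₜ E) (g W₀) = W₀ := g.symm_apply_apply W₀
      rw [h'] at h
      exact h
    refine tendsto_iff_norm_sub_tendsto_zero.2 (squeeze_zero'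
      (Eventually.of_forall fun n => norm_nonneg _) ?_ (tendsto_iff_norm_sub_tendsto_zero.1 t₃))
    filter_upwards [t₃.eventually (mem_interior_iff_mem_nhds.1 hW₀)] with n hn
    exact hrep n g⁻¹ (G.inv_mem hg) hn
  refine ⟨hlim, ?_⟩
  filter_upwards [hΘpos, hlim.eventually (isOpen_interior.mem_nhds hW₀)] with n hn hn'
  exact ((hmin n fun V hV => (hn V hV).ne').isLocalMin
    (mem_interior_iff_mem_nhds.1 hn')).fderiv_eq_zero

end Consistency

/-! ### The information matrix as limit Hessian and as score covariance. -/

section Information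

set_option linter.unusedSectionVars false

variable {d p h : ℕ} {φ : ℝ → ℝ} {A : Finset (WeightIndex d p h)}
  {Ω : Type*} [MeasurableSpace Ω] {P : Measure Ω} [IsProbabilityMeasure P]
  {Z : Ω → EuclideanSpace ℝ (Fin p)} {ε : Ω → EuclideanSpace ℝ (Fin d)}

lemma toDual_symm_coord {ι : Type*} [Fintype ι] [DecidableEq ι] (l : EuclideanSpace ℝ ι →L[ℝ] ℝ)
    (k : ι) : ((InnerProductSpace.toDual ℝ (EuclideanSpace ℝ ι)).symm l) k =
      l (EuclideanSpace.single k 1) := by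
  have h := InnerProductSpace.toDual_symm_apply (𝕜 := ℝ) (x := EuclideanSpace.single k (1 : ℝ))
    (y := l)
  rw [EuclideanSpace.inner_single_right] at h
  simpa using h

namespace IsRegressionPair

lemma posSemidef_secondMoment (hR : IsRegressionPair P Z ε) : (secondMoment P ε).PosSemidef :=
  posSemidef_momentMatrix hR.memLp_noise

lemma meanB_eq (hφ : IsSigmoidal φ) (W₀ : EuclideanSpace ℝ A) (k l : A) (i j : Fin d) :
    meanB P (mlp φ A) Z W₀ k l i j =
      ∫ ω, outputDeriv φ A W₀ (Z ω) i (EuclideanSpace.single k 1) *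
        outputDeriv φ A W₀ (Z ω) j (EuclideanSpace.single l 1) ∂P := by
  simp only [meanB, Matrix.of_apply, partialDeriv_mlp hφ]

lemma infoMatrix_apply (W₀ : EuclideanSpace ℝ A) (Γ : Matrix (Fin d) (Fin d) ℝ) (k l : A) :
    infoMatrix P (mlp φ A) Z Γ W₀ k l =
      ∑ b, ∑ b', Γ⁻¹ b b' * meanB P (mlp φ A) Z W₀ k l b' b := by
  simp [infoMatrix, Matrix.trace, Matrix.mul_apply]

variable {Γ : Matrix (Fin d) (Fin d) ℝ}

/-- The score of an observation. -/
lemma fderiv_log_det_comp_apply (hφ : IsSigmoidal φ) (W₀ : EuclideanSpace ℝ A)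
    (hΓ : Γ.det ≠ 0) (hsymm : ∀ a b, Γ⁻¹ a b = Γ⁻¹ b a) (z : EuclideanSpace ℝ (Fin p))
    (e : EuclideanSpace ℝ (Fin d)) (u : EuclideanSpace ℝ A) :
    fderiv ℝ (fun M : Fin d → Fin d → ℝ => Real.log (Matrix.of M).det) (fun i j => Γ i j)
        (fderiv ℝ (residualProd φ A W₀ (z, e)) W₀ u) =
      -2 * ∑ b, (∑ a, Γ⁻¹ a b * e a) * outputDeriv φ A W₀ z b u := by
  have hΓ' : (Matrix.of fun i j => Γ i j) = Γ := rfl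
  rw [fderiv_log_det_apply (by rwa [hΓ']), hΓ']
  simp only [Matrix.trace, Matrix.diag_apply, Matrix.mul_apply, Matrix.of_apply,
    fderiv_residualProd_apply hφ]
  have h₁ : ∑ a, ∑ b, Γ⁻¹ a b * (e a * outputDeriv φ A W₀ z b u) =
      ∑ b, (∑ a, Γ⁻¹ a b * e a) * outputDeriv φ A W₀ z b u := by
    rw [Finset.sum_comm]
    refine Finset.sum_congr rfl fun b _ => ?_
    rw [Finset.sum_mul]
    exact Finset.sum_congr rfl fun a _ => by ring
  have h₂ : ∑ a, ∑ b, Γ⁻¹ a b * (e b * outputDeriv φ A W₀ z a u) =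
      ∑ b, (∑ a, Γ⁻¹ a b * e a) * outputDeriv φ A W₀ z b u := by
    refine Finset.sum_congr rfl fun b _ => ?_
    rw [Finset.sum_mul]
    refine Finset.sum_congr rfl fun a _ => ?_
    rw [hsymm b a]
    ring
  calc _ = -(∑ a, ∑ b, Γ⁻¹ a b * (e a * outputDeriv φ A W₀ z b u)) -
        ∑ a, ∑ b, Γ⁻¹ a b * (e b * outputDeriv φ A W₀ z a u) := by
        rw [← Finset.sum_neg_distrib, ← Finset.sum_sub_distrib]
        refine Finset.sum_congr rfl fun a _ => ?_
        rw [← Finset.sum_neg_distrib, ← Finset.sum_sub_distrib]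
        exact Finset.sum_congr rfl fun b _ => by ring
    _ = _ := by rw [h₁, h₂]; ring

/-- These are the coordinates of `Γ⁻¹ ε`, whose covariance is `Γ⁻¹ Γ Γ⁻¹ = Γ⁻¹`. -/
lemma integral_whitened_noise (hR : IsRegressionPair P Z ε) (hΓ : (secondMoment P ε).det ≠ 0)
    (b b' : Fin d) :
    Integrable (fun ω => (∑ a, (secondMoment P ε)⁻¹ a b * ε ω a) *
        ∑ a, (secondMoment P ε)⁻¹ a b' * ε ω a) P ∧
      ∫ ω, (∑ a, (secondMoment P ε)⁻¹ a b * ε ω a) *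
        (∑ a, (secondMoment P ε)⁻¹ a b' * ε ω a) ∂P = (secondMoment P ε)⁻¹ b b' := by
  set Γ := secondMoment P ε with hΓdef
  have hsymm : Γ⁻¹.transpose = Γ⁻¹ := by
    have h := hR.posSemidef_secondMoment.isHermitian.inv
    exact h
  have hint : ∀ a a', Integrable (fun ω => Γ⁻¹ a b * Γ⁻¹ a' b' * (ε ω a * ε ω a')) P :=
    fun a a' => (hR.integrable_noise_mul_noise a a').const_mul _
  have hexp : ∀ ω, (∑ a, Γ⁻¹ a b * ε ω a) * (∑ a, Γ⁻¹ a b' * ε ω a) =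
      ∑ a, ∑ a', Γ⁻¹ a b * Γ⁻¹ a' b' * (ε ω a * ε ω a') := by
    intro ω
    rw [Finset.sum_mul_sum]
    exact Finset.sum_congr rfl fun a _ => Finset.sum_congr rfl fun a' _ => by ring
  simp_rw [hexp]
  refine ⟨integrable_finsetSum _ fun a _ => integrable_finsetSum _ fun a' _ => hint a a', ?_⟩
  rw [integral_finsetSum _ fun a _ => integrable_finsetSum _ fun a' _ => hint a a']
  simp_rw [integral_finsetSum _ fun a' _ => hint _ a', integral_const_mul]
  have hmul : Γ⁻¹.transpose * Γ * Γ⁻¹ = Γ⁻¹ := by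
    rw [mul_assoc, Matrix.mul_nonsing_inv _ (isUnit_iff_ne_zero.2 hΓ), mul_one, hsymm]
  have h := congrFun (congrFun hmul b) b'
  rw [← h, Matrix.mul_apply]
  simp only [Matrix.mul_apply, Matrix.transpose_apply, Finset.sum_mul]
  rw [Finset.sum_comm]
  refine Finset.sum_congr rfl fun a' _ => Finset.sum_congr rfl fun a _ => ?_
  have h' : ∫ ω, ε ω a * ε ω a' ∂P = Γ a a' := rfl
  rw [h']
  ring

/-- The covariance matrix of the score. -/
lemma momentMatrix_score (hR : IsRegressionPair P Z ε) (hφ : IsSigmoidal φ)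
    (W₀ : EuclideanSpace ℝ A) (hΓ : (secondMoment P ε).det ≠ 0) :
    (momentMatrix P fun ω => (InnerProductSpace.toDual ℝ _).symm
      ((fderiv ℝ (fun M : Fin d → Fin d → ℝ => Real.log (Matrix.of M).det)
        (fun i j => secondMoment P ε i j)).comp
          (fderiv ℝ (residualProd φ A W₀ (Z ω, ε ω)) W₀))) =
      (4 : ℝ) • infoMatrix P (mlp φ A) Z (secondMoment P ε) W₀ := by
  set Γ := secondMoment P ε with hΓdef
  have hsymm : ∀ a b, Γ⁻¹ a b = Γ⁻¹ b a := fun a b =>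
    (hR.posSemidef_secondMoment.isHermitian.inv.apply a b).symm
  have hcoord : ∀ ω k, ((InnerProductSpace.toDual ℝ (EuclideanSpace ℝ A)).symm
      ((fderiv ℝ (fun M : Fin d → Fin d → ℝ => Real.log (Matrix.of M).det)
        (fun i j => Γ i j)).comp (fderiv ℝ (residualProd φ A W₀ (Z ω, ε ω)) W₀))) k =
      -2 * ∑ b, (∑ a, Γ⁻¹ a b * ε ω a) *
        outputDeriv φ A W₀ (Z ω) b (EuclideanSpace.single k 1) := by
    intro ω k
    rw [← fderiv_log_det_comp_apply hφ W₀ hΓ hsymm]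
    exact toDual_symm_coord _ k
  ext k l
  simp only [momentMatrix, Matrix.of_apply, hcoord]
  have hexp : ∀ ω, (-2 * ∑ b, (∑ a, Γ⁻¹ a b * ε ω a) *
        outputDeriv φ A W₀ (Z ω) b (EuclideanSpace.single k 1)) *
      (-2 * ∑ b, (∑ a, Γ⁻¹ a b * ε ω a) *
        outputDeriv φ A W₀ (Z ω) b (EuclideanSpace.single l 1)) =
      4 * ∑ b, ∑ b', ((∑ a, Γ⁻¹ a b * ε ω a) * ∑ a, Γ⁻¹ a b' * ε ω a) *
        (outputDeriv φ A W₀ (Z ω) b (EuclideanSpace.single k 1) *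
          outputDeriv φ A W₀ (Z ω) b' (EuclideanSpace.single l 1)) := by
    intro ω
    rw [mul_mul_mul_comm, Finset.sum_mul_sum]
    congr 1
    · norm_num
    · exact Finset.sum_congr rfl fun b _ => Finset.sum_congr rfl fun b' _ => by ring
  simp_rw [hexp]
  have hum : ∀ b b', Measurable fun e : EuclideanSpace ℝ (Fin d) =>
      (∑ a, Γ⁻¹ a b * e a) * ∑ a, Γ⁻¹ a b' * e a := fun b b' => by fun_prop
  have hgm : ∀ b b', Measurable fun z : EuclideanSpace ℝ (Fin p) =>
      outputDeriv φ A W₀ z b (EuclideanSpace.single k 1) *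
        outputDeriv φ A W₀ z b' (EuclideanSpace.single l 1) := fun b b' =>
    (measurable_outputDeriv_apply hφ W₀ _ b).mul (measurable_outputDeriv_apply hφ W₀ _ b')
  have hint : ∀ b b', Integrable (fun ω => ((∑ a, Γ⁻¹ a b * ε ω a) * ∑ a, Γ⁻¹ a b' * ε ω a) *
        (outputDeriv φ A W₀ (Z ω) b (EuclideanSpace.single k 1) *
          outputDeriv φ A W₀ (Z ω) b' (EuclideanSpace.single l 1))) P := fun b b' =>
    hR.integrable_mul (hum b b') (hgm b b') (hR.integral_whitened_noise hΓ b b').1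
      (hR.integrable_outputDeriv_mul hφ W₀ _ _ b b')
  -- Independence separates the covariance of `Γ⁻¹ ε` from the mean product of output derivatives.
  have hval : ∀ b b', ∫ ω, ((∑ a, Γ⁻¹ a b * ε ω a) * ∑ a, Γ⁻¹ a b' * ε ω a) *
        (outputDeriv φ A W₀ (Z ω) b (EuclideanSpace.single k 1) *
          outputDeriv φ A W₀ (Z ω) b' (EuclideanSpace.single l 1)) ∂P =
      Γ⁻¹ b b' * meanB P (mlp φ A) Z W₀ k l b b' := by
    intro b b'
    have h := hR.integral_mul (hum b b') (hgm b b')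
    rw [(hR.integral_whitened_noise hΓ b b').2] at h
    rw [meanB_eq hφ]
    exact h
  rw [integral_const_mul, integral_finsetSum _ fun b _ => integrable_finsetSum _ fun b' _ =>
    hint b b']
  simp_rw [integral_finsetSum _ fun b' _ => hint _ b', hval]
  rw [Matrix.smul_apply, infoMatrix_apply, smul_eq_mul, Finset.sum_comm]
  congr 1
  exact Finset.sum_congr rfl fun b _ => Finset.sum_congr rfl fun b' _ => by rw [hsymm]

/-- Four times this matrix is the second moment matrix of the square integrable score. -/
lemma posSemidef_infoMatrix (hR : IsRegressionPair P Z ε) (hφ : IsSigmoidal φ)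
    (W₀ : EuclideanSpace ℝ A) (hΓ : (secondMoment P ε).det ≠ 0) :
    (infoMatrix P (mlp φ A) Z (secondMoment P ε) W₀).PosSemidef := by
  have hmem : MemLp (fun ω => (InnerProductSpace.toDual ℝ (EuclideanSpace ℝ A)).symm
      ((fderiv ℝ (fun M : Fin d → Fin d → ℝ => Real.log (Matrix.of M).det)
        (fun i j => secondMoment P ε i j)).comp
          (fderiv ℝ (residualProd φ A W₀ (Z ω, ε ω)) W₀))) 2 P := by
    have h := ((vectorOfDual A).comp (ContinuousLinearMap.compL ℝ (EuclideanSpace ℝ A) _ ℝ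
      (fderiv ℝ (fun M : Fin d → Fin d → ℝ => Real.log (Matrix.of M).det)
        (fun i j => secondMoment P ε i j)))).comp_memLp' (hR.memLp_fderiv_residualProd hφ W₀)
    exact h
  have h := posSemidef_momentMatrix hmem
  rw [hR.momentMatrix_score hφ W₀ hΓ] at h
  have h' := h.smul (show (0 : ℝ) ≤ 1 / 4 by norm_num)
  rwa [smul_smul, show (1 / 4 : ℝ) * 4 = 1 by norm_num, one_smul] at h'

/-- The limit of the Hessian of the cost function. -/
lemma fderiv_log_det_integral (hR : IsRegressionPair P Z ε) (hφ : IsSigmoidal φ)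
    (W₀ : EuclideanSpace ℝ A) (hΓ : (secondMoment P ε).det ≠ 0) (k l : A) :
    fderiv ℝ (fun M : Fin d → Fin d → ℝ => Real.log (Matrix.of M).det)
        (fun i j => secondMoment P ε i j)
        ((∫ ω, fderiv ℝ (fderiv ℝ (residualProd φ A W₀ (Z ω, ε ω))) W₀ ∂P)
          (EuclideanSpace.single k 1) (EuclideanSpace.single l 1)) =
      2 * infoMatrix P (mlp φ A) Z (secondMoment P ε) W₀ k l := by
  set Γ := secondMoment P ε with hΓdef
  have hsymm : ∀ a b, Γ⁻¹ a b = Γ⁻¹ b a := fun a b =>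
    (hR.posSemidef_secondMoment.isHermitian.inv.apply a b).symm
  have hΓ' : (Matrix.of fun i j => Γ i j) = Γ := rfl
  rw [fderiv_log_det_apply (by rwa [hΓ']), hΓ', infoMatrix_apply]
  simp only [Matrix.trace, Matrix.diag_apply, Matrix.mul_apply, Matrix.of_apply,
    hR.integral_fderiv_fderiv_residualProd hφ, ← meanB_eq hφ, mul_add, Finset.sum_add_distrib]
  rw [two_mul]
  congr 1
  rw [Finset.sum_comm]
  exact Finset.sum_congr rfl fun b _ => Finset.sum_congr rfl fun b' _ => by rw [hsymm]

end IsRegressionPair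

end Information

/-! ### Measurability of the gradient, and passage between matrices and bilinear forms. -/

section Auxiliary

set_option linter.unusedSectionVars false

variable {ι : Type*} [Fintype ι] [DecidableEq ι] {Ω : Type*} [MeasurableSpace Ω]
  {V : Type*} [NormedAddCommGroup V] [NormedSpace ℝ V] [FiniteDimensional ℝ V]
  [MeasurableSpace V] [BorelSpace V]

/-- The formula for the gradient of a logarithm holds even where `D` vanishes, so measurability
holds on the whole probability space, including where the empirical covariance is singular. -/
lemma measurable_gradient_log_comp {D : V → ℝ} (hD : ContDiff ℝ 1 D)
    {G : Ω → EuclideanSpace ℝ ι → V} (hG : ∀ ω, Differentiable ℝ (G ω)) {W₀ : EuclideanSpace ℝ ι}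
    (hm : Measurable fun ω => G ω W₀) (hm' : Measurable fun ω => fderiv ℝ (G ω) W₀) :
    Measurable fun ω => gradient (fun W => Real.log (D (G ω W))) W₀ := by
  have h₁ : ∀ ω, gradient (fun W => Real.log (D (G ω W))) W₀ =
      (D (G ω W₀))⁻¹ • vectorOfDual ι ((fderiv ℝ D (G ω W₀)).comp (fderiv ℝ (G ω) W₀)) := by
    intro ω
    have hd := hD.differentiable (by simp) (G ω W₀)
    rw [gradient_log (g := fun W => D (G ω W)) (hd.comp W₀ (hG ω W₀)), vectorOfDual_apply, gradient]
    congr 2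
    exact fderiv_comp W₀ hd (hG ω W₀)
  simp_rw [h₁]
  have hc : Continuous fun q : V × (EuclideanSpace ℝ ι →L[ℝ] V) =>
      vectorOfDual ι ((fderiv ℝ D q.1).comp q.2) := by
    have hc₁ : Continuous fun q : V × (EuclideanSpace ℝ ι →L[ℝ] V) => fderiv ℝ D q.1 :=
      (hD.continuous_fderiv (by simp)).comp continuous_fst
    exact (vectorOfDual ι).continuous.comp (hc₁.clm_comp continuous_snd)
  have hm₂ := hc.measurable.comp (hm.prodMk hm')
  exact ((hD.continuous.measurable.comp hm).inv).smul hm₂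

lemma IsDominatedC3.measurable_gradient_log {S : Type*} [MeasurableSpace S] {P : Measure Ω}
    {X₀ : Ω → S} {f : S → EuclideanSpace ℝ ι → V} (hf : IsDominatedC3 P X₀ f) {X : ℕ → Ω → S}
    (hX : ∀ t, Measurable (X t)) {D : V → ℝ} (hD : ContDiff ℝ 1 D) (n : ℕ)
    (W₀ : EuclideanSpace ℝ ι) :
    Measurable fun ω =>
      gradient (fun W => Real.log (D (sampleMean f (fun t => X t ω) n W))) W₀ := by
  refine measurable_gradient_log_comp hD
    (fun ω => (contDiff_sampleMean hf.contDiff _ n).differentiable (by simp)) ?_ ?_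
  · exact (measurable_const_smul ((n : ℝ)⁻¹)).comp
      (Finset.measurable_sum _ fun t _ => (hf.measurable W₀).comp (hX t))
  · simp_rw [fderiv_sampleMean fun x => (hf.contDiff x).differentiable (by simp)]
    exact (measurable_const_smul ((n : ℝ)⁻¹)).comp
      (Finset.measurable_sum _ fun t _ => (hf.measurable_fderiv W₀).comp (hX t))

/-- Symmetry is needed because the operator representing `B` in its first argument is the transpose
of the matrix of coefficients. -/
lemma eq_inner_toEuclideanCLM {B : EuclideanSpace ℝ ι →L[ℝ] EuclideanSpace ℝ ι →L[ℝ] ℝ}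
    {H : Matrix ι ι ℝ} (hH : H.transpose = H)
    (hB : ∀ k l, B (EuclideanSpace.single k 1) (EuclideanSpace.single l 1) = H k l)
    (u v : EuclideanSpace ℝ ι) : B u v = inner ℝ (Matrix.toEuclideanCLM (𝕜 := ℝ) H u) v := by
  have hsum : ∀ u : EuclideanSpace ℝ ι, u = ∑ k, u k • EuclideanSpace.single k (1 : ℝ) := by
    intro u
    have h := (EuclideanSpace.basisFun ι ℝ).sum_repr u
    simpa using h.symm
  have h₁ : B u v = ∑ k, ∑ l, u k * (v l * H k l) := by
    conv_lhs => rw [hsum u, hsum v]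
    simp only [map_sum, map_smul, sum_apply, smul_apply, hB, smul_eq_mul, Finset.mul_sum]
    rw [Finset.sum_comm]
    exact Finset.sum_congr rfl fun k _ => Finset.sum_congr rfl fun l _ => by ring
  rw [h₁, PiLp.inner_apply, Finset.sum_comm]
  refine Finset.sum_congr rfl fun l _ => ?_
  rw [Matrix.ofLp_toEuclideanCLM]
  simp only [Matrix.mulVec, dotProduct, RCLike.inner_apply, conj_trivial, Finset.mul_sum]
  refine Finset.sum_congr rfl fun k _ => ?_
  rw [← congrFun (congrFun hH k) l, Matrix.transpose_apply]
  ring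

lemma hessianMatrix_apply {f : EuclideanSpace ℝ ι → ℝ} {W₀ : EuclideanSpace ℝ ι}
    (hf : ContDiffAt ℝ 2 f W₀) (k l : ι) :
    hessianMatrix f W₀ k l =
      fderiv ℝ (fderiv ℝ f) W₀ (EuclideanSpace.single l 1) (EuclideanSpace.single k 1) := by
  have h₁ : ContDiffAt ℝ 1 (fderiv ℝ f) W₀ := hf.fderiv_right (by norm_num)
  have h₂ := ((h₁.differentiableAt (by simp)).hasFDerivAt.clm_apply
    (hasFDerivAt_const (EuclideanSpace.single k (1 : ℝ)) W₀)).fderiv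
  have h₃ : hessianMatrix f W₀ k l = fderiv ℝ (fun W => fderiv ℝ f W (EuclideanSpace.single k 1)) W₀
    (EuclideanSpace.single l 1) := rfl
  rw [h₃, h₂]
  simp

end Auxiliary

/-! ### The limit theorems for the cost function, in terms of regressors and noises. -/

section Cost

variable {d p h : ℕ}

/-- The cost function as a function of the regressors and the noises. -/
def noiseCost (φ : ℝ → ℝ) (A : Finset (WeightIndex d p h)) (W₀ : EuclideanSpace ℝ A)
    (x : ℕ → EuclideanSpace ℝ (Fin p) × EuclideanSpace ℝ (Fin d)) (n : ℕ)
    (W : EuclideanSpace ℝ A) : ℝ :=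
  Real.log (Matrix.of (sampleMean (residualProd φ A W₀) x n W)).det

variable {φ : ℝ → ℝ} {A : Finset (WeightIndex d p h)}
  {Ω : Type*} [MeasurableSpace Ω] {P : Measure Ω} [IsProbabilityMeasure P]
  {Z : ℕ → Ω → EuclideanSpace ℝ (Fin p)} {ε : ℕ → Ω → EuclideanSpace ℝ (Fin d)}

namespace IsRegressionPair

lemma isDominatedC3 (hR : IsRegressionPair P (Z 0) (ε 0)) (hφ : IsSigmoidal φ)
    (W₀ : EuclideanSpace ℝ A) :
    IsDominatedC3 P (fun ω => (Z 0 ω, ε 0 ω)) (residualProd φ A W₀) :=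
  isDominatedC3_residualProd hφ W₀ hR.measurable_regressor hR.measurable_noise
    hR.indepFun hR.integrable_noise_sq hR.integrable_regressor_cube

lemma integral_residualProd_self_eq (hR : IsRegressionPair P (Z 0) (ε 0)) (hφ : IsSigmoidal φ)
    (W₀ : EuclideanSpace ℝ A) :
    (∫ ω, residualProd φ A W₀ (Z 0 ω, ε 0 ω) W₀ ∂P) = fun i j => secondMoment P (ε 0) i j := by
  ext i j
  exact congrFun (congrFun (hR.integral_residualProd_self hφ W₀) i) j

/-- The limit of the second derivative of the cost function. -/
theorem exists_limit_fderiv_fderiv_noiseCost (hR : IsRegressionPair P (Z 0) (ε 0))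
    (hφ : IsSigmoidal φ) (W₀ : EuclideanSpace ℝ A) (hΓ : (secondMoment P (ε 0)).det ≠ 0)
    (hindep : iIndepFun (fun t ω => (Z t ω, ε t ω)) P)
    (hident : ∀ t, IdentDistrib (fun ω => (Z t ω, ε t ω)) (fun ω => (Z 0 ω, ε 0 ω)) P P) :
    ∃ B : EuclideanSpace ℝ A →L[ℝ] EuclideanSpace ℝ A →L[ℝ] ℝ,
      (∀ k l, B (EuclideanSpace.single k 1) (EuclideanSpace.single l 1) =
        2 * infoMatrix P (mlp φ A) (Z 0) (secondMoment P (ε 0)) W₀ k l) ∧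
      ∀ᵐ ω ∂P, (∀ᶠ q : ℕ × EuclideanSpace ℝ A in atTop ×ˢ 𝓝 W₀,
          ContDiffAt ℝ 2 (noiseCost φ A W₀ (fun t => (Z t ω, ε t ω)) q.1) q.2) ∧
        Tendsto (fun q : ℕ × EuclideanSpace ℝ A =>
          fderiv ℝ (fderiv ℝ (noiseCost φ A W₀ (fun t => (Z t ω, ε t ω)) q.1)) q.2)
          (atTop ×ˢ 𝓝 W₀) (𝓝 B) := by
  have hD := hR.isDominatedC3 hφ W₀
  have h₀ := hD.ae_tendsto (X := fun t ω => (Z t ω, ε t ω)) hindep hident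
  have h₁ := hD.ae_tendsto_fderiv (X := fun t ω => (Z t ω, ε t ω)) hindep hident
  have h₂ := hD.ae_tendsto_fderiv_fderiv (X := fun t ω => (Z t ω, ε t ω)) hindep hident
  refine ⟨(ContinuousLinearMap.compL ℝ (EuclideanSpace ℝ A) (Fin d → Fin d → ℝ) ℝ
    (fderiv ℝ (fun M : Fin d → Fin d → ℝ => Real.log (Matrix.of M).det)
      (fun i j => secondMoment P (ε 0) i j))).comp
    (∫ ω, fderiv ℝ (fderiv ℝ (residualProd φ A W₀ (Z 0 ω, ε 0 ω))) W₀ ∂P),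
    fun k l => hR.fderiv_log_det_integral hφ W₀ hΓ k l, ?_⟩
  filter_upwards [h₀, h₁, h₂] with ω t₀ t₁ t₂
  have s₀ := t₀ W₀
  have s₁ := t₁ W₀
  rw [hR.integral_residualProd_self_eq hφ] at s₀
  rw [hR.integral_fderiv_residualProd hφ] at s₁
  have h := eventually_contDiffAt_comp_and_tendsto
    (fun n => (contDiff_sampleMean (hD.contDiff) (fun t => (Z t ω, ε t ω)) n).of_le (by norm_num))
    (contDiffAt_log_det (n := 2) (M := fun i j => secondMoment P (ε 0) i j) hΓ) s₀ s₁ (t₂ W₀)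
  exact h

/-- Asymptotic normality of the gradient of the cost function. -/
theorem tendstoInDistribution_gradient_noiseCost (hR : IsRegressionPair P (Z 0) (ε 0))
    (hφ : IsSigmoidal φ) (W₀ : EuclideanSpace ℝ A) (hΓ : (secondMoment P (ε 0)).det ≠ 0)
    (hX : ∀ t, Measurable fun ω => (Z t ω, ε t ω))
    (hindep : iIndepFun (fun t ω => (Z t ω, ε t ω)) P)
    (hident : ∀ t, IdentDistrib (fun ω => (Z t ω, ε t ω)) (fun ω => (Z 0 ω, ε 0 ω)) P P) :
    TendstoInDistribution (fun (n : ℕ) ω =>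
        √(n : ℝ) • gradient (noiseCost φ A W₀ (fun t => (Z t ω, ε t ω)) n) W₀) atTop
      (id : EuclideanSpace ℝ A → EuclideanSpace ℝ A) (fun _ => P)
      (multivariateGaussian 0
        ((4 : ℝ) • infoMatrix P (mlp φ A) (Z 0) (secondMoment P (ε 0)) W₀)) := by
  have hD := hR.isDominatedC3 hφ W₀
  have hL : ContDiffAt ℝ 2 (fun M : Fin d → Fin d → ℝ => Real.log (Matrix.of M).det)
      (∫ ω, residualProd φ A W₀ (Z 0 ω, ε 0 ω) W₀ ∂P) := by
    rw [hR.integral_residualProd_self_eq hφ]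
    exact contDiffAt_log_det hΓ
  have h := hD.tendstoInDistribution_gradient (X := fun t ω => (Z t ω, ε t ω)) hindep hident hL
    (hR.integral_fderiv_residualProd hφ W₀) (hR.memLp_fderiv_residualProd hφ W₀)
    fun n => (hD.measurable_gradient_log hX contDiff_det n W₀).aemeasurable
  rw [hR.integral_residualProd_self_eq hφ, hR.momentMatrix_score hφ W₀ hΓ] at h
  exact h

/-- The limit of the empirical covariance matrix exceeds that of the noise by a second moment
matrix. -/
lemma integral_residualProd_eq_add (hR : IsRegressionPair P (Z 0) (ε 0)) (hφ : IsSigmoidal φ)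
    (W₀ W : EuclideanSpace ℝ A) :
    Matrix.of (∫ ω, residualProd φ A W₀ (Z 0 ω, ε 0 ω) W ∂P) =
      secondMoment P (ε 0) + momentMatrix P fun ω => mlp φ A W₀ (Z 0 ω) - mlp φ A W (Z 0 ω) := by
  ext i j
  exact hR.integral_residualProd hφ W₀ W i j

lemma memLp_mlp_sub (hR : IsRegressionPair P (Z 0) (ε 0)) (hφ : IsSigmoidal φ)
    (W₀ W : EuclideanSpace ℝ A) :
    MemLp (fun ω => mlp φ A W₀ (Z 0 ω) - mlp φ A W (Z 0 ω)) 2 P := by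
  rw [memLp_piLp_iff]
  intro i
  obtain ⟨C, hC⟩ := exists_norm_mlp_sub_le (φ := φ) (p := p) hφ W₀ W i
  have hm : ∀ W : EuclideanSpace ℝ A, Measurable fun z : EuclideanSpace ℝ (Fin p) =>
      mlp φ A W z i := fun W =>
    measurable_of_contDiff_param (f := fun z W => mlp φ A W z i) (contDiff_mlp hφ i) W
  exact MemLp.of_bound (((hm W₀).sub (hm W)).comp hR.measurable_regressor).aestronglyMeasurable C
    (Eventually.of_forall fun ω => hC (Z 0 ω))

lemma det_integral_residualProd_pos (hR : IsRegressionPair P (Z 0) (ε 0)) (hφ : IsSigmoidal φ)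
    (hΓ : (secondMoment P (ε 0)).det ≠ 0) (W₀ W : EuclideanSpace ℝ A) :
    0 < (Matrix.of (∫ ω, residualProd φ A W₀ (Z 0 ω, ε 0 ω) W ∂P)).det := by
  rw [hR.integral_residualProd_eq_add hφ]
  exact ((hR.posSemidef_secondMoment.posDef_iff_det_ne_zero.2 hΓ).add_posSemidef
    (posSemidef_momentMatrix (hR.memLp_mlp_sub hφ W₀ W))).det_pos

/-- The limit of the cost function is minimal only at parameters giving the true regression
function. -/
lemma ae_eq_of_det_le (hR : IsRegressionPair P (Z 0) (ε 0)) (hφ : IsSigmoidal φ)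
    (hΓ : (secondMoment P (ε 0)).det ≠ 0) (W₀ W : EuclideanSpace ℝ A)
    (hle : (Matrix.of (∫ ω, residualProd φ A W₀ (Z 0 ω, ε 0 ω) W ∂P)).det ≤
      (Matrix.of (∫ ω, residualProd φ A W₀ (Z 0 ω, ε 0 ω) W₀ ∂P)).det) :
    ∀ᵐ ω ∂P, mlp φ A W (Z 0 ω) = mlp φ A W₀ (Z 0 ω) := by
  have hmem := hR.memLp_mlp_sub hφ W₀ W
  rw [hR.integral_residualProd_self hφ, hR.integral_residualProd_eq_add hφ] at hle
  have h0 : momentMatrix P (fun ω => mlp φ A W₀ (Z 0 ω) - mlp φ A W (Z 0 ω)) = 0 := by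
    by_contra hne
    exact absurd hle (not_le.2 (det_lt_det_add
      (hR.posSemidef_secondMoment.posDef_iff_det_ne_zero.2 hΓ) (posSemidef_momentMatrix hmem) hne))
  -- The diagonal entries of the vanishing moment matrix are the mean squares of the coordinates.
  have hcoord : ∀ i, ∀ᵐ ω ∂P, (mlp φ A W₀ (Z 0 ω) - mlp φ A W (Z 0 ω)) i = 0 := by
    intro i
    have h₁ : ∫ ω, (mlp φ A W₀ (Z 0 ω) - mlp φ A W (Z 0 ω)) i *
        (mlp φ A W₀ (Z 0 ω) - mlp φ A W (Z 0 ω)) i ∂P = 0 := congrFun (congrFun h0 i) i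
    have h₂ := (integral_eq_zero_iff_of_nonneg (fun ω => mul_self_nonneg _)
      ((memLp_coord hmem i).integrable_mul (memLp_coord hmem i))).1 h₁
    filter_upwards [h₂] with ω hω
    exact mul_self_eq_zero.1 hω
  filter_upwards [ae_all_iff.2 hcoord] with ω hω
  ext i
  have h := hω i
  rw [PiLp.sub_apply, sub_eq_zero] at h
  exact h.symm

end IsRegressionPair

end Cost

section Cost

variable {d p h : ℕ} {φ : ℝ → ℝ} {A : Finset (WeightIndex d p h)}
  {Ω : Type*} [MeasurableSpace Ω] {P : Measure Ω} [IsProbabilityMeasure P]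
  {Z : ℕ → Ω → EuclideanSpace ℝ (Fin p)} {ε : ℕ → Ω → EuclideanSpace ℝ (Fin d)}

lemma tendsto_of_eventually_prod {ι : Type*} [Fintype ι] {W₀ : EuclideanSpace ℝ ι}
    {f : ℕ × EuclideanSpace ℝ ι → Prop} (hf : ∀ᶠ q in atTop ×ˢ 𝓝 W₀, f q) :
    ∀ᶠ n in atTop, f (n, W₀) :=
  (tendsto_id.prodMk (tendsto_const_nhds (x := W₀))).eventually hf

/-- Consistency of the minimum cost estimator, which eventually is a critical point. -/
theorem IsRegressionPair.ae_tendsto_of_isMinOn_noiseCost (hR : IsRegressionPair P (Z 0) (ε 0))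
    (hφ : IsSigmoidal φ) {W₀ : EuclideanSpace ℝ A} (hΓ : (secondMoment P (ε 0)).det ≠ 0)
    (hindep : iIndepFun (fun t ω => (Z t ω, ε t ω)) P)
    (hident : ∀ t, IdentDistrib (fun ω => (Z t ω, ε t ω)) (fun ω => (Z 0 ω, ε 0 ω)) P P)
    {Θ : Set (EuclideanSpace ℝ A)} (hΘ : IsCompact Θ) (hW₀ : W₀ ∈ interior Θ)
    {G : Subgroup (EuclideanSpace ℝ A ≃ₜ EuclideanSpace ℝ A)}
    (hmodel : ∀ W ∈ Θ, (∀ᵐ ω ∂P, mlp φ A W (Z 0 ω) = mlp φ A W₀ (Z 0 ω)) → ∃ g ∈ G, W = g W₀)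
    {What : ℕ → Ω → EuclideanSpace ℝ A} (hmem : ∀ n, ∀ᵐ ω ∂P, What n ω ∈ Θ)
    (hmin : ∀ n, ∀ᵐ ω ∂P, (∀ W ∈ Θ,
      (Matrix.of (sampleMean (residualProd φ A W₀) (fun t => (Z t ω, ε t ω)) n W)).det ≠ 0) →
        IsMinOn (noiseCost φ A W₀ (fun t => (Z t ω, ε t ω)) n) Θ (What n ω))
    (hrep : ∀ n, ∀ᵐ ω ∂P, ∀ g ∈ G, g (What n ω) ∈ Θ → ‖What n ω - W₀‖ ≤ ‖g (What n ω) - W₀‖) :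
    ∀ᵐ ω ∂P, Tendsto (fun n => What n ω) atTop (𝓝 W₀) ∧
      ∀ᶠ n in atTop, fderiv ℝ (noiseCost φ A W₀ (fun t => (Z t ω, ε t ω)) n) (What n ω) = 0 := by
  filter_upwards [(hR.isDominatedC3 hφ W₀).ae_tendsto (X := fun t ω => (Z t ω, ε t ω)) hindep
    hident, ae_all_iff.2 hmem, ae_all_iff.2 hmin, ae_all_iff.2 hrep] with ω h₁ h₂ h₃ h₄
  have hγ := fun W => ((contDiff_det (d := d) (n := 0)).continuous.tendsto _).comp (h₁ W)
  exact tendsto_of_isMinOn_log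
    (γ := fun n W =>
      (Matrix.of (sampleMean (residualProd φ A W₀) (fun t => (Z t ω, ε t ω)) n W)).det)
    (γ₀ := fun W => (Matrix.of (∫ ω, residualProd φ A W₀ (Z 0 ω, ε 0 ω) W ∂P)).det)
    hΘ hγ (hR.det_integral_residualProd_pos hφ hΓ W₀) hW₀
    (fun W hW hle => hmodel W hW (hR.ae_eq_of_det_le hφ hΓ W₀ W hle)) h₂ h₃ h₄

end Cost

end MLPRegression

end

/-! ### The theorem for the observed pairs. -/

theorem mainTheorem2
    {d p h : ℕ} (φ : ℝ → ℝ) (hφ : MLPRegression.IsSigmoidal φ)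
    (A : Finset (MLPRegression.WeightIndex d p h))
    {Ω : Type*} [MeasurableSpace Ω] (P : Measure Ω) [IsProbabilityMeasure P]
    -- the i.i.d. observations, the regression model and its noise
    (Y : ℕ → Ω → EuclideanSpace ℝ (Fin d)) (Z : ℕ → Ω → EuclideanSpace ℝ (Fin p))
    (hY : ∀ t, Measurable (Y t)) (hZ : ∀ t, Measurable (Z t))
    (hindep : iIndepFun (fun t ω => (Y t ω, Z t ω)) P)
    (hident : ∀ t, IdentDistrib (fun ω => (Y t ω, Z t ω)) (fun ω => (Y 0 ω, Z 0 ω)) P P)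
    (W₀ : EuclideanSpace ℝ A) (ε : ℕ → Ω → EuclideanSpace ℝ (Fin d))
    (hmodel : ∀ t ω, Y t ω = MLPRegression.mlp φ A W₀ (Z t ω) + ε t ω)
    (hεZ : IndepFun (ε 0) (Z 0) P)
    (hε2 : Integrable (fun ω => ‖ε 0 ω‖ ^ 2) P)
    (hεmean : ∫ ω, ε 0 ω ∂P = 0)
    (Γ₀ : Matrix (Fin d) (Fin d) ℝ) (hΓ₀ : Γ₀ = MLPRegression.secondMoment P (ε 0))
    (hΓ₀inv : IsUnit Γ₀.det)
    (hZ3 : Integrable (fun ω => ‖Z 0 ω‖ ^ 3) P)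
    -- the compact parameter set, and identifiability up to a finite group of transformations
    (Θ : Set (EuclideanSpace ℝ A)) (hΘ : IsCompact Θ) (hW₀ : W₀ ∈ Θ)
    (G : Subgroup (EuclideanSpace ℝ A ≃ₜ EuclideanSpace ℝ A)) (hG : Finite G)
    (hGinv : ∀ g ∈ G, ∀ W z, MLPRegression.mlp φ A (g W) z = MLPRegression.mlp φ A W z)
    (hident_model : ∀ W ∈ Θ,
      (∀ᵐ ω ∂P, MLPRegression.mlp φ A W (Z 0 ω) = MLPRegression.mlp φ A W₀ (Z 0 ω)) →
        ∃ g ∈ G, W = g W₀)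
    -- the cost function and the matrix `I₀`
    (U : ℕ → Ω → EuclideanSpace ℝ A → ℝ)
    (hU : U = fun n ω => MLPRegression.logDetCost (MLPRegression.mlp φ A)
      (fun t => Y t ω) (fun t => Z t ω) n)
    (I₀ : Matrix A A ℝ)
    (hI₀ : I₀ = MLPRegression.infoMatrix P (MLPRegression.mlp φ A) (Z 0) Γ₀ W₀)
    -- the estimator: a minimizer of `U n` over `Θ` as soon as `U n` is finite on `Θ`, its class
    -- modulo `G` being represented by the element of `Θ` closest to `W₀`
    (What : ℕ → Ω → EuclideanSpace ℝ A) (hWhat : ∀ n, AEMeasurable (What n) P)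
    (hWhatΘ : ∀ n, ∀ᵐ ω ∂P, What n ω ∈ Θ)
    (hWhatmin : ∀ n, ∀ᵐ ω ∂P,
      (∀ W ∈ Θ, (MLPRegression.empCov (MLPRegression.mlp φ A)
        (fun t => Y t ω) (fun t => Z t ω) n W).det ≠ 0) → IsMinOn (U n ω) Θ (What n ω))
    (hWhatrep : ∀ n, ∀ᵐ ω ∂P, ∀ g ∈ G, g (What n ω) ∈ Θ →
      ‖What n ω - W₀‖ ≤ ‖g (What n ω) - W₀‖) :
    -- the objects below are well defined
    ((∀ (k l : A) (i j : Fin d), Integrable (fun ω =>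
        MLPRegression.partialDeriv k (fun W => MLPRegression.mlp φ A W (Z 0 ω)) W₀ i *
        MLPRegression.partialDeriv l (fun W => MLPRegression.mlp φ A W (Z 0 ω)) W₀ j) P) ∧
      I₀.PosSemidef ∧
      ∀ᵐ ω ∂P, ∀ᶠ n in atTop, ContDiffAt ℝ 2 (U n ω) W₀) ∧
    (∀ᵐ ω ∂P, Tendsto (fun n => MLPRegression.hessianMatrix (U n ω) W₀) atTop
      (𝓝 ((2 : ℝ) • I₀))) ∧
    TendstoInDistribution (fun (n : ℕ) ω => √(n : ℝ) • gradient (U n ω) W₀) atTop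
      (id : EuclideanSpace ℝ A → EuclideanSpace ℝ A) (fun _ => P)
      (multivariateGaussian 0 ((4 : ℝ) • I₀)) ∧
    (W₀ ∈ interior Θ → IsUnit I₀.det →
      TendstoInDistribution (fun (n : ℕ) ω => √(n : ℝ) • (What n ω - W₀)) atTop
        (id : EuclideanSpace ℝ A → EuclideanSpace ℝ A) (fun _ => P)
        (multivariateGaussian 0 I₀⁻¹)) := by
  subst hU hI₀ hΓ₀
  have hYε : ∀ ω, (fun t => Y t ω) = fun t => MLPRegression.mlp φ A W₀ (Z t ω) + ε t ω :=
    fun ω => funext fun t => hmodel t ω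
  simp only [hYε] at hWhatmin ⊢
  have hcost : ∀ (n : ℕ) (ω : Ω), MLPRegression.logDetCost (MLPRegression.mlp φ A)
      (fun t => MLPRegression.mlp φ A W₀ (Z t ω) + ε t ω) (fun t => Z t ω) n =
      MLPRegression.noiseCost φ A W₀ (fun t => (Z t ω, ε t ω)) n := by
    intro n ω
    ext W
    rw [MLPRegression.logDetCost, MLPRegression.logDetCost_mlp W₀ (fun t => Z t ω)
      (fun t => ε t ω), MLPRegression.noiseCost]
  have hcov : ∀ (n : ℕ) (ω : Ω) (W : EuclideanSpace ℝ A),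
      MLPRegression.empCov (MLPRegression.mlp φ A)
        (fun t => MLPRegression.mlp φ A W₀ (Z t ω) + ε t ω) (fun t => Z t ω) n W =
      Matrix.of (MLPRegression.sampleMean (MLPRegression.residualProd φ A W₀)
        (fun t => (Z t ω, ε t ω)) n W) := fun n ω W =>
    MLPRegression.logDetCost_mlp W₀ (fun t => Z t ω) (fun t => ε t ω) n W
  simp only [hcost, hcov] at hWhatmin ⊢
  have hmlp : Measurable (MLPRegression.mlp φ A W₀) := by
    refine (PiLp.continuous_toLp 2 fun _ : Fin d => ℝ).measurable.comp
      (measurable_pi_lambda _ fun i => ?_)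
    exact MLPRegression.measurable_of_contDiff_param
      (f := fun z W => MLPRegression.mlp φ A W z i) (MLPRegression.contDiff_mlp hφ i) W₀
  have hpair : Measurable fun q : EuclideanSpace ℝ (Fin d) × EuclideanSpace ℝ (Fin p) =>
      (q.2, q.1 - MLPRegression.mlp φ A W₀ q.2) :=
    measurable_snd.prodMk (measurable_fst.sub (hmlp.comp measurable_snd))
  -- The noise is a measurable function of the observation, so the pairs `(Z, ε)` inherit
  -- independence and common law from `(Y, Z)`.
  have hX : ∀ t, (fun ω => (Z t ω, ε t ω)) =
      (fun q : EuclideanSpace ℝ (Fin d) × EuclideanSpace ℝ (Fin p) =>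
        (q.2, q.1 - MLPRegression.mlp φ A W₀ q.2)) ∘ fun ω => (Y t ω, Z t ω) := by
    intro t
    ext1 ω
    simp [hmodel t ω]
  have hXm : ∀ t, Measurable fun ω => (Z t ω, ε t ω) := by
    intro t
    rw [hX t]
    exact hpair.comp ((hY t).prodMk (hZ t))
  have hXindep : iIndepFun (fun t ω => (Z t ω, ε t ω)) P := by
    have h := hindep.comp (fun _ (q : EuclideanSpace ℝ (Fin d) × EuclideanSpace ℝ (Fin p)) =>
      (q.2, q.1 - MLPRegression.mlp φ A W₀ q.2)) fun _ => hpair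
    exact (funext hX : (fun t ω => (Z t ω, ε t ω)) = _) ▸ h
  have hXident : ∀ t, IdentDistrib (fun ω => (Z t ω, ε t ω)) (fun ω => (Z 0 ω, ε 0 ω)) P P := by
    intro t
    rw [hX t, hX 0]
    exact (hident t).comp hpair
  have hR : MLPRegression.IsRegressionPair P (Z 0) (ε 0) :=
    ⟨hZ 0, measurable_snd.comp (hXm 0), hεZ, hε2, hεmean, hZ3⟩
  have hΓ := hΓ₀inv.ne_zero
  have hpsd := hR.posSemidef_infoMatrix hφ W₀ hΓ
  have hsymm : (MLPRegression.infoMatrix P (MLPRegression.mlp φ A) (Z 0)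
      (MLPRegression.secondMoment P (ε 0)) W₀).transpose = MLPRegression.infoMatrix P
        (MLPRegression.mlp φ A) (Z 0) (MLPRegression.secondMoment P (ε 0)) W₀ := hpsd.isHermitian
  have hscore := hR.tendstoInDistribution_gradient_noiseCost hφ W₀ hΓ hXm hXindep hXident
  obtain ⟨B, hB, hlim⟩ :=
    hR.exists_limit_fderiv_fderiv_noiseCost hφ W₀ hΓ hXindep hXident
  have hBinner := MLPRegression.eq_inner_toEuclideanCLM (B := B)
    (H := (2 : ℝ) • MLPRegression.infoMatrix P (MLPRegression.mlp φ A) (Z 0)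
      (MLPRegression.secondMoment P (ε 0)) W₀) (by rw [Matrix.transpose_smul, hsymm]) hB
  refine ⟨⟨fun k l i j => ?_, hpsd, ?_⟩, ?_, hscore, fun hint hI => ?_⟩
  · simp only [MLPRegression.partialDeriv_mlp hφ]
    exact hR.integrable_outputDeriv_mul hφ W₀ _ _ i j
  · filter_upwards [hlim] with ω hω
    exact MLPRegression.tendsto_of_eventually_prod hω.1
  · filter_upwards [hlim] with ω hω
    have hcd := MLPRegression.tendsto_of_eventually_prod hω.1
    have ht := hω.2.comp (tendsto_id.prodMk (tendsto_const_nhds (x := W₀)))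
    refine tendsto_pi_nhds.2 fun k => tendsto_pi_nhds.2 fun l => ?_
    have hkl := (((ContinuousLinearMap.apply ℝ ℝ (EuclideanSpace.single k (1 : ℝ))).comp
      (ContinuousLinearMap.apply ℝ (EuclideanSpace ℝ A →L[ℝ] ℝ)
        (EuclideanSpace.single l (1 : ℝ)))).continuous.tendsto B).comp ht
    -- The Hessian matrix differentiates first in `k` and then in `l`, which swaps the arguments of
    -- `B`; the symmetry of `I₀` restores the order.
    have hval : B (EuclideanSpace.single l 1) (EuclideanSpace.single k 1) =
        ((2 : ℝ) • MLPRegression.infoMatrix P (MLPRegression.mlp φ A) (Z 0)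
          (MLPRegression.secondMoment P (ε 0)) W₀) k l := by
      exact (hB l k).trans (congrArg (2 * ·) (congrFun (congrFun hsymm k) l))
    rw [← hval]
    refine hkl.congr' ?_
    filter_upwards [hcd] with n hn
    exact (MLPRegression.hessianMatrix_apply hn k l).symm
  · have hcons := hR.ae_tendsto_of_isMinOn_noiseCost hφ hΓ hXindep hXident hΘ hint hident_model
      hWhatΘ hWhatmin hWhatrep
    have h2 : IsUnit ((2 : ℝ) • MLPRegression.infoMatrix P (MLPRegression.mlp φ A) (Z 0)
        (MLPRegression.secondMoment P (ε 0)) W₀).det := by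
      rw [Matrix.det_smul]
      exact (isUnit_iff_ne_zero.2 (by positivity)).mul hI
    have hfin := MLPRegression.tendstoInDistribution_sqrt_smul_sub
      (U := fun n ω => MLPRegression.noiseCost φ A W₀ (fun t => (Z t ω, ε t ω)) n) hBinner h2
      (hpsd.smul (by norm_num)) (hlim.mono fun ω hω => hω.1) (hlim.mono fun ω hω => hω.2) hscore
      hWhat (hcons.mono fun ω hω => hω.1) (hcons.mono fun ω hω => hω.2)
    -- It remains to compute `(2I)⁻¹ (4I) ((2I)⁻¹)ᵀ = I⁻¹`.
    convert hfin using 2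
    set I := MLPRegression.infoMatrix P (MLPRegression.mlp φ A) (Z 0)
      (MLPRegression.secondMoment P (ε 0)) W₀ with hIdef
    have hinv : ((2 : ℝ) • I)⁻¹ = (2 : ℝ)⁻¹ • I⁻¹ := by
      refine Matrix.inv_eq_left_inv ?_
      rw [Matrix.smul_mul, Matrix.mul_smul, smul_smul, Matrix.nonsing_inv_mul _ hI]
      norm_num
    rw [hinv, Matrix.transpose_smul, Matrix.transpose_nonsing_inv, hsymm]
    simp only [Matrix.smul_mul, Matrix.mul_smul, smul_smul]
    rw [Matrix.nonsing_inv_mul _ hI, one_mul]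
    norm_num
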